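/- **Lemma (interpolation errors on the coarser mesh).** Let $k\ge 1$ be an integer, $\beta,\gamma>0$, $\sigma\ge k+1$, and let $0=\xi_0<\xi_1<\dots<\xi_k=1$ be fixed reference interpolation points. Let $\Omega=(0,2)$, $0<\varepsilon\le 1$, and let $N\ge 4$ be divisible by $4$. *Mesh.* Put $\lambda=\frac{\sigma\varepsilon}{\beta}\ln N$, and $\mu=\frac{1}{\beta}\varepsilon^{(k-1)/k}$ for $k\ge 2$, $\mu=\frac12$ for $k=1$; assume $\lambda\le\frac12$ and $\mu\le\frac12$. Let $\phi$ be continuous and increasing on $[0,\frac12]$ with $\phi(0)=0$, $\phi(\frac12)=\ln N$, differentiable up to finitely many points, put $\psi=\mathrm e^{-\phi}$ with $\psi'$ bounded, and let $\max|\psi'|$ be the supremum of $|\psi'|$ over $[0,\frac12]$ (without the exceptional points). The mesh nodes are $$x_i=\begin{cases}\frac{\sigma\varepsilon}{\beta}\phi\left(\frac{2i}{N}\right),&0\le i\le \frac N4,\\ \frac{4i}{N}(1-\lambda)+2\lambda-1,&\frac N4\le i\le\frac N2,\\ 1+\mu\left(\frac{4i}{N}-2\right),&\frac N2\le i\le\frac{3N}4,\\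 \frac{4i}{N}(1-\mu)+4\mu-2,&\frac{3N}4\le i\le N.\end{cases}$$ Let $h_1=\max_{1\le i\le N/4}(x_i-x_{i-1})$ be the mesh width in $(0,\lambda)$, and assume $h_1\le K_1\varepsilon$. *Functions.* Let $u\in C[0,2]$ with $u(0)=u(2)=0$ satisfy $u=S+E+W$ on $(0,1)\cup(1,2)$, where $S\in H^{k+1}(0,1)$ and $S\in H^{k+1}(1,2)$ (continuous representatives), $E\in C^{k+1}(0,2)$, $W\in C^{k+1}(1,2)$, $W=0$ on $(0,1)$, and for all $0\le\ell\le k+1$ $$\|S^{(\ell)}\|_{L^2(0,1)}+\|S^{(\ell)}\|_{L^2(1,2)}\le K,\qquad |E^{(\ell)}(x)|\le K\varepsilon^{-\ell}\mathrm e^{-\beta x/\varepsilon}\ (0<x<2),\qquad |W^{(\ell)}(x)|\le K\varepsilon^{1-\ell}\mathrm e^{-\beta(x-1)/\varepsilon}\ (1<x<2).$$ (This is the solution decomposition of the convection-diffusion problem $-\varepsilon u''-bu'+cu+d\,u(\cdot-1)=f$ on $\Omega$ with $b\ge\beta$; in particular $u\in H_0^1(\Omega)$.) For a function $v$, let $Iv$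 be its piecewise Lagrange interpolant of degree $k$: on each cell $(x_{i-1},x_i)$ it interpolates $v$ in the points $x_{i-1}+(x_i-x_{i-1})\xi_j$, where the values of $v$ at the end points of the cell are the limits from inside the cell ($S$ and $W$ may jump at $x=1$). Let $|||v|||=\left(\varepsilon\|v'\|_{L^2(\Omega)}^2+\gamma\|v\|_{L^2(\Omega)}^2\right)^{1/2}$, with $v'$ the weak derivative on $\Omega$. *Claim.* There is a constant $C$ depending only on $k,\beta,\gamma,\sigma,K,K_1$ and $\xi_0,\dots,\xi_k$, not on $\varepsilon$, $N$, $\phi$ and $u,S,E,W$, such that, whenever $\mathrm e^{-\varepsilon^{-1/k}}\le N^{1-k}$, the function $u-Iu$ has a weak derivative in $L^2(\Omega)$ and $$\|u-Iu\|_{L^2(\Omega)}\le C\,(h_1+N^{-1}\max|\psi'|)^{k+1/2},\qquad |||u-Iu|||\le C\,(h_1+N^{-1}\max|\psi'|)^{k},$$ $$\|W-IW\|_{L^2(\Omega)}\le C\,\varepsilon^{1/2}N^{-k},\qquad \|E-IE\|_{L^2((\lambda,1)\cup(1+\mu,2))}\le C\,N^{-(k+1)},$$ $$\|E-IE\|_{L^2((0,\lambda)\cup(1,1+\mu))}\le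 C\,\varepsilon^{1/2}(N^{-1}\max|\psi'|)^k.$$ -/

import Mathlib

open MeasureTheory Set Filter Topology
open scoped ENNReal ContDiff

noncomputable section

namespace CoarseMesh

/-! ### Norms and weak derivatives on intervals -/

/-- The norm of `L²(D)`, with value `∞` when it is not finite. -/
def L2norm (v : ℝ → ℝ) (D : Set ℝ) : ℝ≥0∞ :=
  eLpNorm v 2 (volume.restrict D)

/-- `g` is the weak derivative of `v` on the open interval `(a, b)`. -/
def HasWeakDeriv (a b : ℝ) (v g : ℝ → ℝ) : Prop :=
  LocallyIntegrableOn v (Ioo a b) ∧ LocallyIntegrableOn g (Ioo a b) ∧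
    ∀ η : ℝ → ℝ, ContDiff ℝ ∞ η → HasCompactSupport η → tsupport η ⊆ Ioo a b →
      ∫ x in Ioo a b, v x * deriv η x = -∫ x in Ioo a b, g x * η x

/-- The energy norm `(ε ‖v'‖² + γ ‖v‖²)^{1/2}` on `Ω = (0, 2)`, where `v'` is the weak derivative
of `v` on the whole of `Ω`. As `v'` is unique up to null sets, the infimum runs over a
single value if `v` has a weak derivative; the norm is `∞` if it has none. -/
def energyNorm (ε γ : ℝ) (v : ℝ → ℝ) : ℝ≥0∞ :=
  ⨅ (g : ℝ → ℝ) (_ : HasWeakDeriv 0 2 v g),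
    (ENNReal.ofReal ε * L2norm g (Ioo 0 2) ^ 2 +
      ENNReal.ofReal γ * L2norm v (Ioo 0 2) ^ 2) ^ (1 / 2 : ℝ)

/-! ### The mesh -/

/-- The mesh characterising function `ψ = exp (-φ)`. -/
def psi (φ : ℝ → ℝ) (t : ℝ) : ℝ := Real.exp (-φ t)

/-- `max |ψ'|` over `[0, 1/2]`; finitely many points where `ψ` is not differentiable do not
contribute. -/
def maxAbsDerivPsi (φ : ℝ → ℝ) : ℝ :=
  sSup ((fun t => |deriv (psi φ) t|) '' Ioo 0 (1 / 2))

/-- `φ` is a mesh defining function for `N` cells: continuous and increasing on `[0, 1/2]`, with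
`φ 0 = 0` and `φ (1/2) = ln N`, differentiable up to finitely many points, with `ψ'` bounded. -/
structure IsMeshFunction (N : ℕ) (φ : ℝ → ℝ) : Prop where
  continuousOn : ContinuousOn φ (Icc 0 (1 / 2))
  monotoneOn : MonotoneOn φ (Icc 0 (1 / 2))
  map_zero : φ 0 = 0
  map_half : φ (1 / 2) = Real.log N
  differentiableAt : ∃ P : Finset ℝ, ∀ t ∈ Ioo (0 : ℝ) (1 / 2), t ∉ P → DifferentiableAt ℝ φ t
  bddAbove : BddAbove ((fun t => |deriv (psi φ) t|) '' Ioo 0 (1 / 2))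

/-- The transition point `λ` of the strong layer. -/
def lam (β σ ε : ℝ) (N : ℕ) : ℝ := σ * ε / β * Real.log N

/-- The transition parameter `μ` of the weak layer, which is `1/2` for `k = 1`. -/
def mu (k : ℕ) (β ε : ℝ) : ℝ :=
  if k = 1 then 1 / 2 else ε ^ (((k : ℝ) - 1) / k) / β

/-- The nodes `x_i`, `0 ≤ i ≤ N`, of the coarser mesh. -/
def node (k : ℕ) (β σ ε : ℝ) (N : ℕ) (φ : ℝ → ℝ) (i : ℕ) : ℝ :=
  if 4 * i ≤ N then σ * ε / β * φ (2 * i / N)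
  else if 2 * i ≤ N then 4 * i / N * (1 - lam β σ ε N) + 2 * lam β σ ε N - 1
  else if 4 * i ≤ 3 * N then 1 + mu k β ε * (4 * i / N - 2)
  else 4 * i / N * (1 - mu k β ε) + 4 * mu k β ε - 2

/-- The (largest) mesh width `h₁` in the strong layer region `(0, λ)`. -/
def h₁ (k : ℕ) (β σ ε : ℝ) (N : ℕ) (φ : ℝ → ℝ) : ℝ :=
  ⨆ i : Fin (N / 4), (node k β σ ε N φ (i + 1) - node k β σ ε N φ i)

/-! ### Lagrange interpolation -/

/-- The Lagrange interpolation polynomial of degree at most `k` of `v` on the cell `(a, b)`, in the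
points `a + (b - a) ξ_j`. The values of `v` are limits from inside the cell. They are the usual
values where `v` is continuous, and one-sided limits at an end point of the cell where `v` jumps. -/
def cellInterp {k : ℕ} (ξ : Fin (k + 1) → ℝ) (a b : ℝ) (v : ℝ → ℝ) : Polynomial ℝ :=
  Lagrange.interpolate Finset.univ (fun j => a + (b - a) * ξ j)
    (fun j => extendFrom (Ioo a b) v (a + (b - a) * ξ j))

/-- The piecewise Lagrange interpolant `Iv` on the mesh `x 0 ≤ x 1 ≤ … ≤ x N`. -/
def interp {k : ℕ} (ξ : Fin (k + 1) → ℝ) (N : ℕ) (x : ℕ → ℝ) (v : ℝ → ℝ) (y : ℝ) : ℝ :=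
  ∑ i ∈ Finset.range N,
    (Ico (x i) (x (i + 1))).indicator (fun z => (cellInterp ξ (x i) (x (i + 1)) v).eval z) y

/-! ### The solution decomposition -/

/-- `v` is the continuous representative of a function in `H^m(0,1)` and in `H^m(1,2)`, and
`‖v^(ℓ)‖_{L²(0,1)} + ‖v^(ℓ)‖_{L²(1,2)} ≤ K` for all `ℓ ≤ m`; here `D ℓ` is `v^(ℓ)`. -/
def BrokenSobolevBound (m : ℕ) (K : ℝ) (v : ℝ → ℝ) : Prop :=
  ContinuousOn v (Ioo 0 1) ∧ ContinuousOn v (Ioo 1 2) ∧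
    ∃ D : ℕ → ℝ → ℝ, D 0 = v ∧
      (∀ ℓ < m, HasWeakDeriv 0 1 (D ℓ) (D (ℓ + 1)) ∧ HasWeakDeriv 1 2 (D ℓ) (D (ℓ + 1))) ∧
      ∀ ℓ ≤ m, L2norm (D ℓ) (Ioo 0 1) + L2norm (D ℓ) (Ioo 1 2) ≤ ENNReal.ofReal K

/-- `u = S + E + W` with a smooth part `S`, a strong layer part `E` and a weak layer part
`W`, where `K` is the constant in the bounds on their derivatives up to order `m`. `S` and `W` may
jump at `1`. Continuity of `u`, its boundary values and the bounds give `u ∈ H¹₀(0,2)`. -/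
structure IsDecomposition (m : ℕ) (β ε K : ℝ) (u S E W : ℝ → ℝ) : Prop where
  continuousOn_u : ContinuousOn u (Icc 0 2)
  u_zero : u 0 = 0
  u_two : u 2 = 0
  eq_add : ∀ x ∈ Ioo (0 : ℝ) 1 ∪ Ioo 1 2, u x = S x + E x + W x
  bound_S : BrokenSobolevBound m K S
  contDiffOn_E : ContDiffOn ℝ m E (Ioo 0 2)
  bound_E : ∀ ℓ ≤ m, ∀ x ∈ Ioo (0 : ℝ) 2,
    |iteratedDeriv ℓ E x| ≤ K * ε ^ (-(ℓ : ℝ)) * Real.exp (-β * x / ε)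
  W_eq_zero : ∀ x ∈ Ioo (0 : ℝ) 1, W x = 0
  contDiffOn_W : ContDiffOn ℝ m W (Ioo 1 2)
  bound_W : ∀ ℓ ≤ m, ∀ x ∈ Ioo (1 : ℝ) 2,
    |iteratedDeriv ℓ W x| ≤ K * ε ^ (1 - (ℓ : ℝ)) * Real.exp (-β * (x - 1) / ε)

end CoarseMesh

end

noncomputable section

namespace CoarseMesh

/-! Interpolation is linear on every cell and `1` is a node, so the error splits into the errors of
`S`, `E` and `W`. On a cell of width `h`, interpolation reproduces polynomials of degree `k`.
Subtracting a Taylor polynomial of degree `m ≤ k` and using the Lebesgue constant bounds the error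
by `h^(m+1)` and its derivative by `h^m`, each times the norm of the derivative of order `m + 1`
(`IsLebesgueBound.L2norm_cell_le`). What remains is to choose `m` in each region and to balance mesh
width against decay.

Smooth part: `m = k`, and all widths are at most `h₁ + 4/N`.

Strong layer: in `(0, λ)` the width of the cell around `y` is at most a constant times `ε N⁻¹
max|ψ'| exp(βy/(σε))` (`width_strongLayer_le`). The decay of `E` pays for this growth: since `σ ≥ k
+ 1`, every power `p ≤ k + 1/2` of `N⁻¹ max|ψ'|` leaves at least the decay `exp(-βy/(2σε))`
(`pow_width_mul_le`), whose norm supplies `√ε`. Beyond `λ` the layer is below a constant times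
`N^(-(k+1))`, and stability of interpolation suffices.

Weak layer: in `(1, 1 + μ)` one uses `μ^k ≲ ε^(k-1)`. Beyond `1 + μ` the assumption on `ε` makes the
exponential at most `N^(1-k)`, and interpolation of low order adds the missing powers. This yields
both `√ε N^(-k)` and `ε^(-1/2) N^(-(k+1))`; the smaller is at most `N^(-(k+1/2))`.

Weak derivative: the end points of a cell are interpolation points, so `u - Iu` vanishes at all
nodes and is the primitive of its piecewise derivative (`hasWeakDeriv_interp_error`). Only `u` has
to be continuous at `1`, not `S` or `W`. The derivative error is of size `ε^(-1/2)` times the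
asserted rate, which the weight `ε` in the energy norm absorbs. -/

/-! ### Weak derivatives on an interval and primitives -/

lemma integrable_mul_of_tsupport_subset {U : Set ℝ} {w η : ℝ → ℝ}
    (hw : LocallyIntegrableOn w U) (hη : Continuous η) (hc : HasCompactSupport η)
    (hs : tsupport η ⊆ U) : Integrable (fun x => w x * η x) := by
  have h1 : IntegrableOn w (tsupport η) := hw.integrableOn_compact_subset hs hc
  have h2 : IntegrableOn (fun x => w x * η x) (tsupport η) :=
    h1.mul_continuousOn hη.continuousOn hc
  refine h2.integrable_of_forall_notMem_eq_zero fun x hx => ?_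
  simp [image_eq_zero_of_notMem_tsupport hx]

lemma setIntegral_eq_integral_of_tsupport {a b : ℝ} {w η : ℝ → ℝ} (hs : tsupport η ⊆ Ioo a b) :
    ∫ x in Ioo a b, w x * η x = ∫ x, w x * η x := by
  refine setIntegral_eq_integral_of_forall_compl_eq_zero fun x hx => ?_
  simp [image_eq_zero_of_notMem_tsupport (fun h => hx (hs h))]

/-- A primitive of an integrable function is absolutely continuous, so integration by parts applies;
the boundary terms vanish because test functions are zero at `a` and `b`. -/
lemma HasWeakDeriv.of_primitive {a b c : ℝ} (hab : a < b) {v g : ℝ → ℝ}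
    (hg : IntegrableOn g (Ioo a b)) (hv : ∀ x ∈ Ioo a b, v x = c + ∫ t in a..x, g t) :
    HasWeakDeriv a b v g := by
  have hgi : IntervalIntegrable g volume a b :=
    (intervalIntegrable_iff_integrableOn_Ioo_of_le hab.le).2 hg
  have hac : AbsolutelyContinuousOnInterval (fun x => c + ∫ t in a..x, g t) a b := by
    have h0 := hgi.absolutelyContinuousOnInterval_intervalIntegral (c := a) (by simp)
    have h1 : AbsolutelyContinuousOnInterval (fun _ : ℝ => c) a b :=
      ((LipschitzWith.const c).lipschitzOnWith).absolutelyContinuousOnInterval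
    exact h1.add h0
  refine ⟨?_, hg.locallyIntegrableOn, ?_⟩
  · have : ContinuousOn v (Ioo a b) := by
      refine ContinuousOn.congr ?_ hv
      exact hac.continuousOn.mono (Ioo_subset_Icc_self.trans Icc_subset_uIcc)
    exact this.locallyIntegrableOn measurableSet_Ioo
  · intro η hη hηc hηs
    have hηac : AbsolutelyContinuousOnInterval η a b :=
      (hη.of_le (by simp)).contDiffOn.absolutelyContinuousOnInterval
    have hηa : η a = 0 := image_eq_zero_of_notMem_tsupport fun h => lt_irrefl _ (hηs h).1
    have hηb : η b = 0 := image_eq_zero_of_notMem_tsupport fun h => lt_irrefl _ (hηs h).2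
    have key := hac.integral_mul_deriv_eq_deriv_mul hηac
    rw [hηa, hηb] at key
    simp only [mul_zero, sub_zero, zero_sub] at key
    rw [← integral_Ioc_eq_integral_Ioo, ← integral_Ioc_eq_integral_Ioo,
      ← intervalIntegral.integral_of_le hab.le, ← intervalIntegral.integral_of_le hab.le]
    have e1 : ∫ x in a..b, v x * deriv η x = ∫ x in a..b, (c + ∫ t in a..x, g t) * deriv η x := by
      refine intervalIntegral.integral_congr_ae ?_
      have : ∀ᵐ x : ℝ, x ≠ b := by simp [ae_iff, measure_singleton]
      filter_upwards [this] with x hx hx'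
      rw [uIoc_of_le hab.le] at hx'
      rw [hv x ⟨hx'.1, lt_of_le_of_ne hx'.2 hx⟩]
    rw [e1, key]
    congr 1
    refine intervalIntegral.integral_congr_ae ?_
    filter_upwards [hgi.ae_hasDerivAt_integral] with x hx hx'
    rw [((hx (uIoc_subset_uIcc hx') a (by simp)).const_add c).deriv]

lemma exists_Icc_of_isCompact {a b : ℝ} {T : Set ℝ} (hT : IsCompact T) (hne : T.Nonempty)
    (hs : T ⊆ Ioo a b) : ∃ a' b', a < a' ∧ a' ≤ b' ∧ b' < b ∧ T ⊆ Icc a' b' := by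
  obtain ⟨p, hp⟩ := hT.exists_isLeast hne
  obtain ⟨q, hq⟩ := hT.exists_isGreatest hne
  exact ⟨p, q, (hs hp.1).1, hp.2 hq.1, (hs hq.1).2, fun x hx => ⟨hp.2 hx, hq.2 hx⟩⟩

/-- A test function with vanishing integral is the derivative of a test function. -/
lemma exists_testFunction_deriv_eq {a b : ℝ} {θ : ℝ → ℝ} (hθ : ContDiff ℝ ∞ θ)
    (hc : HasCompactSupport θ) (hs : tsupport θ ⊆ Ioo a b) (h0 : ∫ x, θ x = 0) :
    ∃ ζ : ℝ → ℝ, ContDiff ℝ ∞ ζ ∧ HasCompactSupport ζ ∧ tsupport ζ ⊆ Ioo a b ∧ deriv ζ = θ := by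
  rcases (tsupport θ).eq_empty_or_nonempty with hne | hne
  · have : θ = 0 := by simpa [tsupport_eq_empty_iff] using hne
    refine ⟨0, contDiff_const, HasCompactSupport.zero, by simp [tsupport], ?_⟩
    rw [this]; ext x; simp
  obtain ⟨a', b', ha, hab, hb, hT⟩ := exists_Icc_of_isCompact hc hne hs
  have hd : deriv (fun x => ∫ t in a..x, θ t) = θ := by
    ext x; exact hθ.continuous.deriv_integral θ a x
  -- To the left of the support the integrand is zero; to the right the primitive has already
  -- collected the whole integral, which is zero by `h0`.
  have hz : ∀ x, x ∉ Icc a' b' → ∫ t in a..x, θ t = 0 := by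
    intro x hx
    by_cases hxa : x < a'
    · refine intervalIntegral.integral_zero_ae (Eventually.of_forall fun t ht => ?_)
      refine image_eq_zero_of_notMem_tsupport fun h => ?_
      have h1 := (hT h).1
      have h2 : t ≤ max a x := ht.2
      rcases le_max_iff.1 h2 with h | h <;> linarith
    · have hxb : b' < x := by
        by_contra h
        exact hx ⟨not_lt.1 hxa, not_lt.1 h⟩
      rw [intervalIntegral.integral_eq_integral_of_support_subset, h0]
      intro t ht
      have := hT (subset_tsupport _ ht)
      exact ⟨by linarith [this.1], by linarith [this.2]⟩
  have hsupp : tsupport (fun x => ∫ t in a..x, θ t) ⊆ Icc a' b' := by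
    refine closure_minimal (fun x hx => ?_) isClosed_Icc
    by_contra h
    exact hx (hz x h)
  refine ⟨fun x => ∫ t in a..x, θ t, ?_, ?_, ?_, hd⟩
  · rw [contDiff_infty_iff_deriv]
    exact ⟨fun x => (hθ.continuous.integral_hasStrictDerivAt a x).hasDerivAt.differentiableAt,
      by rw [hd]; exact hθ⟩
  · exact isCompact_Icc.of_isClosed_subset (isClosed_tsupport _) hsupp
  · exact hsupp.trans fun x hx => ⟨ha.trans_le hx.1, hx.2.trans_lt hb⟩

lemma exists_testFunction_integral_eq_one {a b : ℝ} (hab : a < b) :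
    ∃ η : ℝ → ℝ, ContDiff ℝ ∞ η ∧ HasCompactSupport η ∧ tsupport η ⊆ Ioo a b ∧ ∫ x, η x = 1 := by
  let f : ContDiffBump ((a + b) / 2) := ⟨(b - a) / 8, (b - a) / 4, by linarith, by linarith⟩
  refine ⟨f.normed volume, f.contDiff_normed, f.hasCompactSupport_normed, ?_, f.integral_normed⟩
  rw [f.tsupport_normed_eq]
  intro x hx
  rw [Real.closedBall_eq_Icc] at hx
  have h : f.rOut = (b - a) / 4 := rfl
  rw [h] at hx
  exact ⟨by linarith [hx.1], by linarith [hx.2]⟩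

/-- The lemma of du Bois-Reymond. -/
lemma ae_eq_const_of_integral_mul_deriv_eq_zero {a b : ℝ} (hab : a < b) {w : ℝ → ℝ}
    (hw : LocallyIntegrableOn w (Ioo a b))
    (h : ∀ η : ℝ → ℝ, ContDiff ℝ ∞ η → HasCompactSupport η → tsupport η ⊆ Ioo a b →
      ∫ x in Ioo a b, w x * deriv η x = 0) :
    ∃ c, ∀ᵐ x, x ∈ Ioo a b → w x = c := by
  obtain ⟨η₀, h1, h2, h3, h4⟩ := exists_testFunction_integral_eq_one hab
  have hi0 := integrable_mul_of_tsupport_subset hw h1.continuous h2 h3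
  refine ⟨∫ x, w x * η₀ x, ?_⟩
  set c := ∫ x, w x * η₀ x with hc
  have key := isOpen_Ioo.ae_eq_zero_of_integral_contDiff_smul_eq_zero (μ := volume)
    (f := fun x => w x - c) (hw.sub (continuousOn_const.locallyIntegrableOn measurableSet_Ioo)) ?_
  · filter_upwards [key] with x hx hx'
    exact sub_eq_zero.1 (hx hx')
  intro η hη hηc hηs
  have hi := integrable_mul_of_tsupport_subset hw hη.continuous hηc hηs
  have hηi : Integrable η := hη.continuous.integrable_of_hasCompactSupport hηc
  have hηi0 : Integrable η₀ := h1.continuous.integrable_of_hasCompactSupport h2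
  set s := ∫ x, η x with hs
  have hts : tsupport (fun x => η x - s * η₀ x) ⊆ tsupport η ∪ tsupport η₀ := by
    refine closure_minimal (fun x hx => ?_) ((isClosed_tsupport _).union (isClosed_tsupport _))
    by_contra hn
    rw [mem_union, not_or] at hn
    exact hx (by simp [image_eq_zero_of_notMem_tsupport hn.1, image_eq_zero_of_notMem_tsupport hn.2])
  -- Subtracting `s * η₀` removes the mean of `η`, so the difference is an admissible derivative in
  -- `h`.
  obtain ⟨ζ, z1, z2, z3, z4⟩ := exists_testFunction_deriv_eq (a := a) (b := b)
    (θ := fun x => η x - s * η₀ x) (hη.sub (contDiff_const.mul h1))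
    (IsCompact.of_isClosed_subset (IsCompact.union hηc h2) (isClosed_tsupport _) hts)
    (hts.trans (union_subset hηs h3)) (by
      rw [integral_sub hηi (hηi0.const_mul s), integral_const_mul, h4]; simp [hs])
  have := h ζ z1 z2 z3
  rw [z4, setIntegral_eq_integral_of_tsupport (hts.trans (union_subset hηs h3))] at this
  have e : ∀ x, w x * (η x - s * η₀ x) = w x * η x - s * (w x * η₀ x) := fun x => by ring
  simp_rw [e] at this
  rw [integral_sub hi (hi0.const_mul s), integral_const_mul, ← hc] at this
  have e2 : ∀ x, η x • (w x - c) = w x * η x - c * η x := fun x => by rw [smul_eq_mul]; ring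
  simp_rw [e2]
  rw [integral_sub hi (hηi.const_mul c), integral_const_mul, ← hs]
  linarith

/-- The difference of `v` and the primitive of `g` has weak derivative zero, hence is constant by du
Bois-Reymond. -/
lemma HasWeakDeriv.ae_eq_primitive {a b : ℝ} (hab : a < b) {v g : ℝ → ℝ}
    (h : HasWeakDeriv a b v g) (hg : IntegrableOn g (Ioo a b)) :
    ∃ c, ∀ᵐ x, x ∈ Ioo a b → v x = c + ∫ t in a..x, g t := by
  have hp := HasWeakDeriv.of_primitive (c := 0) hab hg (v := fun x => ∫ t in a..x, g t)
    (fun x _ => by simp)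
  obtain ⟨c, hc⟩ := ae_eq_const_of_integral_mul_deriv_eq_zero hab (w := fun x => v x - ∫ t in a..x, g t)
    (h.1.sub hp.1) (by
      intro η hη hηc hηs
      have hd : Continuous (deriv η) := hη.continuous_deriv (by simp)
      have hdc := hηc.deriv
      have hds : tsupport (deriv η) ⊆ Ioo a b := fun x hx => hηs (tsupport_deriv_subset hx)
      have i1 := integrable_mul_of_tsupport_subset h.1 hd hdc hds
      have i2 := integrable_mul_of_tsupport_subset hp.1 hd hdc hds
      simp_rw [sub_mul]
      rw [integral_sub i1.integrableOn i2.integrableOn, h.2.2 η hη hηc hηs, hp.2.2 η hη hηc hηs]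
      simp)
  refine ⟨c, ?_⟩
  filter_upwards [hc] with x hx hx'
  linarith [hx hx']

/-! ### The norm of `L²` -/

lemma L2norm_sq (v : ℝ → ℝ) (D : Set ℝ) : L2norm v D ^ 2 = ∫⁻ x in D, ‖v x‖ₑ ^ 2 := by
  have := eLpNorm_nnreal_pow_eq_lintegral (f := v) (μ := volume.restrict D) (p := 2) (by norm_num)
  simpa [L2norm] using this

lemma L2norm_mono_ae {v g : ℝ → ℝ} {D : Set ℝ} (hD : MeasurableSet D)
    (h : ∀ᵐ x, x ∈ D → |v x| ≤ |g x|) : L2norm v D ≤ L2norm g D :=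
  eLpNorm_mono_ae ((ae_restrict_iff' hD).2 h)

lemma L2norm_mono {v g : ℝ → ℝ} {D : Set ℝ} (hD : MeasurableSet D)
    (h : ∀ x ∈ D, |v x| ≤ |g x|) : L2norm v D ≤ L2norm g D :=
  L2norm_mono_ae hD (Eventually.of_forall h)

lemma L2norm_congr_ae {v g : ℝ → ℝ} {D : Set ℝ} (hD : MeasurableSet D)
    (h : ∀ᵐ x, x ∈ D → v x = g x) : L2norm v D = L2norm g D :=
  eLpNorm_congr_ae ((ae_restrict_iff' hD).2 h)

lemma L2norm_mono_set {v : ℝ → ℝ} {D D' : Set ℝ} (h : D ⊆ D') : L2norm v D ≤ L2norm v D' :=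
  eLpNorm_mono_measure v (Measure.restrict_mono h le_rfl)

lemma L2norm_const_mul (c : ℝ) (v : ℝ → ℝ) (D : Set ℝ) :
    L2norm (fun x => c * v x) D = ENNReal.ofReal |c| * L2norm v D := by
  have := eLpNorm_const_smul c v 2 (volume.restrict D)
  rw [Real.enorm_eq_ofReal_abs] at this
  exact this

lemma L2norm_union_le (v : ℝ → ℝ) (D D' : Set ℝ) :
    L2norm v (D ∪ D') ≤ L2norm v D + L2norm v D' := by
  have h : L2norm v (D ∪ D') ^ 2 ≤ (L2norm v D + L2norm v D') ^ 2 := by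
    calc L2norm v (D ∪ D') ^ 2 ≤ L2norm v D ^ 2 + L2norm v D' ^ 2 := by
          simp_rw [L2norm_sq]; exact lintegral_union_le _ _ _
      _ ≤ _ := by rw [add_sq]; gcongr; exact le_self_add
  exact (ENNReal.pow_le_pow_left_iff (by norm_num)).1 h

lemma L2norm_add_le {v g : ℝ → ℝ} {D : Set ℝ} (hv : AEStronglyMeasurable v (volume.restrict D))
    (hg : AEStronglyMeasurable g (volume.restrict D)) :
    L2norm (fun x => v x + g x) D ≤ L2norm v D + L2norm g D :=
  eLpNorm_add_le hv hg (by norm_num)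

lemma L2norm_le_of_bound {v : ℝ → ℝ} {D : Set ℝ} {c h : ℝ} (hD : MeasurableSet D)
    (hc : ∀ x ∈ D, |v x| ≤ c) (hh0 : 0 ≤ h) (hh : volume D ≤ ENNReal.ofReal h) :
    L2norm v D ≤ ENNReal.ofReal (c * √h) := by
  rcases D.eq_empty_or_nonempty with rfl | ⟨x, hx⟩
  · simp [L2norm]
  have hc0 : 0 ≤ c := (abs_nonneg _).trans (hc x hx)
  have h1 : L2norm v D ≤ (volume.restrict D) univ ^ (2 : ℝ≥0∞).toReal⁻¹ * ENNReal.ofReal c :=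
    eLpNorm_le_of_ae_bound ((ae_restrict_iff' hD).2 (Eventually.of_forall hc))
  refine h1.trans ?_
  rw [Measure.restrict_apply_univ, mul_comm, ENNReal.ofReal_mul hc0]
  gcongr
  rw [Real.sqrt_eq_rpow, ← ENNReal.ofReal_rpow_of_nonneg hh0 (by norm_num)]
  refine (ENNReal.rpow_le_rpow hh (by norm_num)).trans (le_of_eq (by norm_num))

/-- Cauchy–Schwarz. The factor `√(b - a)` is one of the two half powers of the width in the cell
estimate. -/
lemma ofReal_integral_abs_le {f : ℝ → ℝ} {a b : ℝ} (hab : a < b) (hf : IntegrableOn f (Icc a b)) :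
    ENNReal.ofReal (∫ t in a..b, |f t|) ≤ ENNReal.ofReal √(b - a) * L2norm f (Ico a b) := by
  have hf' : IntegrableOn f (Ico a b) := hf.mono_set Ico_subset_Icc_self
  rw [intervalIntegral.integral_of_le hab.le, integral_Ioc_eq_integral_Ioo,
    ← integral_Ico_eq_integral_Ioo]
  have h1 : ENNReal.ofReal (∫ t in Ico a b, |f t|) = eLpNorm f 1 (volume.restrict (Ico a b)) := by
    rw [eLpNorm_one_eq_lintegral_enorm]
    exact ofReal_integral_norm_eq_lintegral_enorm hf'
  rw [h1]
  have h2 := eLpNorm_le_eLpNorm_mul_rpow_measure_univ (p := 1) (q := 2) (by norm_num)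
    hf'.aestronglyMeasurable
  refine h2.trans (le_of_eq ?_)
  rw [mul_comm, L2norm, Measure.restrict_apply_univ, Real.volume_Ico, Real.sqrt_eq_rpow,
    ENNReal.ofReal_rpow_of_nonneg (by linarith) (by norm_num)]
  norm_num

/-! ### Chains of derivatives -/

/-- On `[a, b]`, each of `F 0, …, F (m - 1)` is a primitive of the next function. -/
structure IsDerivChain (a b : ℝ) (m : ℕ) (F : ℕ → ℝ → ℝ) : Prop where
  integrableOn : ∀ ℓ < m, IntegrableOn (F (ℓ + 1)) (Icc a b)
  sub_eq : ∀ ℓ < m, ∀ x ∈ Icc a b, ∀ y ∈ Icc a b, F ℓ y - F ℓ x = ∫ t in x..y, F (ℓ + 1) t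

namespace IsDerivChain
variable {a b : ℝ} {m : ℕ} {F : ℕ → ℝ → ℝ}

lemma mono (h : IsDerivChain a b m F) {a' b' : ℝ} {m' : ℕ} (ha : a ≤ a') (hb : b' ≤ b)
    (hm : m' ≤ m) : IsDerivChain a' b' m' F :=
  have hs : Icc a' b' ⊆ Icc a b := Icc_subset_Icc ha hb
  ⟨fun ℓ hℓ => (h.integrableOn ℓ (hℓ.trans_le hm)).mono_set hs,
    fun ℓ hℓ x hx y hy => h.sub_eq ℓ (hℓ.trans_le hm) x (hs hx) y (hs hy)⟩

lemma shift (h : IsDerivChain a b (m + 1) F) : IsDerivChain a b m (fun ℓ => F (ℓ + 1)) :=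
  ⟨fun ℓ hℓ => h.integrableOn (ℓ + 1) (by omega), fun ℓ hℓ => h.sub_eq (ℓ + 1) (by omega)⟩

lemma intervalIntegrable (h : IsDerivChain a b m F) {ℓ : ℕ} (hℓ : ℓ < m) {x y : ℝ}
    (hx : x ∈ Icc a b) (hy : y ∈ Icc a b) : IntervalIntegrable (F (ℓ + 1)) volume x y :=
  ((h.integrableOn ℓ hℓ).mono_set (uIcc_subset_Icc hx hy)).intervalIntegrable

lemma continuousOn (h : IsDerivChain a b m F) {ℓ : ℕ} (hℓ : ℓ < m) :
    ContinuousOn (F ℓ) (Icc a b) := by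
  rcases lt_or_ge b a with hab | hab
  · simp [Icc_eq_empty (not_le.2 hab)]
  have ha : a ∈ Icc a b := left_mem_Icc.2 hab
  have hb : b ∈ Icc a b := right_mem_Icc.2 hab
  have h1 := intervalIntegral.continuousOn_primitive_interval' (h.intervalIntegrable hℓ ha hb)
    (a := a) (by simp)
  rw [uIcc_of_le hab] at h1
  refine (h1.const_add (F ℓ a)).congr fun x hx => ?_
  linarith [h.sub_eq ℓ hℓ a ha x hx]

lemma add {G : ℕ → ℝ → ℝ} (h : IsDerivChain a b m F) (h' : IsDerivChain a b m G) :
    IsDerivChain a b m (fun ℓ x => F ℓ x + G ℓ x) := by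
  refine ⟨fun ℓ hℓ => (h.integrableOn ℓ hℓ).add (h'.integrableOn ℓ hℓ), fun ℓ hℓ x hx y hy => ?_⟩
  rw [intervalIntegral.integral_add (h.intervalIntegrable hℓ hx hy)
    (h'.intervalIntegrable hℓ hx hy), ← h.sub_eq ℓ hℓ x hx y hy, ← h'.sub_eq ℓ hℓ x hx y hy]
  ring

lemma abs_sub_le (h : IsDerivChain a b m F) {ℓ : ℕ} (hℓ : ℓ < m) {x : ℝ} (hx : x ∈ Icc a b) :
    |F ℓ x - F ℓ a| ≤ ∫ t in a..b, |F (ℓ + 1) t| := by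
  have hab : a ≤ b := hx.1.trans hx.2
  have ha : a ∈ Icc a b := left_mem_Icc.2 hab
  have hb : b ∈ Icc a b := right_mem_Icc.2 hab
  rw [h.sub_eq ℓ hℓ a ha x hx]
  refine (intervalIntegral.abs_integral_le_integral_abs hx.1).trans ?_
  exact intervalIntegral.integral_mono_interval le_rfl hx.1 hx.2
    (Eventually.of_forall fun t => abs_nonneg _) (h.intervalIntegrable hℓ ha hb).abs

end IsDerivChain

open Polynomial in
lemma exists_derivative_eq (m : ℕ) (q : ℝ[X]) (hq : q.degree < m) (a c : ℝ) :
    ∃ p : ℝ[X], p.degree < (m + 1 : ℕ) ∧ derivative p = q ∧ p.eval a = c := by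
  have h1 : ∃ p : ℝ[X], p.degree < (m + 1 : ℕ) ∧ derivative p = q := by
    rcases eq_or_ne q 0 with rfl | hq0
    · exact ⟨0, by simp, by simp⟩
    refine ⟨∑ i ∈ Finset.range m, monomial (i + 1) (q.coeff i / (i + 1)), ?_, ?_⟩
    · rw [← mem_degreeLT]
      refine Submodule.sum_mem _ fun i hi => ?_
      rw [mem_degreeLT]
      refine (degree_monomial_le _ _).trans_lt ?_
      have := Finset.mem_range.1 hi
      exact_mod_cast Nat.add_lt_add_right this 1
    · rw [derivative_sum]
      conv_rhs => rw [q.as_sum_range' m (by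
        exact (natDegree_lt_iff_degree_lt hq0).2 hq)]
      refine Finset.sum_congr rfl fun i _ => ?_
      rw [derivative_monomial]
      congr 1
      push_cast
      field_simp
  obtain ⟨p, hp, hd⟩ := h1
  refine ⟨p + C (c - p.eval a), ?_, by simp [hd], by simp⟩
  refine (degree_add_le _ _).trans_lt (max_lt hp (degree_C_le.trans_lt ?_))
  exact_mod_cast Nat.succ_pos m

/-- Taylor approximation of a chain of derivatives. -/
lemma IsDerivChain.exists_polynomial {a b : ℝ} (hab : a < b) (m : ℕ) :
    ∀ {F : ℕ → ℝ → ℝ}, IsDerivChain a b (m + 1) F → ∃ q : Polynomial ℝ, q.degree < (m + 1 : ℕ) ∧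
      (∀ x ∈ Icc a b, |F 0 x - q.eval x| ≤ (b - a) ^ m * ∫ t in a..b, |F (m + 1) t|) ∧
      (∀ x ∈ Icc a b, |F 1 x - q.derivative.eval x| ≤
        if m = 0 then |F 1 x| else (b - a) ^ (m - 1) * ∫ t in a..b, |F (m + 1) t|) := by
  induction m with
  | zero =>
    intro F h
    -- A constant has derivative zero, so only the trivial bound by `|F 1 x|` is available; this is
    -- the case distinction in the statement.
    refine ⟨Polynomial.C (F 0 a), ?_, fun x hx => ?_, fun x hx => ?_⟩
    · exact Polynomial.degree_C_le.trans_lt (by norm_num)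
    · simpa using h.abs_sub_le (ℓ := 0) (by norm_num) hx
    · simp
  | succ m ih =>
    intro F h
    obtain ⟨q, hq, hq0, -⟩ := ih h.shift
    -- The induction hypothesis approximates `F 1` by `q`. The primitive of `q` that agrees with `F
    -- 0` at `a` gains one power of `b - a` by integration, and its derivative inherits the bound
    -- for `q`.
    obtain ⟨p, hp, hpd, hpa⟩ := exists_derivative_eq (m + 1) q hq a (F 0 a)
    refine ⟨p, hp, fun x hx => ?_, fun x hx => ?_⟩
    · have ha : a ∈ Icc a b := left_mem_Icc.2 hab.le
      have e : F 0 x - p.eval x = ∫ t in a..x, (F 1 t - q.eval t) := by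
        rw [intervalIntegral.integral_sub (h.intervalIntegrable (ℓ := 0) (by omega) ha hx)
          (q.continuous.intervalIntegrable _ _), ← h.sub_eq 0 (by omega) a ha x hx]
        have : ∫ t in a..x, q.eval t = p.eval x - p.eval a := by
          refine intervalIntegral.integral_eq_sub_of_hasDerivAt (f := fun t => p.eval t) (fun t _ => ?_)
            (q.continuous.intervalIntegrable _ _)
          rw [← hpd]; exact p.hasDerivAt t
        rw [this, hpa]; ring
      rw [e]
      have hb := intervalIntegral.norm_integral_le_of_norm_le_const (a := a) (b := x)
        (f := fun t => F 1 t - q.eval t) (C := (b - a) ^ m * ∫ t in a..b, |F (m + 1 + 1) t|)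
        (fun t ht => by
          rw [uIoc_of_le hx.1] at ht
          exact hq0 t ⟨ht.1.le, ht.2.trans hx.2⟩)
      rw [Real.norm_eq_abs, abs_of_nonneg (by linarith [hx.1] : 0 ≤ x - a)] at hb
      refine hb.trans ?_
      have hI : 0 ≤ ∫ t in a..b, |F (m + 1 + 1) t| :=
        intervalIntegral.integral_nonneg hab.le fun _ _ => abs_nonneg _
      rw [pow_succ (b - a) m]
      have : x - a ≤ b - a := by linarith [hx.2]
      have hba : 0 ≤ (b - a) ^ m := pow_nonneg (by linarith) _
      calc _ ≤ ((b - a) ^ m * ∫ t in a..b, |F (m + 1 + 1) t|) * (b - a) := by gcongr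
        _ = _ := by ring
    · rw [hpd]
      simpa using hq0 x hx

/-! ### Lagrange interpolation on a cell -/

variable {k : ℕ} {ξ : Fin (k + 1) → ℝ}

lemma node_mem_Icc (hξ : StrictMono ξ) (hξ0 : ξ 0 = 0) (hξ1 : ξ (Fin.last k) = 1) {a b : ℝ}
    (hab : a ≤ b) (j : Fin (k + 1)) : a + (b - a) * ξ j ∈ Icc a b := by
  have h0 : 0 ≤ ξ j := hξ0 ▸ hξ.monotone (Fin.zero_le j)
  have h1 : ξ j ≤ 1 := hξ1 ▸ hξ.monotone (Fin.le_last j)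
  constructor <;> nlinarith

lemma injOn_node (hξ : StrictMono ξ) {a b : ℝ} (hab : a < b) :
    Set.InjOn (fun j => a + (b - a) * ξ j) ((Finset.univ : Finset (Fin (k + 1))) : Set (Fin (k + 1))) := by
  intro i _ j _ hij
  have : (b - a) ≠ 0 := by linarith
  exact hξ.injective (mul_left_cancel₀ this (add_left_cancel hij))

/-- The interpolation polynomial on `[a, b]` of a function that is continuous there. -/
def cellPoly (ξ : Fin (k + 1) → ℝ) (a b : ℝ) (f : ℝ → ℝ) : Polynomial ℝ :=
  Lagrange.interpolate Finset.univ (fun j => a + (b - a) * ξ j) (fun j => f (a + (b - a) * ξ j))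

/-- The limits from inside the cell are the values of the continuous extension `f`, so `extendFrom`
disappears from all later estimates. -/
lemma cellInterp_eq_cellPoly (hξ : StrictMono ξ) (hξ0 : ξ 0 = 0) (hξ1 : ξ (Fin.last k) = 1)
    {a b : ℝ} (hab : a < b) {v f : ℝ → ℝ} (hf : ContinuousOn f (Icc a b))
    (hv : ∀ x ∈ Ioo a b, v x = f x) : cellInterp ξ a b v = cellPoly ξ a b f := by
  unfold cellInterp cellPoly
  refine Lagrange.interpolate_eq_of_values_eq_on _ _ fun j _ => ?_
  have hx := node_mem_Icc hξ hξ0 hξ1 hab.le j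
  refine extendFrom_eq (by rw [closure_Ioo hab.ne]; exact hx) ?_
  have h1 : Tendsto f (𝓝[Ioo a b] (a + (b - a) * ξ j)) (𝓝 (f (a + (b - a) * ξ j))) :=
    (hf _ hx).mono_left (nhdsWithin_mono _ Ioo_subset_Icc_self)
  refine h1.congr' ?_
  filter_upwards [self_mem_nhdsWithin] with x hx
  exact (hv x hx).symm

lemma cellPoly_sub (a b : ℝ) (f g : ℝ → ℝ) :
    cellPoly ξ a b (fun x => f x - g x) = cellPoly ξ a b f - cellPoly ξ a b g := by
  unfold cellPoly; rw [← map_sub]; rfl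

lemma cellPoly_add (a b : ℝ) (f g : ℝ → ℝ) :
    cellPoly ξ a b (fun x => f x + g x) = cellPoly ξ a b f + cellPoly ξ a b g := by
  unfold cellPoly; rw [← map_add]; rfl

lemma cellPoly_eval_node (hξ : StrictMono ξ) {a b : ℝ} (hab : a < b) (f : ℝ → ℝ) (j : Fin (k + 1)) :
    (cellPoly ξ a b f).eval (a + (b - a) * ξ j) = f (a + (b - a) * ξ j) :=
  Lagrange.eval_interpolate_at_node (fun j => f (a + (b - a) * ξ j)) (injOn_node hξ hab)
    (Finset.mem_univ j)

lemma cellPoly_polynomial (hξ : StrictMono ξ) {a b : ℝ} (hab : a < b) {q : Polynomial ℝ}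
    (hq : q.degree < (k + 1 : ℕ)) : cellPoly ξ a b (fun x => q.eval x) = q :=
  (Lagrange.eq_interpolate (injOn_node hξ hab) (by simpa using hq)).symm

/-- `Λ` bounds the Lebesgue constants of the reference points and of their derivatives. -/
def IsLebesgueBound (ξ : Fin (k + 1) → ℝ) (Λ : ℝ) : Prop :=
  0 ≤ Λ ∧ ∀ (r : Fin (k + 1) → ℝ) (R : ℝ), (∀ j, |r j| ≤ R) → ∀ s ∈ Icc (0 : ℝ) 1,
    |(Lagrange.interpolate Finset.univ ξ r).eval s| ≤ Λ * R ∧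
    |(Lagrange.interpolate Finset.univ ξ r).derivative.eval s| ≤ Λ * R

lemma exists_isLebesgueBound (ξ : Fin (k + 1) → ℝ) : ∃ Λ, IsLebesgueBound ξ Λ := by
  have hb : ∀ p : Polynomial ℝ, ∃ c, ∀ s ∈ Icc (0 : ℝ) 1, ‖p.eval s‖ ≤ c := fun p =>
    isCompact_Icc.exists_bound_of_continuousOn p.continuous.continuousOn
  choose c hc using hb
  let B := Lagrange.basis (Finset.univ : Finset (Fin (k + 1))) ξ
  have hc0 : ∀ p, 0 ≤ c p := fun p => (norm_nonneg _).trans (hc p 0 (by simp))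
  refine ⟨∑ j, (c (B j) + c (B j).derivative),
    Finset.sum_nonneg fun j _ => add_nonneg (hc0 _) (hc0 _), fun r R hR s hs => ?_⟩
  have hR0 : 0 ≤ R := (abs_nonneg _).trans (hR 0)
  rw [Lagrange.interpolate_apply, Finset.sum_mul]
  constructor
  · rw [Polynomial.eval_finsetSum]
    refine (Finset.abs_sum_le_sum_abs _ _).trans (Finset.sum_le_sum fun j _ => ?_)
    rw [Polynomial.eval_mul, Polynomial.eval_C, abs_mul, mul_comm]
    gcongr
    · exact add_nonneg (hc0 _) (hc0 _)
    · exact (hc (B j) s hs).trans (le_add_of_nonneg_right (hc0 _))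
    · exact hR j
  · rw [Polynomial.derivative_sum, Polynomial.eval_finsetSum]
    refine (Finset.abs_sum_le_sum_abs _ _).trans (Finset.sum_le_sum fun j _ => ?_)
    rw [Polynomial.derivative_C_mul, Polynomial.eval_mul, Polynomial.eval_C, abs_mul, mul_comm]
    gcongr
    · exact add_nonneg (hc0 _) (hc0 _)
    · exact (hc (B j).derivative s hs).trans (le_add_of_nonneg_left (hc0 _))
    · exact hR j

-- Pull-back to `[0, 1]`, where the Lebesgue constants do not depend on the cell. Equality follows
-- from uniqueness of the interpolating polynomial.
open Polynomial in
lemma cellPoly_eq_comp (hξ : StrictMono ξ) {a b : ℝ} (hab : a < b) (f : ℝ → ℝ) :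
    cellPoly ξ a b f = (Lagrange.interpolate Finset.univ ξ (fun j => f (a + (b - a) * ξ j))).comp
      (C (b - a)⁻¹ * (X - C a)) := by
  symm
  have hba : b - a ≠ 0 := by linarith
  refine Lagrange.eq_interpolate_of_eval_eq _ (injOn_node hξ hab) ?_ fun j _ => ?_
  · have hd := natDegree_le_of_degree_le (Lagrange.degree_interpolate_le (s := Finset.univ)
      (fun j => f (a + (b - a) * ξ j))
      (hξ.injective.injOn (s := (Finset.univ : Finset (Fin (k + 1))))))
    rw [Finset.card_univ, Fintype.card_fin] at hd ⊢
    refine degree_le_natDegree.trans_lt ?_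
    have hl : (C (b - a)⁻¹ * (X - C a)).natDegree ≤ 1 :=
      (natDegree_C_mul_le _ _).trans (natDegree_X_sub_C a).le
    have := natDegree_comp_le.trans (Nat.mul_le_mul hd hl)
    exact_mod_cast (this.trans_lt (by omega))
  · rw [eval_comp]
    have : eval (a + (b - a) * ξ j) (C (b - a)⁻¹ * (X - C a)) = ξ j := by
      simp; field_simp
    rw [this]
    exact Lagrange.eval_interpolate_at_node (fun j => f (a + (b - a) * ξ j)) hξ.injective.injOn
      (Finset.mem_univ j)

lemma IsLebesgueBound.cellPoly_le {Λ : ℝ} (hΛ : IsLebesgueBound ξ Λ) (hξ : StrictMono ξ)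
    (hξ0 : ξ 0 = 0) (hξ1 : ξ (Fin.last k) = 1) {a b : ℝ} (hab : a < b) {f : ℝ → ℝ} {R : ℝ}
    (hR : ∀ x ∈ Icc a b, |f x| ≤ R) {x : ℝ} (hx : x ∈ Icc a b) :
    |(cellPoly ξ a b f).eval x| ≤ Λ * R ∧
      |(cellPoly ξ a b f).derivative.eval x| ≤ Λ * R / (b - a) := by
  have hba : 0 < b - a := by linarith
  have hs : (b - a)⁻¹ * (x - a) ∈ Icc (0 : ℝ) 1 := by
    constructor
    · exact mul_nonneg (inv_nonneg.2 hba.le) (by linarith [hx.1])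
    · rw [inv_mul_le_iff₀ hba]; linarith [hx.2]
  obtain ⟨h1, h2⟩ := hΛ.2 (fun j => f (a + (b - a) * ξ j)) R
    (fun j => hR _ (node_mem_Icc hξ hξ0 hξ1 hab.le j)) _ hs
  rw [cellPoly_eq_comp hξ hab]
  constructor
  · have e : (Polynomial.C (b - a)⁻¹ * (Polynomial.X - Polynomial.C a)).eval x =
        (b - a)⁻¹ * (x - a) := by simp
    rw [Polynomial.eval_comp, e]; exact h1
  · rw [Polynomial.derivative_comp, Polynomial.eval_mul, Polynomial.eval_comp]
    simp only [Polynomial.derivative_mul, Polynomial.derivative_C, Polynomial.derivative_sub,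
      Polynomial.derivative_X, Polynomial.eval_mul, Polynomial.eval_add, Polynomial.eval_sub,
      Polynomial.eval_C, Polynomial.eval_X, Polynomial.eval_one, Polynomial.eval_zero]
    simp only [zero_mul, sub_zero, mul_one, zero_add]
    rw [abs_mul, abs_of_pos (inv_pos.2 hba), div_eq_inv_mul]
    gcongr

/-- Stability and approximation of the interpolation on a cell. -/
lemma IsLebesgueBound.abs_sub_cellPoly_le {Λ : ℝ} (hΛ : IsLebesgueBound ξ Λ) (hξ : StrictMono ξ)
    (hξ0 : ξ 0 = 0) (hξ1 : ξ (Fin.last k) = 1) {a b : ℝ} (hab : a < b) {f : ℝ → ℝ} {R : ℝ}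
    {q : Polynomial ℝ} (hq : q.degree < (k + 1 : ℕ))
    (hR : ∀ x ∈ Icc a b, |f x - q.eval x| ≤ R) {x : ℝ} (hx : x ∈ Icc a b) :
    |f x - (cellPoly ξ a b f).eval x| ≤ (1 + Λ) * R ∧
      ∀ d, |d - (cellPoly ξ a b f).derivative.eval x| ≤
        |d - q.derivative.eval x| + Λ * R / (b - a) := by
  obtain ⟨h1, h2⟩ := hΛ.cellPoly_le hξ hξ0 hξ1 hab hR hx
  rw [cellPoly_sub, cellPoly_polynomial hξ hab hq] at h1 h2
  rw [Polynomial.derivative_sub, Polynomial.eval_sub] at h2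
  rw [Polynomial.eval_sub] at h1
  have h3 := hR x hx
  constructor
  -- Interpolation reproduces `q`, so the error of `f` equals the error of `f - q`.
  · calc _ = |(f x - q.eval x) - ((cellPoly ξ a b f).eval x - q.eval x)| := by congr 1; ring
      _ ≤ _ := abs_sub _ _
      _ ≤ _ := by linarith
  -- The number `d` stands for the value of a derivative of `f` that is only determined almost
  -- everywhere.
  · intro d
    calc _ = |(d - q.derivative.eval x) -
          ((cellPoly ξ a b f).derivative.eval x - q.derivative.eval x)| := by congr 1; ring
      _ ≤ _ := abs_sub _ _
      _ ≤ _ := by linarith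

/-- The Taylor remainder is bounded uniformly by a power of the width times an `L¹` norm. Passing
from `L¹` to `L²` gains half a power of the width, and taking the `L²` norm of the uniform bound
gains the other half. -/
lemma IsLebesgueBound.L2norm_cell_le {Λ : ℝ} (hΛ : IsLebesgueBound ξ Λ) (hξ : StrictMono ξ)
    (hξ0 : ξ 0 = 0) (hξ1 : ξ (Fin.last k) = 1) {a b : ℝ} (hab : a < b) {F : ℕ → ℝ → ℝ} {m : ℕ}
    (hm : m ≤ k) (hF : IsDerivChain a b (m + 1) F) :
    L2norm (fun x => F 0 x - (cellPoly ξ a b (F 0)).eval x) (Ico a b) ≤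
        ENNReal.ofReal ((1 + Λ) * (b - a) ^ (m + 1)) * L2norm (F (m + 1)) (Ico a b) ∧
      L2norm (fun x => F 1 x - (cellPoly ξ a b (F 0)).derivative.eval x) (Ico a b) ≤
        ENNReal.ofReal ((1 + Λ) * (b - a) ^ m) * L2norm (F (m + 1)) (Ico a b) := by
  have hΛ0 := hΛ.1
  have hba : 0 < b - a := by linarith
  obtain ⟨q, hq, hq0, hq1⟩ := hF.exists_polynomial hab m
  have hqk : q.degree < (k + 1 : ℕ) := hq.trans_le (by exact_mod_cast Nat.succ_le_succ hm)
  set T := ∫ t in a..b, |F (m + 1) t| with hT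
  have hT0 : 0 ≤ T := intervalIntegral.integral_nonneg hab.le fun _ _ => abs_nonneg _
  have hTL := ofReal_integral_abs_le hab (hF.integrableOn m (by omega))
  rw [← hT] at hTL
  have hsq : √(b - a) * √(b - a) = b - a := Real.mul_self_sqrt hba.le
  have key : ∀ {v : ℝ → ℝ} {c : ℝ}, 0 ≤ c → (∀ x ∈ Ico a b, |v x| ≤ c * T) →
      L2norm v (Ico a b) ≤ ENNReal.ofReal (c * (b - a)) * L2norm (F (m + 1)) (Ico a b) := by
    intro v c hc hv
    have h1 := L2norm_le_of_bound (h := b - a) measurableSet_Ico hv hba.le (by simp)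
    refine h1.trans ?_
    rw [show c * T * √(b - a) = (c * √(b - a)) * T by ring, ENNReal.ofReal_mul (by positivity)]
    refine (mul_le_mul_right hTL _).trans (le_of_eq ?_)
    rw [← mul_assoc, ← ENNReal.ofReal_mul (by positivity), mul_assoc, hsq]
  constructor
  · have h1 := key (v := fun x => F 0 x - (cellPoly ξ a b (F 0)).eval x)
      (c := (1 + Λ) * (b - a) ^ m) (by positivity) fun x hx => by
        rw [mul_assoc]
        exact (hΛ.abs_sub_cellPoly_le hξ hξ0 hξ1 hab hqk hq0 ⟨hx.1, hx.2.le⟩).1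
    rwa [mul_assoc, ← pow_succ] at h1
  · have h2 : ∀ x ∈ Ico a b, _ := fun x hx =>
      (hΛ.abs_sub_cellPoly_le hξ hξ0 hξ1 hab hqk hq0 ⟨hx.1, hx.2.le⟩).2 (F 1 x)
    -- For `m = 0` the Taylor polynomial gives no uniform bound on the derivative error. Then `F 1`
    -- is measured directly in `L²`, and only the interpolant is bounded uniformly.
    rcases m with _ | m
    · simp only [zero_add, pow_zero, mul_one, one_mul, if_true] at *
      have hF1 : AEStronglyMeasurable (F 1) (volume.restrict (Ico a b)) :=
        ((hF.integrableOn 0 (by omega)).mono_set Ico_subset_Icc_self).aestronglyMeasurable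
      have h3 : L2norm (fun x => F 1 x - (cellPoly ξ a b (F 0)).derivative.eval x) (Ico a b) ≤
          L2norm (fun x => |F 1 x| + Λ * T / (b - a)) (Ico a b) := by
        refine L2norm_mono measurableSet_Ico fun x hx => ?_
        rw [abs_of_nonneg (a := |F 1 x| + Λ * T / (b - a)) (by positivity)]
        linarith [h2 x hx, hq1 x ⟨hx.1, hx.2.le⟩]
      have h4 := key (v := fun _ => Λ * T / (b - a)) (c := Λ / (b - a)) (by positivity)
        fun x hx => by rw [abs_of_nonneg (by positivity)]; exact le_of_eq (by ring)
      have h5 : L2norm (fun x => |F 1 x|) (Ico a b) = L2norm (F 1) (Ico a b) :=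
        le_antisymm (L2norm_mono measurableSet_Ico fun x _ => by simp)
          (L2norm_mono measurableSet_Ico fun x _ => by simp)
      refine (h3.trans (L2norm_add_le hF1.norm aestronglyMeasurable_const)).trans ?_
      rw [div_mul_cancel₀ _ hba.ne'] at h4
      rw [h5, ENNReal.ofReal_add zero_le_one hΛ0, add_mul, ENNReal.ofReal_one, one_mul]
      gcongr
    · have h1 := key (v := fun x => F 1 x - (cellPoly ξ a b (F 0)).derivative.eval x)
        (c := (1 + Λ) * (b - a) ^ m) (by positivity) fun x hx => by
          have h3 := hq1 x ⟨hx.1, hx.2.le⟩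
          rw [if_neg (by omega), Nat.add_sub_cancel] at h3
          refine (h2 x hx).trans ((add_le_add_left h3 _).trans (le_of_eq ?_))
          rw [pow_succ]; field_simp
      rwa [mul_assoc, ← pow_succ] at h1

/-- On `(a, b)`, the function `v` is absolutely continuous together with its first `m - 1`
derivatives, and `D ℓ` is the derivative of order `ℓ` up to null sets. -/
def HasChain (a b : ℝ) (m : ℕ) (v : ℝ → ℝ) (D : ℕ → ℝ → ℝ) : Prop :=
  ∃ F : ℕ → ℝ → ℝ, IsDerivChain a b m F ∧ (∀ x ∈ Ioo a b, v x = F 0 x) ∧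
    ∀ ℓ ≤ m, ∀ᵐ x, x ∈ Ioo a b → F ℓ x = D ℓ x

namespace HasChain
variable {a b : ℝ} {m : ℕ} {v w u : ℝ → ℝ} {D G : ℕ → ℝ → ℝ}

lemma mono (h : HasChain a b m v D) {a' b' : ℝ} {m' : ℕ} (ha : a ≤ a') (hb : b' ≤ b)
    (hm : m' ≤ m) : HasChain a' b' m' v D := by
  obtain ⟨F, h1, h2, h3⟩ := h
  have hs : Ioo a' b' ⊆ Ioo a b := Ioo_subset_Ioo ha hb
  refine ⟨F, h1.mono ha hb hm, fun x hx => h2 x (hs hx), fun ℓ hℓ => ?_⟩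
  filter_upwards [h3 ℓ (hℓ.trans hm)] with x hx hx'
  exact hx (hs hx')

lemma add (hv : HasChain a b m v D) (hw : HasChain a b m w G)
    (hu : ∀ x ∈ Ioo a b, u x = v x + w x) : HasChain a b m u (fun ℓ x => D ℓ x + G ℓ x) := by
  obtain ⟨F, h1, h2, h3⟩ := hv
  obtain ⟨F', h1', h2', h3'⟩ := hw
  refine ⟨_, h1.add h1', fun x hx => by rw [hu x hx, h2 x hx, h2' x hx], fun ℓ hℓ => ?_⟩
  filter_upwards [h3 ℓ hℓ, h3' ℓ hℓ] with x hx hx' hx''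
  rw [hx hx'', hx' hx'']

lemma continuousOn (h : HasChain a b (m + 1) v D) : ContinuousOn v (Ioo a b) := by
  obtain ⟨F, h1, h2, -⟩ := h
  exact ((h1.continuousOn (ℓ := 0) (by omega)).mono Ioo_subset_Icc_self).congr h2

lemma aestronglyMeasurable (h : HasChain a b (m + 1) v D) :
    AEStronglyMeasurable v (volume.restrict (Ioo a b)) :=
  h.continuousOn.aestronglyMeasurable measurableSet_Ioo

lemma aestronglyMeasurable_deriv (h : HasChain a b (m + 1) v D) :
    AEStronglyMeasurable (D 1) (volume.restrict (Ioo a b)) := by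
  obtain ⟨F, h1, -, h3⟩ := h
  refine ((h1.integrableOn 0 (by omega)).mono_set Ioo_subset_Icc_self).aestronglyMeasurable.congr ?_
  exact (ae_restrict_iff' measurableSet_Ioo).2 (h3 1 (by omega))

end HasChain

variable {k : ℕ} {ξ : Fin (k + 1) → ℝ}

/-- The chains guarantee the limits at the end points of the cell, without which `extendFrom` need
not be additive. -/
lemma cellInterp_add (hξ : StrictMono ξ) (hξ0 : ξ 0 = 0) (hξ1 : ξ (Fin.last k) = 1) {a b : ℝ}
    (hab : a < b) {u v w : ℝ → ℝ} {D G : ℕ → ℝ → ℝ} {m : ℕ} (hv : HasChain a b (m + 1) v D)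
    (hw : HasChain a b (m + 1) w G) (hu : ∀ x ∈ Ioo a b, u x = v x + w x) :
    cellInterp ξ a b u = cellInterp ξ a b v + cellInterp ξ a b w := by
  obtain ⟨F, h1, h2, -⟩ := hv
  obtain ⟨F', h1', h2', -⟩ := hw
  have c1 := h1.continuousOn (ℓ := 0) (by omega)
  have c2 := h1'.continuousOn (ℓ := 0) (by omega)
  rw [cellInterp_eq_cellPoly hξ hξ0 hξ1 hab c1 h2, cellInterp_eq_cellPoly hξ hξ0 hξ1 hab c2 h2',
    cellInterp_eq_cellPoly hξ hξ0 hξ1 hab (c1.add c2) (f := fun x => F 0 x + F' 0 x)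
      (fun x hx => by rw [hu x hx, h2 x hx, h2' x hx]), cellPoly_add]

/-! ### Piecewise interpolation -/

/-- The piecewise derivative of the interpolant. -/
def interpDeriv (ξ : Fin (k + 1) → ℝ) (N : ℕ) (x : ℕ → ℝ) (v : ℝ → ℝ) (y : ℝ) : ℝ :=
  ∑ i ∈ Finset.range N, (Ico (x i) (x (i + 1))).indicator
    (fun z => (cellInterp ξ (x i) (x (i + 1)) v).derivative.eval z) y

lemma measurable_interp (ξ : Fin (k + 1) → ℝ) (N : ℕ) (x : ℕ → ℝ) (v : ℝ → ℝ) :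
    Measurable (interp ξ N x v) := by
  unfold interp
  exact Finset.measurable_fun_sum _ fun i _ =>
    (Polynomial.continuous _).measurable.indicator measurableSet_Ico

lemma measurable_interpDeriv (ξ : Fin (k + 1) → ℝ) (N : ℕ) (x : ℕ → ℝ) (v : ℝ → ℝ) :
    Measurable (interpDeriv ξ N x v) := by
  unfold interpDeriv
  exact Finset.measurable_fun_sum _ fun i _ =>
    (Polynomial.continuous _).measurable.indicator measurableSet_Ico

section Mesh
variable {N : ℕ} {x : ℕ → ℝ}

lemma mesh_mono (hx : ∀ i < N, x i ≤ x (i + 1)) {i j : ℕ} (hij : i ≤ j) (hj : j ≤ N) :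
    x i ≤ x j := by
  induction j, hij using Nat.le_induction with
  | base => exact le_rfl
  | succ n hn ih => exact (ih (by omega)).trans (hx n (by omega))

/-- Nodes may coincide, since the mesh function is only monotone. Half-open cells are still pairwise
disjoint, and a cell that contains `y` is not degenerate. -/
lemma sum_indicator_mesh (hx : ∀ i < N, x i ≤ x (i + 1)) {i : ℕ} (hi : i < N) {y : ℝ}
    (hy : y ∈ Ico (x i) (x (i + 1))) (f : ℕ → ℝ → ℝ) :
    ∑ j ∈ Finset.range N, (Ico (x j) (x (j + 1))).indicator (f j) y = f i y := by
  rw [Finset.sum_eq_single i]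
  · exact indicator_of_mem hy _
  · intro j hj hji
    have hj := Finset.mem_range.1 hj
    refine indicator_of_notMem (fun h => ?_) _
    rcases lt_or_gt_of_ne hji with h' | h'
    · have := mesh_mono hx (i := j + 1) (j := i) h' hi.le
      linarith [h.2, hy.1]
    · have := mesh_mono hx (i := i + 1) (j := j) h' hj.le
      linarith [h.1, hy.2]
  · intro h; exact absurd (Finset.mem_range.2 hi) h

lemma interp_of_mem (hx : ∀ i < N, x i ≤ x (i + 1)) {i : ℕ} (hi : i < N) {y : ℝ}
    (hy : y ∈ Ico (x i) (x (i + 1))) (v : ℝ → ℝ) :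
    interp ξ N x v y = (cellInterp ξ (x i) (x (i + 1)) v).eval y :=
  sum_indicator_mesh hx hi hy _

lemma interpDeriv_of_mem (hx : ∀ i < N, x i ≤ x (i + 1)) {i : ℕ} (hi : i < N) {y : ℝ}
    (hy : y ∈ Ico (x i) (x (i + 1))) (v : ℝ → ℝ) :
    interpDeriv ξ N x v y = (cellInterp ξ (x i) (x (i + 1)) v).derivative.eval y :=
  sum_indicator_mesh hx hi hy _

lemma exists_mem_cell {n p : ℕ} (hp : p ≤ n) {y : ℝ} (hy : y ∈ Ico (x p) (x n)) :
    ∃ i, p ≤ i ∧ i < n ∧ y ∈ Ico (x i) (x (i + 1)) := by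
  induction n, hp using Nat.le_induction with
  | base => exact absurd (hy.1.trans_lt hy.2) (lt_irrefl _)
  | succ n hn ih =>
    by_cases h : y < x n
    · obtain ⟨i, h0, h1, h2⟩ := ih ⟨hy.1, h⟩
      exact ⟨i, h0, by omega, h2⟩
    · exact ⟨n, hn, by omega, not_lt.1 h, hy.2⟩

/-- Squares of norms add up over disjoint cells, so a constant that is uniform in the cells survives
without growing with their number. -/
lemma L2norm_cells_le (hx : ∀ i < N, x i ≤ x (i + 1)) {p q : ℕ} (hpq : p ≤ q) (hq : q ≤ N)
    {v G : ℝ → ℝ} {c : ℝ≥0∞}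
    (h : ∀ i, p ≤ i → i < q → L2norm v (Ico (x i) (x (i + 1))) ≤
      c * L2norm G (Ico (x i) (x (i + 1)))) :
    L2norm v (Ico (x p) (x q)) ≤ c * L2norm G (Ico (x p) (x q)) := by
  have key : L2norm v (Ico (x p) (x q)) ^ 2 ≤ (c * L2norm G (Ico (x p) (x q))) ^ 2 := by
    induction q, hpq using Nat.le_induction with
    | base => simp [L2norm]
    | succ n hn ih =>
      have ih := ih (by omega) fun i h1 h2 => h i h1 (by omega)
      have hu : Ico (x p) (x (n + 1)) = Ico (x p) (x n) ∪ Ico (x n) (x (n + 1)) :=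
        (Ico_union_Ico_eq_Ico (mesh_mono hx hn (by omega)) (hx n (by omega))).symm
      have hd : Disjoint (Ico (x p) (x n)) (Ico (x n) (x (n + 1))) := by
        rw [Set.disjoint_left]
        intro y h1 h2
        exact absurd (h1.2.trans_le h2.1) (lt_irrefl _)
      have h2 := pow_le_pow_left' (h n hn (by omega)) 2
      rw [mul_pow] at ih h2 ⊢
      simp only [L2norm_sq] at ih h2 ⊢
      rw [hu, lintegral_union measurableSet_Ico hd, lintegral_union measurableSet_Ico hd, mul_add]
      exact add_le_add ih h2
  exact (ENNReal.pow_le_pow_left_iff (by norm_num)).1 key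

variable {a b Λ : ℝ} {v : ℝ → ℝ} {D : ℕ → ℝ → ℝ}

/-- The majorant `G` is compared pointwise with the local width times the local derivative. A graded
mesh can thus trade the growth of its widths against the decay of a layer before any norm is taken.
-/
lemma IsLebesgueBound.L2norm_region_le (hΛ : IsLebesgueBound ξ Λ) (hξ : StrictMono ξ)
    (hξ0 : ξ 0 = 0) (hξ1 : ξ (Fin.last k) = 1) (hx : ∀ i < N, x i ≤ x (i + 1)) {p q : ℕ}
    (hpq : p ≤ q) (hq : q ≤ N) (ha : a ≤ x p) (hb : x q ≤ b) {m : ℕ} (hm : m ≤ k)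
    (hv : HasChain a b (m + 1) v D) {G : ℝ → ℝ}
    (hG : ∀ i, p ≤ i → i < q → ∀ y ∈ Ioo (x i) (x (i + 1)),
      (x (i + 1) - x i) ^ (m + 1) * |D (m + 1) y| ≤ |G y|) :
    L2norm (fun y => v y - interp ξ N x v y) (Ico (x p) (x q)) ≤
      ENNReal.ofReal (1 + Λ) * L2norm G (Ico (x p) (x q)) := by
  have hΛ0 := hΛ.1
  refine L2norm_cells_le hx hpq hq fun i hpi hiq => ?_
  rcases (hx i (by omega)).eq_or_lt with h0 | h0
  · simp [h0, L2norm]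
  have hai : a ≤ x i := ha.trans (mesh_mono hx hpi (by omega))
  have hbi : x (i + 1) ≤ b := (mesh_mono hx (by omega) hq).trans hb
  obtain ⟨F, h1, h2, h3⟩ := hv.mono hai hbi le_rfl
  have hF0 := h1.continuousOn (ℓ := 0) (by omega)
  have hne : ∀ᵐ y : ℝ, y ≠ x i := by simp [ae_iff, measure_singleton]
  have e1 : L2norm (fun y => v y - interp ξ N x v y) (Ico (x i) (x (i + 1))) =
      L2norm (fun y => F 0 y - (cellPoly ξ (x i) (x (i + 1)) (F 0)).eval y)
        (Ico (x i) (x (i + 1))) := by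
    refine L2norm_congr_ae measurableSet_Ico ?_
    filter_upwards [hne] with y hy hy'
    rw [interp_of_mem hx (by omega) hy', cellInterp_eq_cellPoly hξ hξ0 hξ1 h0 hF0 h2,
      h2 y ⟨lt_of_le_of_ne hy'.1 hy.symm, hy'.2⟩]
  rw [e1]
  refine (hΛ.L2norm_cell_le hξ hξ0 hξ1 h0 hm h1).1.trans ?_
  rw [ENNReal.ofReal_mul (by positivity), mul_assoc]
  gcongr
  rw [← abs_of_nonneg (pow_nonneg (sub_nonneg.2 h0.le) (m + 1)), ← L2norm_const_mul]
  refine L2norm_mono_ae measurableSet_Ico ?_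
  filter_upwards [hne, h3 (m + 1) le_rfl] with y hy hy3 hy'
  have hy'' : y ∈ Ioo (x i) (x (i + 1)) := ⟨lt_of_le_of_ne hy'.1 hy.symm, hy'.2⟩
  rw [hy3 hy'', abs_mul, abs_of_nonneg (pow_nonneg (sub_nonneg.2 h0.le) (m + 1))]
  exact hG i hpi hiq y hy''

lemma IsLebesgueBound.L2norm_region_deriv_le (hΛ : IsLebesgueBound ξ Λ) (hξ : StrictMono ξ)
    (hξ0 : ξ 0 = 0) (hξ1 : ξ (Fin.last k) = 1) (hx : ∀ i < N, x i ≤ x (i + 1)) {p q : ℕ}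
    (hpq : p ≤ q) (hq : q ≤ N) (ha : a ≤ x p) (hb : x q ≤ b) {m : ℕ} (hm : m ≤ k)
    (hv : HasChain a b (m + 1) v D) {G : ℝ → ℝ}
    (hG : ∀ i, p ≤ i → i < q → ∀ y ∈ Ioo (x i) (x (i + 1)),
      (x (i + 1) - x i) ^ m * |D (m + 1) y| ≤ |G y|) :
    L2norm (fun y => D 1 y - interpDeriv ξ N x v y) (Ico (x p) (x q)) ≤
      ENNReal.ofReal (1 + Λ) * L2norm G (Ico (x p) (x q)) := by
  have hΛ0 := hΛ.1
  refine L2norm_cells_le hx hpq hq fun i hpi hiq => ?_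
  rcases (hx i (by omega)).eq_or_lt with h0 | h0
  · simp [h0, L2norm]
  have hai : a ≤ x i := ha.trans (mesh_mono hx hpi (by omega))
  have hbi : x (i + 1) ≤ b := (mesh_mono hx (by omega) hq).trans hb
  obtain ⟨F, h1, h2, h3⟩ := hv.mono hai hbi le_rfl
  have hF0 := h1.continuousOn (ℓ := 0) (by omega)
  have hne : ∀ᵐ y : ℝ, y ≠ x i := by simp [ae_iff, measure_singleton]
  have e1 : L2norm (fun y => D 1 y - interpDeriv ξ N x v y) (Ico (x i) (x (i + 1))) =
      L2norm (fun y => F 1 y - (cellPoly ξ (x i) (x (i + 1)) (F 0)).derivative.eval y)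
        (Ico (x i) (x (i + 1))) := by
    refine L2norm_congr_ae measurableSet_Ico ?_
    filter_upwards [hne, h3 1 (by omega)] with y hy hy3 hy'
    rw [interpDeriv_of_mem hx (by omega) hy', cellInterp_eq_cellPoly hξ hξ0 hξ1 h0 hF0 h2,
      hy3 ⟨lt_of_le_of_ne hy'.1 hy.symm, hy'.2⟩]
  rw [e1]
  refine (hΛ.L2norm_cell_le hξ hξ0 hξ1 h0 hm h1).2.trans ?_
  rw [ENNReal.ofReal_mul (by positivity), mul_assoc]
  gcongr
  rw [← abs_of_nonneg (pow_nonneg (sub_nonneg.2 h0.le) m), ← L2norm_const_mul]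
  refine L2norm_mono_ae measurableSet_Ico ?_
  filter_upwards [hne, h3 (m + 1) le_rfl] with y hy hy3 hy'
  have hy'' : y ∈ Ioo (x i) (x (i + 1)) := ⟨lt_of_le_of_ne hy'.1 hy.symm, hy'.2⟩
  rw [hy3 hy'', abs_mul, abs_of_nonneg (pow_nonneg (sub_nonneg.2 h0.le) m)]
  exact hG i hpi hiq y hy''

lemma abs_le_of_continuousOn_Icc {f : ℝ → ℝ} {R : ℝ} (hab : a < b) (hf : ContinuousOn f (Icc a b))
    (h : ∀ y ∈ Ioo a b, |f y| ≤ R) : ∀ y ∈ Icc a b, |f y| ≤ R := by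
  intro y hy
  rw [← closure_Ioo hab.ne] at hf hy
  exact closure_minimal (s := Ioo a b) (t := {y | y ∈ closure (Ioo a b) ∧ |f y| ≤ R})
    (fun y hy => ⟨subset_closure hy, h y hy⟩)
    (by
      have := hf.abs.preimage_isClosed_of_isClosed isClosed_closure (isClosed_Iic (a := R))
      exact this) hy |>.2

/-- Pure stability, with the zero polynomial as approximation: for regions where the function is
small but its derivatives are too large for the mesh. -/
lemma IsLebesgueBound.L2norm_region_le_of_bound (hΛ : IsLebesgueBound ξ Λ) (hξ : StrictMono ξ)
    (hξ0 : ξ 0 = 0) (hξ1 : ξ (Fin.last k) = 1) (hx : ∀ i < N, x i ≤ x (i + 1)) {p q : ℕ}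
    (hpq : p ≤ q) (hq : q ≤ N) (ha : a ≤ x p) (hb : x q ≤ b) {m : ℕ}
    (hv : HasChain a b (m + 1) v D) {R : ℝ} (hR : ∀ y ∈ Ioo (x p) (x q), |v y| ≤ R) :
    L2norm (fun y => v y - interp ξ N x v y) (Ico (x p) (x q)) ≤
      ENNReal.ofReal ((1 + Λ) * R * √(x q - x p)) := by
  have hnode : ∀ᵐ y, ∀ i, y ≠ x i := by
    rw [ae_all_iff]; intro i; simp [ae_iff, measure_singleton]
  have hab := mesh_mono hx hpq hq
  rcases hab.eq_or_lt with h | h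
  · simp [h, L2norm]
  have hR0 : 0 ≤ R := (abs_nonneg _).trans (hR ((x p + x q) / 2) ⟨by linarith, by linarith⟩)
  have hΛ0 := hΛ.1
  have key : L2norm (fun y => v y - interp ξ N x v y) (Ico (x p) (x q)) ≤
      L2norm (fun _ => (1 + Λ) * R) (Ico (x p) (x q)) := by
    refine L2norm_mono_ae measurableSet_Ico ?_
    filter_upwards [hnode] with y hyn hy
    obtain ⟨i, hpi, hiq, hyi⟩ := exists_mem_cell hpq hy
    have hai : a ≤ x i := ha.trans (mesh_mono hx hpi (by omega))
    have hbi : x (i + 1) ≤ b := (mesh_mono hx (by omega) hq).trans hb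
    have h0 : x i < x (i + 1) := hyi.1.trans_lt hyi.2
    obtain ⟨F, h1, h2, -⟩ := hv.mono hai hbi le_rfl
    have hF0 := h1.continuousOn (ℓ := 0) (by omega)
    have hs : Ioo (x i) (x (i + 1)) ⊆ Ioo (x p) (x q) :=
      Ioo_subset_Ioo (mesh_mono hx hpi (by omega)) (mesh_mono hx (by omega) hq)
    have hy' : y ∈ Ioo (x i) (x (i + 1)) := ⟨lt_of_le_of_ne hyi.1 (hyn i).symm, hyi.2⟩
    have hFR : ∀ z ∈ Icc (x i) (x (i + 1)), |F 0 z - (0 : Polynomial ℝ).eval z| ≤ R := by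
      simp only [Polynomial.eval_zero, sub_zero]
      exact abs_le_of_continuousOn_Icc h0 hF0 fun z hz => by rw [← h2 z hz]; exact hR z (hs hz)
    rw [interp_of_mem hx (by omega) hyi, cellInterp_eq_cellPoly hξ hξ0 hξ1 h0 hF0 h2, h2 y hy',
      abs_of_nonneg (by positivity : 0 ≤ (1 + Λ) * R)]
    exact (hΛ.abs_sub_cellPoly_le hξ hξ0 hξ1 h0 (by simp) hFR
      (Ioo_subset_Icc_self hy')).1
  refine key.trans (L2norm_le_of_bound measurableSet_Ico (fun y _ => ?_) (by linarith) (by simp))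
  rw [abs_of_nonneg (by positivity)]

/-! ### The weak derivative of the interpolation error -/

/-- The error vanishes at both ends of each cell because `ξ` contains `0` and `1`. Hence its
derivative has integral zero over each cell, and the primitive from `0` restarts at zero at every
node. As `1` is a node, no cell mixes the two chains. -/
lemma hasWeakDeriv_interp_error (hξ : StrictMono ξ)
    (hξ0 : ξ 0 = 0) (hξ1 : ξ (Fin.last k) = 1) (hx : ∀ i < N, x i ≤ x (i + 1))
    (hx0 : x 0 = 0) (hxN : x N = 2) {r : ℕ} (hr : r ≤ N) (hxr : x r = 1) {u : ℝ → ℝ} {m : ℕ}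
    (hu : ContinuousOn u (Icc 0 2)) (h1 : HasChain 0 1 (m + 1) u D)
    (h2 : HasChain 1 2 (m + 1) u D) :
    HasWeakDeriv 0 2 (fun y => u y - interp ξ N x u y) (fun y => D 1 y - interpDeriv ξ N x u y) := by
  set g : ℝ → ℝ := fun y => D 1 y - interpDeriv ξ N x u y with hg
  have cell : ∀ i < N, x i < x (i + 1) → IntervalIntegrable g volume (x i) (x (i + 1)) ∧
      (∀ y ∈ Icc (x i) (x (i + 1)), u y - (cellInterp ξ (x i) (x (i + 1)) u).eval y =
        ∫ t in (x i)..y, g t) ∧ ∫ t in (x i)..(x (i + 1)), g t = 0 := by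
    intro i hi h0
    have hch : HasChain (x i) (x (i + 1)) (m + 1) u D := by
      have hi0 : 0 ≤ x i := hx0 ▸ mesh_mono hx (Nat.zero_le i) hi.le
      have hi2 : x (i + 1) ≤ 2 := hxN ▸ mesh_mono hx hi le_rfl
      rcases lt_or_ge i r with hir | hir
      · exact h1.mono hi0 (hxr ▸ mesh_mono hx hir hr) le_rfl
      · exact h2.mono (hxr ▸ mesh_mono hx hir hi.le) hi2 le_rfl
    obtain ⟨F, hF, hF0, hFD⟩ := hch
    have hc := hF.continuousOn (ℓ := 0) (by omega)
    have hsub : Icc (x i) (x (i + 1)) ⊆ Icc 0 2 := Icc_subset_Icc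
      (hx0 ▸ mesh_mono hx (Nat.zero_le i) hi.le) (hxN ▸ mesh_mono hx hi le_rfl)
    -- Continuity of `u` extends the identity to the end points of the cell; for a cell ending at
    -- `1` this excludes a jump there.
    have huF : ∀ y ∈ Icc (x i) (x (i + 1)), u y = F 0 y := by
      intro y hy
      have := abs_le_of_continuousOn_Icc (R := 0) h0 ((hu.mono hsub).sub hc)
        (fun z hz => by simp [hF0 z hz]) y hy
      simpa [sub_eq_zero] using this
    rw [cellInterp_eq_cellPoly hξ hξ0 hξ1 h0 hc hF0]
    set P := cellPoly ξ (x i) (x (i + 1)) (F 0) with hP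
    have ha : x i ∈ Icc (x i) (x (i + 1)) := left_mem_Icc.2 h0.le
    have hb : x (i + 1) ∈ Icc (x i) (x (i + 1)) := right_mem_Icc.2 h0.le
    have hPa : P.eval (x i) = F 0 (x i) := by
      have := cellPoly_eval_node hξ h0 (F 0) 0
      simpa [hξ0] using this
    have hPb : P.eval (x (i + 1)) = F 0 (x (i + 1)) := by
      have := cellPoly_eval_node hξ h0 (F 0) (Fin.last k)
      simpa [hξ1] using this
    have hgae : ∀ᵐ y, y ∈ Ioc (x i) (x (i + 1)) → F 1 y - P.derivative.eval y = g y := by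
      have hne : ∀ᵐ y : ℝ, y ≠ x (i + 1) := by simp [ae_iff, measure_singleton]
      filter_upwards [hne, hFD 1 (by omega)] with y hy hyD hy'
      have hy2 : y < x (i + 1) := lt_of_le_of_ne hy'.2 hy
      rw [hg]
      simp only
      rw [interpDeriv_of_mem hx hi ⟨hy'.1.le, hy2⟩, cellInterp_eq_cellPoly hξ hξ0 hξ1 h0 hc hF0,
        hyD ⟨hy'.1, hy2⟩]
    have hint : ∀ y ∈ Icc (x i) (x (i + 1)), u y - P.eval y = ∫ t in (x i)..y, g t := by
      intro y hy
      have e1 : ∫ t in (x i)..y, g t = ∫ t in (x i)..y, (F 1 t - P.derivative.eval t) := by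
        refine intervalIntegral.integral_congr_ae ?_
        filter_upwards [hgae] with t ht ht'
        rw [uIoc_of_le hy.1] at ht'
        exact (ht ⟨ht'.1, ht'.2.trans hy.2⟩).symm
      rw [e1, intervalIntegral.integral_sub (hF.intervalIntegrable (ℓ := 0) (by omega) ha hy)
        (P.derivative.continuous.intervalIntegrable _ _), ← hF.sub_eq 0 (by omega) _ ha y hy,
        intervalIntegral.integral_eq_sub_of_hasDerivAt (f := fun t => P.eval t)
          (fun t _ => P.hasDerivAt t) (P.derivative.continuous.intervalIntegrable _ _),
        huF y hy, hPa]
      ring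
    refine ⟨?_, hint, ?_⟩
    · refine IntervalIntegrable.congr_ae
        ((hF.intervalIntegrable (ℓ := 0) (by omega) ha hb).sub
          (P.derivative.continuous.intervalIntegrable _ _)) ?_
      rw [uIoc_of_le h0.le]
      exact (ae_restrict_iff' measurableSet_Ioc).2 hgae
    · rw [← hint _ hb, huF _ hb, hPb, sub_self]
  have acc : ∀ n ≤ N, IntervalIntegrable g volume (x 0) (x n) ∧ ∫ t in (x 0)..(x n), g t = 0 := by
    intro n
    induction n with
    | zero => intro _; simp
    | succ n ih =>
      intro hn
      obtain ⟨i1, i2⟩ := ih (by omega)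
      rcases (hx n (by omega)).eq_or_lt with h0 | h0
      · rw [← h0]; exact ⟨i1, i2⟩
      · obtain ⟨j1, -, j2⟩ := cell n (by omega) h0
        refine ⟨i1.trans j1, ?_⟩
        rw [← intervalIntegral.integral_add_adjacent_intervals i1 j1, i2, j2, add_zero]
  have hall := (acc N le_rfl).1
  rw [hx0, hxN, intervalIntegrable_iff_integrableOn_Ioo_of_le (by norm_num)] at hall
  refine HasWeakDeriv.of_primitive (c := 0) (by norm_num) hall fun y hy => ?_
  obtain ⟨i, -, hi, hyi⟩ := exists_mem_cell (x := x) (Nat.zero_le N) (y := y)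
    (by rw [hx0, hxN]; exact ⟨hy.1.le, hy.2⟩)
  have h0 := hyi.1.trans_lt hyi.2
  obtain ⟨j1, j2, -⟩ := cell i hi h0
  obtain ⟨i1, i2⟩ := acc i hi.le
  rw [interp_of_mem hx hi hyi, j2 y ⟨hyi.1, hyi.2.le⟩, zero_add, ← hx0,
    ← intervalIntegral.integral_add_adjacent_intervals i1
      (j1.mono_set (uIcc_subset_uIcc_left (by rw [uIcc_of_le h0.le]; exact ⟨hyi.1, hyi.2.le⟩))),
    i2, zero_add]

end Mesh

/-! ### Chains of derivatives of Sobolev functions and of smooth functions -/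

/-- Passage from relations almost everywhere to the exact fundamental theorem of calculus: below the
top order each `D ℓ` is replaced by the primitive it agrees with almost everywhere, and `D (m + 1)`
itself is kept. -/
lemma hasChain_of_ae_primitive {a b : ℝ} (hab : a < b) {m : ℕ} {v : ℝ → ℝ} {D : ℕ → ℝ → ℝ}
    (hD0 : D 0 = v) (hv : ContinuousOn v (Ioo a b))
    (hi : ∀ ℓ < m + 1, IntegrableOn (D (ℓ + 1)) (Ioo a b))
    (hp : ∀ ℓ < m + 1, ∃ c, ∀ᵐ x, x ∈ Ioo a b → D ℓ x = c + ∫ t in a..x, D (ℓ + 1) t) :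
    HasChain a b (m + 1) v D := by
  choose! c hc using hp
  set F : ℕ → ℝ → ℝ := fun ℓ x => if ℓ < m + 1 then c ℓ + ∫ t in a..x, D (ℓ + 1) t else D ℓ x
    with hF
  have hFD : ∀ ℓ ≤ m + 1, ∀ᵐ x, x ∈ Ioo a b → F ℓ x = D ℓ x := by
    intro ℓ hℓ
    by_cases h : ℓ < m + 1
    · filter_upwards [hc ℓ h] with x hx hx'
      simp only [hF, if_pos h]
      exact (hx hx').symm
    · exact Eventually.of_forall fun x _ => by simp only [hF, if_neg h]
  have hi' : ∀ ℓ < m + 1, IntervalIntegrable (D (ℓ + 1)) volume a b := fun ℓ hℓ =>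
    (intervalIntegrable_iff_integrableOn_Ioo_of_le hab.le).2 (hi ℓ hℓ)
  have ha : a ∈ Icc a b := left_mem_Icc.2 hab.le
  have hsub : ∀ {x y}, x ∈ Icc a b → y ∈ Icc a b → uIcc x y ⊆ uIcc a b := by
    intro x y hx hy
    rw [uIcc_of_le hab.le]; exact uIcc_subset_Icc hx hy
  have hchain : IsDerivChain a b (m + 1) F := by
    refine ⟨fun ℓ hℓ => ?_, fun ℓ hℓ x hx y hy => ?_⟩
    · rw [integrableOn_Icc_iff_integrableOn_Ioo]
      refine (hi ℓ hℓ).congr ((ae_restrict_iff' measurableSet_Ioo).2 ?_)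
      filter_upwards [hFD (ℓ + 1) (by omega)] with x hx hx'
      exact (hx hx').symm
    · have e1 : ∫ t in x..y, F (ℓ + 1) t = ∫ t in x..y, D (ℓ + 1) t := by
        refine intervalIntegral.integral_congr_ae ?_
        have hne : ∀ᵐ y : ℝ, y ≠ b := by simp [ae_iff, measure_singleton]
        filter_upwards [hFD (ℓ + 1) (by omega), hne] with t ht hne' ht'
        refine ht ⟨?_, ?_⟩
        · exact (le_min hx.1 hy.1).trans_lt ht'.1
        · exact lt_of_le_of_ne (ht'.2.trans (max_le hx.2 hy.2)) hne'
      rw [e1]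
      simp only [hF, if_pos hℓ]
      have h1 := (hi' ℓ hℓ).mono_set (hsub ha hx)
      have h2 := (hi' ℓ hℓ).mono_set (hsub hx hy)
      rw [← intervalIntegral.integral_add_adjacent_intervals h1 h2]
      ring
  refine ⟨F, hchain, ?_, hFD⟩
  have hcont := (hchain.continuousOn (ℓ := 0) (by omega)).mono Ioo_subset_Icc_self
  -- Two continuous functions that agree almost everywhere on an open interval agree everywhere on
  -- it.
  refine Measure.eqOn_open_of_ae_eq (μ := volume) ?_ isOpen_Ioo hv hcont
  refine (ae_restrict_iff' measurableSet_Ioo).2 ?_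
  filter_upwards [hFD 0 (by omega)] with x hx hx'
  rw [hx hx', hD0]

lemma HasWeakDeriv.integrableOn {a b : ℝ} {v g : ℝ → ℝ} (h : HasWeakDeriv a b v g)
    (hg : L2norm g (Ioo a b) < ⊤) : IntegrableOn g (Ioo a b) := by
  have h1 : MemLp g 2 (volume.restrict (Ioo a b)) := ⟨h.2.1.aestronglyMeasurable, hg⟩
  exact h1.integrable (by norm_num)

lemma hasChain_of_hasWeakDeriv {a b : ℝ} (hab : a < b) {m : ℕ} {v : ℝ → ℝ} {D : ℕ → ℝ → ℝ}
    (hD0 : D 0 = v) (hv : ContinuousOn v (Ioo a b))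
    (hw : ∀ ℓ < m + 1, HasWeakDeriv a b (D ℓ) (D (ℓ + 1)))
    (hD : ∀ ℓ ≤ m + 1, L2norm (D ℓ) (Ioo a b) < ⊤) : HasChain a b (m + 1) v D :=
  hasChain_of_ae_primitive hab hD0 hv
    (fun ℓ hℓ => (hw ℓ hℓ).integrableOn (hD (ℓ + 1) hℓ))
    (fun ℓ hℓ => (hw ℓ hℓ).ae_eq_primitive hab ((hw ℓ hℓ).integrableOn (hD (ℓ + 1) hℓ)))

lemma BrokenSobolevBound.exists_hasChain {m : ℕ} {K : ℝ} {v : ℝ → ℝ}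
    (h : BrokenSobolevBound (m + 1) K v) : ∃ D : ℕ → ℝ → ℝ,
      HasChain 0 1 (m + 1) v D ∧ HasChain 1 2 (m + 1) v D ∧
      ∀ ℓ ≤ m + 1, L2norm (D ℓ) (Ioo 0 1) + L2norm (D ℓ) (Ioo 1 2) ≤ ENNReal.ofReal K := by
  obtain ⟨c1, c2, D, hD0, hw, hD⟩ := h
  refine ⟨D, ?_, ?_, hD⟩
  · exact hasChain_of_hasWeakDeriv zero_lt_one hD0 c1 (fun ℓ hℓ => (hw ℓ hℓ).1)
      fun ℓ hℓ => (le_self_add.trans (hD ℓ hℓ)).trans_lt ENNReal.ofReal_lt_top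
  · exact hasChain_of_hasWeakDeriv one_lt_two hD0 c2 (fun ℓ hℓ => (hw ℓ hℓ).2)
      fun ℓ hℓ => (le_add_self.trans (hD ℓ hℓ)).trans_lt ENNReal.ofReal_lt_top

lemma continuousOn_iteratedDeriv {a b : ℝ} {m : ℕ} {v : ℝ → ℝ} (hv : ContDiffOn ℝ m v (Ioo a b))
    {ℓ : ℕ} (hℓ : ℓ ≤ m) : ContinuousOn (iteratedDeriv ℓ v) (Ioo a b) :=
  (hv.continuousOn_iteratedDerivWithin (by exact_mod_cast hℓ) isOpen_Ioo.uniqueDiffOn).congr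
    fun _ hx => (iteratedDerivWithin_of_isOpen isOpen_Ioo hx).symm

lemma hasDerivAt_iteratedDeriv {a b : ℝ} {m : ℕ} {v : ℝ → ℝ} (hv : ContDiffOn ℝ m v (Ioo a b))
    {ℓ : ℕ} (hℓ : ℓ < m) {x : ℝ} (hx : x ∈ Ioo a b) :
    HasDerivAt (iteratedDeriv ℓ v) (iteratedDeriv (ℓ + 1) v x) x := by
  have h1 := (hv.differentiableOn_iteratedDerivWithin (m := ℓ) (by exact_mod_cast hℓ)
    isOpen_Ioo.uniqueDiffOn).congr (f₁ := iteratedDeriv ℓ v)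
    (fun _ hx => (iteratedDerivWithin_of_isOpen isOpen_Ioo hx).symm)
  rw [iteratedDeriv_succ]
  exact ((h1 x hx).differentiableAt (isOpen_Ioo.mem_nhds hx)).hasDerivAt

lemma hasChain_of_contDiffOn {a b : ℝ} (hab : a < b) {m : ℕ} {v : ℝ → ℝ}
    (hv : ContDiffOn ℝ (m + 1 : ℕ) v (Ioo a b))
    (hb : ∀ ℓ ≤ m + 1, ∃ B, ∀ x ∈ Ioo a b, |iteratedDeriv ℓ v x| ≤ B) :
    HasChain a b (m + 1) v (fun ℓ => iteratedDeriv ℓ v) := by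
  have hi : ∀ ℓ < m + 1, IntegrableOn (iteratedDeriv (ℓ + 1) v) (Ioo a b) := by
    intro ℓ hℓ
    obtain ⟨B, hB⟩ := hb (ℓ + 1) hℓ
    refine Integrable.of_bound
      ((continuousOn_iteratedDeriv hv hℓ).aestronglyMeasurable measurableSet_Ioo) B ?_
    exact (ae_restrict_iff' measurableSet_Ioo).2 (Eventually.of_forall hB)
  refine hasChain_of_ae_primitive hab iteratedDeriv_zero hv.continuousOn hi fun ℓ hℓ => ?_
  -- Derivatives exist only inside the interval, so the fundamental theorem is based at an interior
  -- point and then shifted to `a`.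
  set z := (a + b) / 2 with hz
  have hzm : z ∈ Ioo a b := ⟨by linarith, by linarith⟩
  refine ⟨iteratedDeriv ℓ v z - ∫ t in a..z, iteratedDeriv (ℓ + 1) v t,
    Eventually.of_forall fun x hx => ?_⟩
  have hii := (intervalIntegrable_iff_integrableOn_Ioo_of_le hab.le).2 (hi ℓ hℓ)
  have hs : ∀ {x y}, x ∈ Icc a b → y ∈ Icc a b →
      IntervalIntegrable (iteratedDeriv (ℓ + 1) v) volume x y := fun hx hy =>
    hii.mono_set (by rw [uIcc_of_le hab.le]; exact uIcc_subset_Icc hx hy)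
  have hzc := Ioo_subset_Icc_self hzm
  have hxc := Ioo_subset_Icc_self hx
  have h1 : ∫ t in z..x, iteratedDeriv (ℓ + 1) v t = iteratedDeriv ℓ v x - iteratedDeriv ℓ v z := by
    refine intervalIntegral.integral_eq_sub_of_hasDerivAt (fun t ht => ?_) (hs hzc hxc)
    exact hasDerivAt_iteratedDeriv hv hℓ (OrdConnected.uIcc_subset ordConnected_Ioo hzm hx ht)
  have h2 := intervalIntegral.integral_add_adjacent_intervals
    (hs (left_mem_Icc.2 hab.le) hzc) (hs hzc hxc)
  linarith

lemma iteratedDeriv_eq_zero_of_eq_zero {U : Set ℝ} (hU : IsOpen U) {v : ℝ → ℝ}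
    (hv : ∀ x ∈ U, v x = 0) (ℓ : ℕ) {x : ℝ} (hx : x ∈ U) : iteratedDeriv ℓ v x = 0 := by
  have h : v =ᶠ[𝓝 x] fun _ => 0 := by
    filter_upwards [hU.mem_nhds hx] with y hy using hv y hy
  rw [h.iteratedDeriv_eq, iteratedDeriv_fun_const_zero]

/-! ### The mesh -/

section Mesh
variable {k n : ℕ} {β σ ε : ℝ} {φ : ℝ → ℝ}

lemma node_strongLayer {i : ℕ} (hi : i ≤ n) : node k β σ ε (4 * n) φ i =
    σ * ε / β * φ (2 * i / (4 * n : ℕ)) := by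
  unfold node; rw [if_pos (by omega)]

lemma node_last_strongLayer (hn : 0 < n) (hφ : IsMeshFunction (4 * n) φ) :
    node k β σ ε (4 * n) φ n = lam β σ ε (4 * n) := by
  rw [node_strongLayer le_rfl, lam]
  have : (2 * (n : ℝ) / (4 * n : ℕ)) = 1 / 2 := by
    have : (n : ℝ) ≠ 0 := by exact_mod_cast hn.ne'
    push_cast; field_simp; norm_num
  rw [this, hφ.map_half]

/-- The branches of `node` agree at the transition indices. This formula and the next two therefore
hold from the transition index on, although `node` selects the earlier branch there. -/
lemma node_middle (hn : 0 < n) (hφ : IsMeshFunction (4 * n) φ) {i : ℕ} (h1 : n ≤ i)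
    (h2 : i ≤ 2 * n) : node k β σ ε (4 * n) φ i =
      i / n * (1 - lam β σ ε (4 * n)) + 2 * lam β σ ε (4 * n) - 1 := by
  have hn' : (n : ℝ) ≠ 0 := by exact_mod_cast hn.ne'
  rcases h1.eq_or_lt with rfl | h1
  · rw [node_last_strongLayer hn hφ, div_self hn']; ring
  · unfold node; rw [if_neg (by omega), if_pos (by omega)]
    push_cast
    congr 3
    field_simp

lemma node_weakLayer (hn : 0 < n) (hφ : IsMeshFunction (4 * n) φ) {i : ℕ} (h1 : 2 * n ≤ i)
    (h2 : i ≤ 3 * n) : node k β σ ε (4 * n) φ i = 1 + mu k β ε * (i / n - 2) := by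
  have hn' : (n : ℝ) ≠ 0 := by exact_mod_cast hn.ne'
  rcases h1.eq_or_lt with rfl | h1
  · rw [node_middle hn hφ (by omega) le_rfl]
    push_cast; field_simp; ring
  · unfold node; rw [if_neg (by omega), if_neg (by omega), if_pos (by omega)]
    push_cast
    congr 3
    field_simp

lemma node_right (hn : 0 < n) (hφ : IsMeshFunction (4 * n) φ) {i : ℕ} (h1 : 3 * n ≤ i) :
    node k β σ ε (4 * n) φ i = i / n * (1 - mu k β ε) + 4 * mu k β ε - 2 := by
  have hn' : (n : ℝ) ≠ 0 := by exact_mod_cast hn.ne'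
  rcases h1.eq_or_lt with rfl | h1
  · rw [node_weakLayer hn hφ (by omega) le_rfl]
    push_cast; field_simp; ring
  · unfold node; rw [if_neg (by omega), if_neg (by omega), if_neg (by omega)]
    push_cast
    congr 3
    field_simp

lemma node_zero (hφ : IsMeshFunction (4 * n) φ) : node k β σ ε (4 * n) φ 0 = 0 := by
  rw [node_strongLayer (Nat.zero_le _)]
  simp [hφ.map_zero]

lemma node_two_mul (hn : 0 < n) (hφ : IsMeshFunction (4 * n) φ) :
    node k β σ ε (4 * n) φ (2 * n) = 1 := by
  have hn' : (n : ℝ) ≠ 0 := by exact_mod_cast hn.ne'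
  rw [node_middle hn hφ (by omega) le_rfl]
  push_cast; field_simp; ring

lemma node_three_mul (hn : 0 < n) (hφ : IsMeshFunction (4 * n) φ) :
    node k β σ ε (4 * n) φ (3 * n) = 1 + mu k β ε := by
  have hn' : (n : ℝ) ≠ 0 := by exact_mod_cast hn.ne'
  rw [node_weakLayer hn hφ (by omega) le_rfl]
  push_cast; field_simp; ring

lemma node_last (hn : 0 < n) (hφ : IsMeshFunction (4 * n) φ) :
    node k β σ ε (4 * n) φ (4 * n) = 2 := by
  have hn' : (n : ℝ) ≠ 0 := by exact_mod_cast hn.ne'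
  rw [node_right hn hφ (by omega)]
  push_cast; field_simp; ring

lemma width_middle (hn : 0 < n) (hφ : IsMeshFunction (4 * n) φ) {i : ℕ} (h1 : n ≤ i)
    (h2 : i < 2 * n) : node k β σ ε (4 * n) φ (i + 1) - node k β σ ε (4 * n) φ i =
      (1 - lam β σ ε (4 * n)) / n := by
  rw [node_middle hn hφ h1 h2.le, node_middle hn hφ (by omega) h2]
  push_cast; ring

lemma width_weakLayer (hn : 0 < n) (hφ : IsMeshFunction (4 * n) φ) {i : ℕ} (h1 : 2 * n ≤ i)
    (h2 : i < 3 * n) : node k β σ ε (4 * n) φ (i + 1) - node k β σ ε (4 * n) φ i =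
      mu k β ε / n := by
  rw [node_weakLayer hn hφ h1 h2.le, node_weakLayer hn hφ (by omega) h2]
  push_cast; ring

lemma width_right (hn : 0 < n) (hφ : IsMeshFunction (4 * n) φ) {i : ℕ} (h1 : 3 * n ≤ i) :
    node k β σ ε (4 * n) φ (i + 1) - node k β σ ε (4 * n) φ i = (1 - mu k β ε) / n := by
  rw [node_right hn hφ h1, node_right hn hφ (by omega)]
  push_cast; ring

lemma gridPoint_mem {i : ℕ} (hi : i ≤ n) : 2 * (i : ℝ) / (4 * n : ℕ) ∈ Icc (0 : ℝ) (1 / 2) := by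
  refine ⟨by positivity, ?_⟩
  rcases Nat.eq_zero_or_pos n with rfl | hn
  · simp
  have hn' : (0 : ℝ) < n := by exact_mod_cast hn
  have : (i : ℝ) ≤ n := by exact_mod_cast hi
  rw [div_le_iff₀ (by push_cast; positivity)]
  push_cast; linarith

lemma width_strongLayer_nonneg (hβ : 0 < β) (hσ : 0 < σ) (hε : 0 < ε)
    (hφ : IsMeshFunction (4 * n) φ) {i : ℕ} (hi : i < n) :
    0 ≤ node k β σ ε (4 * n) φ (i + 1) - node k β σ ε (4 * n) φ i := by
  rw [node_strongLayer hi.le, node_strongLayer hi, ← mul_sub]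
  refine mul_nonneg (by positivity) (sub_nonneg.2 ?_)
  refine hφ.monotoneOn (gridPoint_mem hi.le) (gridPoint_mem hi) ?_
  gcongr; omega

lemma width_le_h₁ {i : ℕ} (hi : i < n) :
    node k β σ ε (4 * n) φ (i + 1) - node k β σ ε (4 * n) φ i ≤ h₁ k β σ ε (4 * n) φ := by
  have h4 : 4 * n / 4 = n := by omega
  exact le_ciSup (f := fun i : Fin (4 * n / 4) =>
    node k β σ ε (4 * n) φ (i + 1) - node k β σ ε (4 * n) φ i) (Set.finite_range _).bddAbove
    ⟨i, by omega⟩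

lemma h₁_nonneg (hn : 0 < n) (hβ : 0 < β) (hσ : 0 < σ) (hε : 0 < ε)
    (hφ : IsMeshFunction (4 * n) φ) : 0 ≤ h₁ k β σ ε (4 * n) φ :=
  (width_strongLayer_nonneg hβ hσ hε hφ hn).trans (width_le_h₁ hn)

lemma node_mono (hn : 0 < n) (hβ : 0 < β) (hσ : 0 < σ) (hε : 0 < ε)
    (hφ : IsMeshFunction (4 * n) φ) (hlam : lam β σ ε (4 * n) ≤ 1 / 2) (hmu0 : 0 ≤ mu k β ε)
    (hmu : mu k β ε ≤ 1 / 2) :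
    ∀ i < 4 * n, node k β σ ε (4 * n) φ i ≤ node k β σ ε (4 * n) φ (i + 1) := by
  intro i _
  rw [← sub_nonneg]
  rcases lt_or_ge i n with h | h
  · exact width_strongLayer_nonneg hβ hσ hε hφ h
  rcases lt_or_ge i (2 * n) with h2 | h2
  · rw [width_middle hn hφ h h2]; exact div_nonneg (by linarith) (by positivity)
  rcases lt_or_ge i (3 * n) with h3 | h3
  · rw [width_weakLayer hn hφ h2 h3]; positivity
  · rw [width_right hn hφ h3]; exact div_nonneg (by linarith) (by positivity)

lemma width_le (hn : 0 < n) (hβ : 0 < β) (hσ : 0 < σ) (hε : 0 < ε)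
    (hφ : IsMeshFunction (4 * n) φ) (hlam0 : 0 ≤ lam β σ ε (4 * n)) (hmu0 : 0 ≤ mu k β ε)
    (hmu : mu k β ε ≤ 1 / 2) (i : ℕ) :
    node k β σ ε (4 * n) φ (i + 1) - node k β σ ε (4 * n) φ i ≤
      h₁ k β σ ε (4 * n) φ + 1 / n := by
  have hh := h₁_nonneg (k := k) hn hβ hσ hε hφ
  have hn' : (0 : ℝ) < n := by exact_mod_cast hn
  have hn0 : (0 : ℝ) ≤ 1 / n := by positivity
  have aux : ∀ z : ℝ, z ≤ 1 → z / n ≤ h₁ k β σ ε (4 * n) φ + 1 / n := fun z hz => by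
    have : z / n ≤ 1 / n := by gcongr
    linarith
  rcases lt_or_ge i n with h | h
  · exact (width_le_h₁ h).trans (by linarith)
  rcases lt_or_ge i (2 * n) with h2 | h2
  · rw [width_middle hn hφ h h2]; exact aux _ (by linarith)
  rcases lt_or_ge i (3 * n) with h3 | h3
  · rw [width_weakLayer hn hφ h2 h3]; exact aux _ (by linarith)
  · rw [width_right hn hφ h3]; exact aux _ (by linarith)

/-- Gives `h₁ ≤ 1/2`, which keeps the base bounded when a power of the mesh width is lowered. -/
lemma h₁_le_lam (hn : 0 < n) (hβ : 0 < β) (hσ : 0 < σ) (hε : 0 < ε)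
    (hφ : IsMeshFunction (4 * n) φ) : h₁ k β σ ε (4 * n) φ ≤ lam β σ ε (4 * n) := by
  have h4 : 4 * n / 4 = n := by omega
  have : Nonempty (Fin (4 * n / 4)) := ⟨⟨0, by omega⟩⟩
  refine ciSup_le fun i => ?_
  have hi : (i : ℕ) < n := by have := i.2; omega
  have hm : ∀ j < n, node k β σ ε (4 * n) φ j ≤ node k β σ ε (4 * n) φ (j + 1) := fun j hj =>
    sub_nonneg.1 (width_strongLayer_nonneg hβ hσ hε hφ hj)
  have h0 := mesh_mono hm (Nat.zero_le i) hi.le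
  have h1 := mesh_mono hm (i := i + 1) (j := n) hi le_rfl
  rw [node_zero hφ] at h0
  rw [node_last_strongLayer hn hφ] at h1
  linarith

/-! ### The mesh characterising function -/

/-- The fundamental theorem of calculus tolerates the finitely many exceptional points, since `psi
φ` is continuous across them. -/
lemma psi_sub_le {N : ℕ} (hφ : IsMeshFunction N φ) {s t : ℝ} (hs : 0 ≤ s) (hst : s ≤ t)
    (ht : t ≤ 1 / 2) : psi φ s - psi φ t ≤ maxAbsDerivPsi φ * (t - s) := by
  obtain ⟨P, hP⟩ := hφ.differentiableAt
  have hbd : ∀ x ∈ Ioo (0 : ℝ) (1 / 2), |deriv (psi φ) x| ≤ maxAbsDerivPsi φ := fun x hx =>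
    le_csSup hφ.bddAbove (mem_image_of_mem _ hx)
  have hii : IntervalIntegrable (deriv (psi φ)) volume s t := by
    rw [intervalIntegrable_iff_integrableOn_Ioo_of_le hst]
    refine Measure.integrableOn_of_bounded (M := maxAbsDerivPsi φ) (by simp)
      (measurable_deriv _).aestronglyMeasurable ?_
    exact (ae_restrict_iff' measurableSet_Ioo).2
      (Eventually.of_forall fun x hx => hbd x ⟨hs.trans_lt hx.1, hx.2.trans_le ht⟩)
  have hcont : ContinuousOn (psi φ) (Icc s t) :=
    (hφ.continuousOn.mono (Icc_subset_Icc hs ht)).neg.rexp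
  have h1 := integral_eq_of_hasDerivAt_off_countable_of_le (psi φ) (deriv (psi φ)) hst
    (s := (P : Set ℝ)) P.countable_toSet hcont
    (fun x hx => by
      have hx' : x ∈ Ioo (0 : ℝ) (1 / 2) := ⟨hs.trans_lt hx.1.1, hx.1.2.trans_le ht⟩
      exact ((hP x hx' hx.2).neg.exp).hasDerivAt) hii
  have h2 : |∫ x in s..t, deriv (psi φ) x| ≤ maxAbsDerivPsi φ * (t - s) := by
    have hae : ∀ᵐ x, x ∈ uIoc s t → ‖deriv (psi φ) x‖ ≤ maxAbsDerivPsi φ := by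
      have hne : ∀ᵐ y : ℝ, y ≠ 1 / 2 := by simp [ae_iff, measure_singleton]
      filter_upwards [hne] with x hx hx'
      rw [uIoc_of_le hst] at hx'
      exact hbd x ⟨hs.trans_lt hx'.1, lt_of_le_of_ne (hx'.2.trans ht) hx⟩
    have := intervalIntegral.norm_integral_le_of_norm_le_const_ae hae
    rwa [Real.norm_eq_abs, abs_of_nonneg (sub_nonneg.2 hst)] at this
  rw [h1] at h2
  linarith [(abs_le.1 h2).1]

/-- On an interval of length `1/2`, `psi φ` falls from `1` to `1/N ≤ 1/4`. Hence powers of `N⁻¹` are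
dominated by powers of `N⁻¹ max|ψ'|`. -/
lemma one_le_maxAbsDerivPsi (hn : 0 < n) (hφ : IsMeshFunction (4 * n) φ) :
    1 ≤ maxAbsDerivPsi φ := by
  have h := psi_sub_le hφ le_rfl (by norm_num : (0 : ℝ) ≤ 1 / 2) le_rfl
  have hn' : (1 : ℝ) ≤ n := by exact_mod_cast hn
  rw [psi, psi, hφ.map_zero, hφ.map_half, Real.exp_neg, Real.exp_neg, Real.exp_log
    (by push_cast; positivity), Real.exp_zero] at h
  have h2 : ((4 * n : ℕ) : ℝ)⁻¹ ≤ 1 / 4 := by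
    push_cast
    rw [mul_inv]
    have : (n : ℝ)⁻¹ ≤ 1 := inv_le_one_of_one_le₀ hn'
    linarith
  norm_num at h
  norm_num at h2
  linarith

/-- The key property of the graded mesh: relative to `ε`, a cell may grow at most like `exp (β y /
(σ ε))`, the root of order `σ` of the inverse layer function. -/
lemma width_strongLayer_le (hn : 0 < n) (hβ : 0 < β) (hσ : 0 < σ) (hε : 0 < ε)
    (hφ : IsMeshFunction (4 * n) φ) {K₁ : ℝ} (hK₁ : h₁ k β σ ε (4 * n) φ ≤ K₁ * ε) {i : ℕ}
    (hi : i < n) {y : ℝ} (hy : node k β σ ε (4 * n) φ i ≤ y) :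
    node k β σ ε (4 * n) φ (i + 1) - node k β σ ε (4 * n) φ i ≤
      2 * σ / β * Real.exp (β * K₁ / σ) * ε * (((4 * n : ℕ) : ℝ)⁻¹ * maxAbsDerivPsi φ) *
        Real.exp (β * y / (σ * ε)) := by
  have hw := (width_le_h₁ (k := k) (β := β) (σ := σ) (ε := ε) (φ := φ) hi).trans hK₁
  have hM := one_le_maxAbsDerivPsi hn hφ
  have e0 := node_strongLayer (k := k) (β := β) (σ := σ) (ε := ε) (φ := φ) hi.le
  have e1 := node_strongLayer (k := k) (β := β) (σ := σ) (ε := ε) (φ := φ) (i := i + 1) hi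
  set x0 := node k β σ ε (4 * n) φ i
  set x1 := node k β σ ε (4 * n) φ (i + 1)
  have hm0 := gridPoint_mem hi.le
  have hm1 := gridPoint_mem (n := n) (i := i + 1) hi
  set s := 2 * (i : ℝ) / (4 * n : ℕ) with hs
  set t := 2 * ((i + 1 : ℕ) : ℝ) / (4 * n : ℕ) with ht
  have hts : t - s = 2 * ((4 * n : ℕ) : ℝ)⁻¹ := by rw [hs, ht]; push_cast; ring
  have hN0 : (0 : ℝ) ≤ ((4 * n : ℕ) : ℝ)⁻¹ := by positivity
  have hp := psi_sub_le hφ hm0.1 (by linarith : s ≤ t) hm1.2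
  rw [hts] at hp
  -- The inequality `z ≤ exp z - 1` turns the increment of `φ` into one of `psi φ`, at the price of
  -- the factor `exp (φ t)`.
  have h1 : φ t - φ s ≤ Real.exp (φ t) * (maxAbsDerivPsi φ * (2 * ((4 * n : ℕ) : ℝ)⁻¹)) := by
    calc φ t - φ s ≤ Real.exp (φ t - φ s) - 1 := by linarith [Real.add_one_le_exp (φ t - φ s)]
      _ = Real.exp (φ t) * (psi φ s - psi φ t) := by
          rw [psi, psi, mul_sub, ← Real.exp_add, ← Real.exp_add]; simp [sub_eq_add_neg]
      _ ≤ _ := by gcongr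
  have hσε : 0 < σ * ε := by positivity
  -- At its right node the mesh recovers `φ t` from the node itself. Since the cell is at most `K₁ *
  -- ε` wide, moving from this node to `y` costs only a constant.
  have h2 : φ t ≤ β * y / (σ * ε) + β * K₁ / σ := by
    have h3 : φ t = β * x1 / (σ * ε) := by rw [e1]; field_simp
    have h4 : x1 ≤ y + K₁ * ε := by linarith
    rw [h3]
    calc β * x1 / (σ * ε) ≤ β * (y + K₁ * ε) / (σ * ε) := by gcongr
      _ = _ := by field_simp
  have h5 : Real.exp (φ t) ≤ Real.exp (β * y / (σ * ε)) * Real.exp (β * K₁ / σ) := by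
    rw [← Real.exp_add]; exact Real.exp_le_exp.2 h2
  calc x1 - x0 = σ * ε / β * (φ t - φ s) := by rw [e0, e1]; ring
    _ ≤ σ * ε / β * (Real.exp (β * y / (σ * ε)) * Real.exp (β * K₁ / σ) *
        (maxAbsDerivPsi φ * (2 * ((4 * n : ℕ) : ℝ)⁻¹))) := by
        refine mul_le_mul_of_nonneg_left (h1.trans ?_) (by positivity)
        exact mul_le_mul_of_nonneg_right h5 (by positivity)
    _ = _ := by ring

end Mesh

/-! ### Exponential layers on a range of cells -/

/-- Integration over the half-line from `c`. With `α` proportional to `1/ε`, the factor `1 / √α` is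
the source of every `√ε` won from a layer. -/
lemma L2norm_exp_le {A α : ℝ} (hA : 0 ≤ A) (hα : 0 < α) (s c d : ℝ) :
    L2norm (fun y => A * Real.exp (-α * (y - s))) (Ico c d) ≤
      ENNReal.ofReal (A * Real.exp (-α * (c - s)) / √α) := by
  have hsq : L2norm (fun y => A * Real.exp (-α * (y - s))) (Ico c d) ^ 2 ≤
      ENNReal.ofReal (A * Real.exp (-α * (c - s)) / √α) ^ 2 := by
    rw [← ENNReal.ofReal_pow (by positivity), L2norm_sq]
    have h1 : ∀ y : ℝ, ‖A * Real.exp (-α * (y - s))‖ₑ ^ 2 =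
        ENNReal.ofReal (A ^ 2 * Real.exp (2 * α * s) * Real.exp (-(2 * α) * y)) := by
      intro y
      rw [Real.enorm_eq_ofReal (by positivity), ← ENNReal.ofReal_pow (by positivity), mul_pow,
        ← Real.exp_nat_mul, mul_assoc, ← Real.exp_add]
      congr 3; push_cast; ring
    simp_rw [h1]
    have hneg : -(2 * α) < 0 := by linarith
    calc ∫⁻ y in Ico c d, ENNReal.ofReal (A ^ 2 * Real.exp (2 * α * s) * Real.exp (-(2 * α) * y))
        ≤ ∫⁻ y in Ici c, ENNReal.ofReal (A ^ 2 * Real.exp (2 * α * s) * Real.exp (-(2 * α) * y)) :=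
          lintegral_mono_set Ico_subset_Ici_self
      _ = ∫⁻ y in Ioi c, ENNReal.ofReal (A ^ 2 * Real.exp (2 * α * s) * Real.exp (-(2 * α) * y)) :=
          (setLIntegral_congr Ioi_ae_eq_Ici).symm
      _ = ENNReal.ofReal (∫ y in Ioi c, A ^ 2 * Real.exp (2 * α * s) * Real.exp (-(2 * α) * y)) :=
          (ofReal_integral_eq_lintegral_ofReal ((integrableOn_exp_mul_Ioi hneg c).const_mul _)
            (Eventually.of_forall fun y => by positivity)).symm
      _ ≤ _ := by
          refine ENNReal.ofReal_le_ofReal ?_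
          rw [integral_const_mul, integral_exp_mul_Ioi hneg, div_pow, Real.sq_sqrt hα.le, mul_pow,
            ← Real.exp_nat_mul]
          have e : Real.exp ((2 : ℕ) * (-α * (c - s))) =
              Real.exp (2 * α * s) * Real.exp (-(2 * α) * c) := by
            rw [← Real.exp_add]; congr 1; push_cast; ring
          rw [e]
          have h2 : 0 ≤ A ^ 2 * (Real.exp (2 * α * s) * Real.exp (-(2 * α) * c)) / α := by
            positivity
          calc _ = A ^ 2 * (Real.exp (2 * α * s) * Real.exp (-(2 * α) * c)) / α / 2 := by
                field_simp
            _ ≤ _ := by linarith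
  exact (ENNReal.pow_le_pow_left_iff (by norm_num)).1 hsq

section Layer
variable {k N : ℕ} {ξ : Fin (k + 1) → ℝ} {x : ℕ → ℝ} {a b Λ : ℝ} {v : ℝ → ℝ} {D : ℕ → ℝ → ℝ}

lemma IsLebesgueBound.L2norm_layer_le (hΛ : IsLebesgueBound ξ Λ) (hξ : StrictMono ξ)
    (hξ0 : ξ 0 = 0) (hξ1 : ξ (Fin.last k) = 1) (hx : ∀ i < N, x i ≤ x (i + 1)) {p q : ℕ}
    (hpq : p ≤ q) (hq : q ≤ N) (ha : a ≤ x p) (hb : x q ≤ b) {m : ℕ} (hm : m ≤ k)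
    (hv : HasChain a b (m + 1) v D) {H A α s : ℝ} (hH0 : 0 ≤ H) (hA : 0 ≤ A) (hα : 0 < α)
    (hH : ∀ i, p ≤ i → i < q → x (i + 1) - x i ≤ H)
    (hD : ∀ y ∈ Ioo (x p) (x q), |D (m + 1) y| ≤ A * Real.exp (-α * (y - s))) :
    L2norm (fun y => v y - interp ξ N x v y) (Ico (x p) (x q)) ≤
        ENNReal.ofReal ((1 + Λ) * (H ^ (m + 1) * A * Real.exp (-α * (x p - s)) / √α)) ∧
      L2norm (fun y => D 1 y - interpDeriv ξ N x v y) (Ico (x p) (x q)) ≤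
        ENNReal.ofReal ((1 + Λ) * (H ^ m * A * Real.exp (-α * (x p - s)) / √α)) := by
  have hΛ0 := hΛ.1
  have hG : ∀ r i, p ≤ i → i < q → ∀ y ∈ Ioo (x i) (x (i + 1)),
      (x (i + 1) - x i) ^ r * |D (m + 1) y| ≤ |H ^ r * A * Real.exp (-α * (y - s))| := by
    intro r i hpi hiq y hy
    have h0 : 0 ≤ x (i + 1) - x i := sub_nonneg.2 (hx i (by omega))
    rw [abs_of_nonneg (by positivity : 0 ≤ H ^ r * A * Real.exp (-α * (y - s))), mul_assoc]
    gcongr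
    · exact hH i hpi hiq
    · exact hD y ⟨(mesh_mono hx hpi (by omega)).trans_lt hy.1,
        hy.2.trans_le (mesh_mono hx (by omega) hq)⟩
  constructor
  · rw [ENNReal.ofReal_mul (by positivity)]
    refine (hΛ.L2norm_region_le hξ hξ0 hξ1 hx hpq hq ha hb hm hv (hG (m + 1))).trans ?_
    gcongr
    exact L2norm_exp_le (by positivity) hα _ _ _
  · rw [ENNReal.ofReal_mul (by positivity)]
    refine (hΛ.L2norm_region_deriv_le hξ hξ0 hξ1 hx hpq hq ha hb hm hv (hG m)).trans ?_
    gcongr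
    exact L2norm_exp_le (by positivity) hα _ _ _

end Layer

/-! ### Consequences of the standing assumptions -/

/-- The parameters of the mesh, with `N = 4 n`, satisfy the standing assumptions. -/
structure IsAdmissible (k n : ℕ) (β σ ε K₁ : ℝ) (φ : ℝ → ℝ) : Prop where
  one_le_k : 1 ≤ k
  n_pos : 0 < n
  β_pos : 0 < β
  le_σ : (k : ℝ) + 1 ≤ σ
  ε_pos : 0 < ε
  ε_le_one : ε ≤ 1
  meshFunction : IsMeshFunction (4 * n) φ
  lam_le : lam β σ ε (4 * n) ≤ 1 / 2
  mu_le : mu k β ε ≤ 1 / 2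
  h₁_le : h₁ k β σ ε (4 * n) φ ≤ K₁ * ε
  exp_le : Real.exp (-ε ^ (-1 / (k : ℝ))) ≤ ((4 * n : ℕ) : ℝ) ^ (1 - (k : ℝ))

namespace IsAdmissible
variable {k n : ℕ} {β σ ε K₁ : ℝ} {φ : ℝ → ℝ} (h : IsAdmissible k n β σ ε K₁ φ)
include h

lemma σ_pos : 0 < σ := by
  have := h.le_σ
  have : (0 : ℝ) ≤ k := by positivity
  linarith

lemma N_pos : (0 : ℝ) < (4 * n : ℕ) := by
  have := h.n_pos
  exact_mod_cast (by omega : 0 < 4 * n)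

lemma one_le_N : (1 : ℝ) ≤ (4 * n : ℕ) := by
  have := h.n_pos
  exact_mod_cast (by omega : 1 ≤ 4 * n)

lemma inv_n : 1 / (n : ℝ) = 4 * ((4 * n : ℕ) : ℝ)⁻¹ := by
  have : (n : ℝ) ≠ 0 := by exact_mod_cast h.n_pos.ne'
  push_cast; field_simp

lemma lam_nonneg : 0 ≤ lam β σ ε (4 * n) := by
  have := h.σ_pos; have := h.β_pos; have := h.ε_pos
  have := Real.log_nonneg h.one_le_N
  unfold lam; positivity

lemma mu_nonneg : 0 ≤ mu k β ε := by
  have := h.β_pos; have := h.ε_pos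
  unfold mu; split_ifs <;> positivity

lemma K₁_nonneg : 0 ≤ K₁ := by
  have h1 := (h₁_nonneg (k := k) h.n_pos h.β_pos h.σ_pos h.ε_pos h.meshFunction).trans h.h₁_le
  exact nonneg_of_mul_nonneg_left h1 h.ε_pos

lemma node_le_succ : ∀ i < 4 * n, node k β σ ε (4 * n) φ i ≤ node k β σ ε (4 * n) φ (i + 1) :=
  node_mono h.n_pos h.β_pos h.σ_pos h.ε_pos h.meshFunction h.lam_le h.mu_nonneg h.mu_le

lemma one_le_M : 1 ≤ maxAbsDerivPsi φ := one_le_maxAbsDerivPsi h.n_pos h.meshFunction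

lemma inv_N_pow_le : ((4 * n : ℕ) : ℝ)⁻¹ ≤ ((4 * n : ℕ) : ℝ)⁻¹ * maxAbsDerivPsi φ :=
  le_mul_of_one_le_right (inv_nonneg.2 h.N_pos.le) h.one_le_M

/-- The choice of `λ` makes the left side equal to `N^(-σ)`, and `σ ≥ k + 1`. -/
lemma exp_lam_le : Real.exp (-(β / ε) * lam β σ ε (4 * n)) ≤ ((4 * n : ℕ) : ℝ)⁻¹ ^ (k + 1) := by
  have h1 := h.β_pos; have h2 := h.ε_pos
  have e : -(β / ε) * lam β σ ε (4 * n) = Real.log (4 * n : ℕ) * (-σ) := by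
    unfold lam; field_simp
  rw [e, ← Real.rpow_def_of_pos h.N_pos, inv_pow, ← Real.rpow_natCast,
    ← Real.rpow_neg h.N_pos.le]
  refine Real.rpow_le_rpow_of_exponent_le h.one_le_N ?_
  push_cast; linarith [h.le_σ]

/-- Half of the exponent suffices for the power of `N`, because `λ ≤ 1/2`; the other half beats any
power of `ε`, in particular `√ε`. -/
lemma exp_le_sqrt : Real.exp (-(β / ε)) ≤ 2 / β * √ε * ((4 * n : ℕ) : ℝ)⁻¹ ^ (k + 1) := by
  have h1 := h.β_pos; have h2 := h.ε_pos
  have e : Real.exp (-(β / ε)) = Real.exp (-(β / (2 * ε))) * Real.exp (-(β / ε) * (1 / 2)) := by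
    rw [← Real.exp_add]; congr 1; field_simp; ring
  rw [e]
  have b1 : Real.exp (-(β / ε) * (1 / 2)) ≤ ((4 * n : ℕ) : ℝ)⁻¹ ^ (k + 1) := by
    refine le_trans (Real.exp_le_exp.2 ?_) h.exp_lam_le
    have := h.lam_le
    have : 0 < β / ε := by positivity
    nlinarith
  have b2 : Real.exp (-(β / (2 * ε))) ≤ 2 / β * √ε := by
    have hz : 0 < β / (2 * ε) := by positivity
    have b3 : Real.exp (-(β / (2 * ε))) ≤ (β / (2 * ε))⁻¹ := by
      rw [Real.exp_neg]
      exact inv_anti₀ hz (by linarith [Real.add_one_le_exp (β / (2 * ε))])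
    refine b3.trans ?_
    have b4 : ε ≤ √ε := by
      rw [Real.le_sqrt' h2]
      nlinarith [h.ε_le_one]
    calc (β / (2 * ε))⁻¹ = 2 / β * ε := by field_simp
      _ ≤ _ := by gcongr
  gcongr

/-- For `k ≥ 2` this is the definition of `μ`; the summand `1` in the constant covers `μ = 1/2` for
`k = 1`. -/
lemma mu_pow_le : mu k β ε ^ k ≤ (1 + 1 / β) ^ k * ε ^ (k - 1) := by
  have h1 := h.β_pos; have h2 := h.ε_pos; have hk := h.one_le_k
  have hk0 : (k : ℝ) ≠ 0 := by positivity
  have h3 : mu k β ε ≤ (1 + 1 / β) * ε ^ (((k : ℝ) - 1) / k) := by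
    unfold mu
    split_ifs with hk1
    · subst hk1
      have : 0 < 1 / β := by positivity
      norm_num
      have : 0 < β⁻¹ := by positivity
      linarith
    · rw [div_eq_mul_one_div, mul_comm]
      gcongr
      linarith
  refine (pow_le_pow_left₀ h.mu_nonneg h3 k).trans (le_of_eq ?_)
  rw [mul_pow, ← Real.rpow_natCast (ε ^ _), ← Real.rpow_mul h2.le, div_mul_cancel₀ _ hk0,
    ← Real.rpow_natCast ε, Nat.cast_sub hk, Nat.cast_one]

/-- For `k ≥ 2` the exponent equals `-ε^(-1/k)`, and the assumption relating `ε` and `N` is exactly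
what is needed. For `k = 1` the right side is `1`. -/
lemma exp_mu_le : Real.exp (-(β / ε) * mu k β ε) ≤ ((4 * n : ℕ) : ℝ)⁻¹ ^ (k - 1) := by
  have h1 := h.β_pos; have h2 := h.ε_pos; have hk := h.one_le_k
  have hmu := h.mu_nonneg
  by_cases hk1 : k = 1
  · subst hk1
    rw [Nat.sub_self, pow_zero, Real.exp_le_one_iff]
    have : 0 < β / ε := by positivity
    nlinarith
  · have hk0 : (k : ℝ) ≠ 0 := by positivity
    have e : -(β / ε) * mu k β ε = -ε ^ (-1 / (k : ℝ)) := by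
      have e1 : ε ^ (-1 / (k : ℝ)) * ε = ε ^ (((k : ℝ) - 1) / k) := by
        nth_rewrite 2 [← Real.rpow_one ε]
        rw [← Real.rpow_add h2]; congr 1; field_simp; ring
      unfold mu
      rw [if_neg hk1, ← e1]; field_simp
    rw [e, inv_pow, ← Real.rpow_natCast, ← Real.rpow_neg h.N_pos.le, Nat.cast_sub hk, neg_sub,
      Nat.cast_one]
    exact h.exp_le

end IsAdmissible

/-- Split `w^m` into `w^(m-p)`, bounded through `K₁`, and `w^p`, bounded through `Y`. Real exponents
`p` make the order `k + 1/2` accessible and avoid any assumption `Y ≤ 1`. -/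
lemma pow_le_of_layer {w K₁ c Y θ p : ℝ} {m : ℕ} (hw : 0 ≤ w) (hwK : w ≤ K₁) (hc : 0 ≤ c)
    (hY : 0 ≤ Y) (hwY : w ≤ c * Y * Real.exp θ) (hp : 0 ≤ p) (hpm : p ≤ m) :
    w ^ m ≤ (1 + K₁) ^ m * (1 + c) ^ m * Y ^ p * Real.exp (p * θ) := by
  have hK : 0 ≤ K₁ := hw.trans hwK
  have e : w ^ m = w ^ ((m : ℝ) - p) * w ^ p := by
    rw [← Real.rpow_add_of_nonneg hw (by linarith) hp, sub_add_cancel, Real.rpow_natCast]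
  have h1 : w ^ ((m : ℝ) - p) ≤ (1 + K₁) ^ m := by
    calc w ^ ((m : ℝ) - p) ≤ (1 + K₁) ^ ((m : ℝ) - p) :=
          Real.rpow_le_rpow hw (by linarith) (by linarith)
      _ ≤ (1 + K₁) ^ (m : ℝ) := Real.rpow_le_rpow_of_exponent_le (by linarith) (by linarith)
      _ = _ := Real.rpow_natCast _ _
  have h2 : w ^ p ≤ (1 + c) ^ m * Y ^ p * Real.exp (p * θ) := by
    calc w ^ p ≤ (c * Y * Real.exp θ) ^ p := Real.rpow_le_rpow hw hwY hp
      _ = c ^ p * Y ^ p * Real.exp (p * θ) := by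
          rw [Real.mul_rpow (by positivity) (by positivity), Real.mul_rpow hc hY, ← Real.exp_mul,
            mul_comm θ]
      _ ≤ (1 + c) ^ (m : ℝ) * Y ^ p * Real.exp (p * θ) := by
          gcongr
          exact (Real.rpow_le_rpow hc (by linarith) hp).trans
            (Real.rpow_le_rpow_of_exponent_le (by linarith) hpm)
      _ = _ := by rw [Real.rpow_natCast]
  rw [e]
  calc _ ≤ (1 + K₁) ^ m * ((1 + c) ^ m * Y ^ p * Real.exp (p * θ)) := by gcongr
    _ = _ := by ring

/-! ### The parts of the solution -/

/-- `E` is smooth and its derivatives of order at most `m` decay like a layer at `0`. -/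
structure IsStrongLayer (m : ℕ) (β ε K : ℝ) (E : ℝ → ℝ) : Prop where
  contDiffOn : ContDiffOn ℝ m E (Ioo 0 2)
  bound : ∀ ℓ ≤ m, ∀ y ∈ Ioo (0 : ℝ) 2,
    |iteratedDeriv ℓ E y| ≤ K * (ε ^ ℓ)⁻¹ * Real.exp (-(β / ε) * (y - 0))

/-- `W` vanishes on `(0, 1)` and its derivatives of order at most `m` decay like a weak layer at
`1`. -/
structure IsWeakLayer (m : ℕ) (β ε K : ℝ) (W : ℝ → ℝ) : Prop where
  eq_zero : ∀ y ∈ Ioo (0 : ℝ) 1, W y = 0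
  contDiffOn : ContDiffOn ℝ m W (Ioo 1 2)
  bound : ∀ ℓ ≤ m, ∀ y ∈ Ioo (1 : ℝ) 2,
    |iteratedDeriv ℓ W y| ≤ K * (ε * (ε ^ ℓ)⁻¹) * Real.exp (-(β / ε) * (y - 1))

section Decomposition
variable {m : ℕ} {β ε K : ℝ} {u S E W : ℝ → ℝ}

/-- Natural powers of `ε` and the shift `y - 0` bring the bound into the form required by
`L2norm_layer_le`, as for the weak layer with shift `1`. -/
lemma IsDecomposition.isStrongLayer (h : IsDecomposition m β ε K u S E W) (hε : 0 < ε) :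
    IsStrongLayer m β ε K E := by
  refine ⟨h.contDiffOn_E, fun ℓ hℓ y hy => (h.bound_E ℓ hℓ y hy).trans (le_of_eq ?_)⟩
  rw [Real.rpow_neg hε.le, Real.rpow_natCast]
  congr 2; ring

lemma IsDecomposition.isWeakLayer (h : IsDecomposition m β ε K u S E W) (hε : 0 < ε) :
    IsWeakLayer m β ε K W := by
  refine ⟨h.W_eq_zero, h.contDiffOn_W, fun ℓ hℓ y hy => (h.bound_W ℓ hℓ y hy).trans (le_of_eq ?_)⟩
  rw [Real.rpow_sub hε, Real.rpow_one, Real.rpow_natCast, div_eq_mul_inv]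
  congr 2; ring

lemma IsStrongLayer.K_nonneg (h : IsStrongLayer m β ε K E) : 0 ≤ K := by
  have h1 := (abs_nonneg _).trans (h.bound 0 (Nat.zero_le _) 1 ⟨one_pos, one_lt_two⟩)
  rw [pow_zero, inv_one, mul_one] at h1
  exact nonneg_of_mul_nonneg_left h1 (Real.exp_pos _)

lemma IsStrongLayer.hasChain (h : IsStrongLayer (m + 1) β ε K E) (hβ : 0 < β) (hε : 0 < ε) :
    HasChain 0 2 (m + 1) E (fun ℓ => iteratedDeriv ℓ E) := by
  have hK := h.K_nonneg
  refine hasChain_of_contDiffOn zero_lt_two h.contDiffOn fun ℓ hℓ =>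
    ⟨K * (ε ^ ℓ)⁻¹, fun y hy => (h.bound ℓ hℓ y hy).trans ?_⟩
  refine mul_le_of_le_one_right (by positivity) (Real.exp_le_one_iff.2 ?_)
  rw [neg_mul, neg_nonpos]
  exact mul_nonneg (by positivity) (by linarith [hy.1])

lemma IsWeakLayer.K_nonneg (h : IsWeakLayer m β ε K W) (hε : 0 < ε) : 0 ≤ K := by
  have h1 := (abs_nonneg _).trans (h.bound 0 (Nat.zero_le _) (3 / 2) ⟨by norm_num, by norm_num⟩)
  rw [pow_zero, inv_one, mul_one] at h1
  exact nonneg_of_mul_nonneg_left (nonneg_of_mul_nonneg_left h1 (Real.exp_pos _)) hε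

lemma IsWeakLayer.hasChain_right (h : IsWeakLayer (m + 1) β ε K W) (hβ : 0 < β) (hε : 0 < ε) :
    HasChain 1 2 (m + 1) W (fun ℓ => iteratedDeriv ℓ W) := by
  have hK := h.K_nonneg hε
  refine hasChain_of_contDiffOn one_lt_two h.contDiffOn fun ℓ hℓ =>
    ⟨K * (ε * (ε ^ ℓ)⁻¹), fun y hy => (h.bound ℓ hℓ y hy).trans ?_⟩
  refine mul_le_of_le_one_right (by positivity) (Real.exp_le_one_iff.2 ?_)
  rw [neg_mul, neg_nonpos]
  exact mul_nonneg (by positivity) (by linarith [hy.1])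

lemma IsWeakLayer.hasChain_left (h : IsWeakLayer (m + 1) β ε K W) :
    HasChain 0 1 (m + 1) W (fun ℓ => iteratedDeriv ℓ W) := by
  refine hasChain_of_contDiffOn zero_lt_one (contDiffOn_const.congr h.eq_zero) fun ℓ _ =>
    ⟨0, fun y hy => ?_⟩
  rw [iteratedDeriv_eq_zero_of_eq_zero isOpen_Ioo h.eq_zero ℓ hy, abs_zero]

end Decomposition

/-! ### Interpolation errors of the parts -/

/-- The constant in the bound of the mesh widths in the strong layer. -/
def layerConst (β σ K₁ : ℝ) : ℝ := 2 * σ / β * Real.exp (β * K₁ / σ)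

namespace IsAdmissible
variable {k n : ℕ} {ξ : Fin (k + 1) → ℝ} {β σ ε K K₁ Λ : ℝ} {φ : ℝ → ℝ} {S E W : ℝ → ℝ}

/-- The width contributes the growth `exp (p θ)`, the layer the decay `exp (-σ θ)`. Since `σ - p ≥
1/2`, the decay `exp (-θ/2)` remains for integration; for `p = k + 1` and `σ = k + 1` none would be
left. -/
lemma pow_width_mul_le (h : IsAdmissible k n β σ ε K₁ φ) (hE : IsStrongLayer (k + 1) β ε K E)
    {r : ℕ} (hr : r ≤ k + 1) {p : ℝ} (hp : 0 ≤ p) (hpr : p ≤ r) (hpk : p ≤ k + 1 / 2) {i : ℕ}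
    (hi : i < n) {y : ℝ}
    (hy : y ∈ Ioo (node k β σ ε (4 * n) φ i) (node k β σ ε (4 * n) φ (i + 1))) :
    (node k β σ ε (4 * n) φ (i + 1) - node k β σ ε (4 * n) φ i) ^ r *
        |iteratedDeriv (k + 1) E y| ≤
      K * (ε ^ (k + 1 - r))⁻¹ * ((1 + K₁) * (1 + layerConst β σ K₁)) ^ r *
        (((4 * n : ℕ) : ℝ)⁻¹ * maxAbsDerivPsi φ) ^ p *
        Real.exp (-(β / (2 * σ * ε)) * (y - 0)) := by
  have hβ := h.β_pos
  have hε := h.ε_pos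
  have hσ := h.σ_pos
  have hK := hE.K_nonneg
  have hn := h.n_pos
  have hx := h.node_le_succ
  have hw0 := width_strongLayer_nonneg (k := k) hβ hσ hε h.meshFunction hi
  have hwK := (width_le_h₁ (k := k) (β := β) (σ := σ) (ε := ε) (φ := φ) hi).trans h.h₁_le
  have hwY := width_strongLayer_le (k := k) hn hβ hσ hε h.meshFunction h.h₁_le hi hy.1.le
  have hy0 : 0 ≤ node k β σ ε (4 * n) φ i := by
    have := mesh_mono hx (Nat.zero_le i) (by omega)
    rwa [node_zero h.meshFunction] at this
  have hy2 : node k β σ ε (4 * n) φ (i + 1) ≤ 2 := by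
    have := mesh_mono hx (i := i + 1) (j := 4 * n) (by omega) le_rfl
    rwa [node_last hn h.meshFunction] at this
  have hb := hE.bound (k + 1) le_rfl y ⟨hy0.trans_lt hy.1, hy.2.trans_le hy2⟩
  have hy00 : 0 ≤ y := hy0.trans hy.1.le
  set w := node k β σ ε (4 * n) φ (i + 1) - node k β σ ε (4 * n) φ i
  set Y := ((4 * n : ℕ) : ℝ)⁻¹ * maxAbsDerivPsi φ with hYdef
  have hY : 0 ≤ Y := mul_nonneg (inv_nonneg.2 h.N_pos.le) (zero_le_one.trans h.one_le_M)
  have hc : 0 ≤ layerConst β σ K₁ := by unfold layerConst; positivity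
  set θ := β * y / (σ * ε) with hθ
  have hθ0 : 0 ≤ θ := by positivity
  have h1 := pow_le_of_layer (w := w / ε) (K₁ := K₁) (c := layerConst β σ K₁) (Y := Y) (θ := θ)
    (p := p) (m := r) (by positivity) ((div_le_iff₀ hε).2 hwK) hc hY
    (by
      rw [div_le_iff₀ hε]
      refine hwY.trans (le_of_eq ?_)
      rw [layerConst]; ring) hp hpr
  have h2 : Real.exp (p * θ) * Real.exp (-(β / ε) * (y - 0)) ≤
      Real.exp (-(β / (2 * σ * ε)) * (y - 0)) := by
    rw [← Real.exp_add]
    refine Real.exp_le_exp.2 ?_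
    have e1 : -(β / ε) * (y - 0) = -(σ * θ) := by rw [hθ]; field_simp; ring
    have e2 : -(β / (2 * σ * ε)) * (y - 0) = -(θ / 2) := by rw [hθ]; field_simp; ring
    rw [e1, e2]
    nlinarith [h.le_σ]
  have hε' : ε ^ (k + 1) = ε ^ r * ε ^ (k + 1 - r) := by rw [← pow_add]; congr 1; omega
  have hK1 := h.K₁_nonneg
  calc w ^ r * |iteratedDeriv (k + 1) E y|
      ≤ w ^ r * (K * (ε ^ (k + 1))⁻¹ * Real.exp (-(β / ε) * (y - 0))) := by gcongr
    _ = K * (ε ^ (k + 1 - r))⁻¹ * (w / ε) ^ r * Real.exp (-(β / ε) * (y - 0)) := by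
        rw [hε', mul_inv, div_pow]; field_simp
    _ ≤ K * (ε ^ (k + 1 - r))⁻¹ * ((1 + K₁) ^ r * (1 + layerConst β σ K₁) ^ r * Y ^ p *
          Real.exp (p * θ)) * Real.exp (-(β / ε) * (y - 0)) := by gcongr
    _ = K * (ε ^ (k + 1 - r))⁻¹ * ((1 + K₁) * (1 + layerConst β σ K₁)) ^ r * Y ^ p *
          (Real.exp (p * θ) * Real.exp (-(β / ε) * (y - 0))) := by rw [mul_pow]; ring
    _ ≤ _ := by gcongr

variable (h : IsAdmissible k n β σ ε K₁ φ) (hΛ : IsLebesgueBound ξ Λ) (hξ : StrictMono ξ)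
  (hξ0 : ξ 0 = 0) (hξ1 : ξ (Fin.last k) = 1)
include h hΛ hξ hξ0 hξ1

lemma L2norm_strongLayer_le (hE : IsStrongLayer (k + 1) β ε K E) {p : ℝ} (hp : 0 ≤ p)
    (hpk : p ≤ k + 1 / 2) :
    L2norm (fun y => E y - interp ξ (4 * n) (node k β σ ε (4 * n) φ) E y)
        (Ico 0 (lam β σ ε (4 * n))) ≤
      ENNReal.ofReal ((1 + Λ) * (K * ((1 + K₁) * (1 + layerConst β σ K₁)) ^ (k + 1) *
        √(2 * σ / β)) * (√ε * (((4 * n : ℕ) : ℝ)⁻¹ * maxAbsDerivPsi φ) ^ p)) := by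
  have hβ := h.β_pos
  have hε := h.ε_pos
  have hσ := h.σ_pos
  have hK := hE.K_nonneg
  have hK1 := h.K₁_nonneg
  have hΛ0 := hΛ.1
  have hc : 0 ≤ layerConst β σ K₁ := by unfold layerConst; positivity
  have hY : 0 ≤ ((4 * n : ℕ) : ℝ)⁻¹ * maxAbsDerivPsi φ :=
    mul_nonneg (inv_nonneg.2 h.N_pos.le) (zero_le_one.trans h.one_le_M)
  have h0 := node_zero (k := k) (β := β) (σ := σ) (ε := ε) h.meshFunction
  have h1 := node_last_strongLayer (k := k) (β := β) (σ := σ) (ε := ε) h.n_pos h.meshFunction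
  rw [← h1]
  nth_rewrite 1 [← h0]
  have hlam := h.lam_le
  refine (hΛ.L2norm_region_le (a := 0) (b := 2) (p := 0) (q := n) hξ hξ0 hξ1 h.node_le_succ
    (Nat.zero_le _) (by omega) h0.ge (by rw [h1]; linarith) le_rfl (hE.hasChain hβ hε)
    (G := fun y => K * (ε ^ (k + 1 - (k + 1)))⁻¹ * ((1 + K₁) * (1 + layerConst β σ K₁)) ^ (k + 1) *
        (((4 * n : ℕ) : ℝ)⁻¹ * maxAbsDerivPsi φ) ^ p * Real.exp (-(β / (2 * σ * ε)) * (y - 0)))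
    (fun i _ hi y hy => ?_)).trans ?_
  · refine (h.pow_width_mul_le hE le_rfl hp ?_ hpk hi hy).trans (le_abs_self _)
    push_cast; linarith
  · rw [mul_assoc (1 + Λ), ENNReal.ofReal_mul (by positivity)]
    gcongr
    refine (L2norm_exp_le (by positivity) (by positivity) 0 _ _).trans
      (ENNReal.ofReal_le_ofReal (le_of_eq ?_))
    have e : √(β / (2 * σ * ε)) = (√(2 * σ / β) * √ε)⁻¹ := by
      rw [← Real.sqrt_mul (by positivity), ← Real.sqrt_inv]; congr 1; field_simp
    rw [e, h0, div_inv_eq_mul]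
    simp
    ring

lemma L2norm_strongLayer_deriv_le (hE : IsStrongLayer (k + 1) β ε K E) :
    L2norm (fun y => iteratedDeriv 1 E y - interpDeriv ξ (4 * n) (node k β σ ε (4 * n) φ) E y)
        (Ico 0 (lam β σ ε (4 * n))) ≤
      ENNReal.ofReal ((1 + Λ) * (K * ((1 + K₁) * (1 + layerConst β σ K₁)) ^ k *
        √(2 * σ / β)) * (√ε * ε⁻¹ * (((4 * n : ℕ) : ℝ)⁻¹ * maxAbsDerivPsi φ) ^ k)) := by
  have hβ := h.β_pos
  have hε := h.ε_pos
  have hσ := h.σ_pos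
  have hK := hE.K_nonneg
  have hK1 := h.K₁_nonneg
  have hΛ0 := hΛ.1
  have hc : 0 ≤ layerConst β σ K₁ := by unfold layerConst; positivity
  have hY : 0 ≤ ((4 * n : ℕ) : ℝ)⁻¹ * maxAbsDerivPsi φ :=
    mul_nonneg (inv_nonneg.2 h.N_pos.le) (zero_le_one.trans h.one_le_M)
  have h0 := node_zero (k := k) (β := β) (σ := σ) (ε := ε) h.meshFunction
  have h1 := node_last_strongLayer (k := k) (β := β) (σ := σ) (ε := ε) h.n_pos h.meshFunction
  rw [← h1]
  nth_rewrite 1 [← h0]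
  have hlam := h.lam_le
  refine (hΛ.L2norm_region_deriv_le (D := fun ℓ => iteratedDeriv ℓ E) (a := 0) (b := 2) (p := 0)
    (q := n) hξ hξ0 hξ1 h.node_le_succ
    (Nat.zero_le _) (by omega) h0.ge (by rw [h1]; linarith) le_rfl (hE.hasChain hβ hε)
    (G := fun y => K * (ε ^ (k + 1 - k))⁻¹ * ((1 + K₁) * (1 + layerConst β σ K₁)) ^ k *
        (((4 * n : ℕ) : ℝ)⁻¹ * maxAbsDerivPsi φ) ^ (k : ℝ) *
        Real.exp (-(β / (2 * σ * ε)) * (y - 0)))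
    (fun i _ hi y hy => ?_)).trans ?_
  · exact (h.pow_width_mul_le hE (by omega) (by positivity) le_rfl (by linarith) hi hy).trans
      (le_abs_self _)
  · rw [mul_assoc (1 + Λ), ENNReal.ofReal_mul (by positivity)]
    gcongr
    refine (L2norm_exp_le (by positivity) (by positivity) 0 _ _).trans
      (ENNReal.ofReal_le_ofReal (le_of_eq ?_))
    have e : √(β / (2 * σ * ε)) = (√(2 * σ / β) * √ε)⁻¹ := by
      rw [← Real.sqrt_mul (by positivity), ← Real.sqrt_inv]; congr 1; field_simp
    rw [e, h0, Real.rpow_natCast, div_inv_eq_mul]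
    simp
    ring

/-- Right of a node the strong layer is interpolated with an error of the size of the layer. -/
lemma L2norm_strongLayer_tail_le (hE : IsStrongLayer (k + 1) β ε K E) {p q : ℕ} (hpq : p ≤ q)
    (hq : q ≤ 4 * n)
    (hl : node k β σ ε (4 * n) φ q - node k β σ ε (4 * n) φ p ≤ 1) :
    L2norm (fun y => E y - interp ξ (4 * n) (node k β σ ε (4 * n) φ) E y)
        (Ico (node k β σ ε (4 * n) φ p) (node k β σ ε (4 * n) φ q)) ≤
      ENNReal.ofReal ((1 + Λ) * (K * Real.exp (-(β / ε) * node k β σ ε (4 * n) φ p))) ∧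
    L2norm (fun y => iteratedDeriv 1 E y - interpDeriv ξ (4 * n) (node k β σ ε (4 * n) φ) E y)
        (Ico (node k β σ ε (4 * n) φ p) (node k β σ ε (4 * n) φ q)) ≤
      ENNReal.ofReal ((1 + Λ) * (K / √β * (√ε * ε⁻¹ *
        Real.exp (-(β / ε) * node k β σ ε (4 * n) φ p)))) := by
  have hβ := h.β_pos
  have hε := h.ε_pos
  have hK := hE.K_nonneg
  have hΛ0 := hΛ.1
  have hx := h.node_le_succ
  have h0 := node_zero (k := k) (β := β) (σ := σ) (ε := ε) h.meshFunction
  have hN := node_last (k := k) (β := β) (σ := σ) (ε := ε) h.n_pos h.meshFunction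
  have hp0 := mesh_mono hx (Nat.zero_le p) (by omega)
  have hqN := mesh_mono hx hq le_rfl
  rw [h0] at hp0
  rw [hN] at hqN
  constructor
  · refine (hΛ.L2norm_region_le_of_bound hξ hξ0 hξ1 hx hpq hq hp0 hqN (hE.hasChain hβ hε)
      (R := K * Real.exp (-(β / ε) * node k β σ ε (4 * n) φ p)) fun y hy => ?_).trans ?_
    · have := hE.bound 0 (Nat.zero_le _) y ⟨hp0.trans_lt hy.1, hy.2.trans_le hqN⟩
      rw [iteratedDeriv_zero, pow_zero, inv_one, mul_one] at this
      refine this.trans ?_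
      gcongr K * Real.exp ?_
      have : 0 < β / ε := by positivity
      have := hy.1
      nlinarith
    · refine ENNReal.ofReal_le_ofReal (mul_le_of_le_one_right (by positivity) ?_)
      exact Real.sqrt_le_one.2 hl
  -- Order `m = 0` uses no power of the width: the first derivative is only interpolated stably, and
  -- all smallness comes from the exponential at the left end.
  · refine (hΛ.L2norm_layer_le (D := fun ℓ => iteratedDeriv ℓ E) (a := 0) (b := 2) (m := 0)
      hξ hξ0 hξ1 hx hpq hq hp0 hqN (Nat.zero_le _)
      ((hE.hasChain hβ hε).mono le_rfl le_rfl (by omega)) (H := 1) (A := K * (ε ^ 1)⁻¹)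
      (α := β / ε) (s := 0) zero_le_one (by positivity) (by positivity) (fun i hpi hiq => ?_)
      (fun y hy => ?_)).2.trans (ENNReal.ofReal_le_ofReal (le_of_eq ?_))
    · have h1 := mesh_mono hx hpi (by omega : i ≤ 4 * n)
      have h2 := mesh_mono hx (i := i + 1) (j := q) hiq hq
      linarith
    · exact hE.bound 1 (by omega) y ⟨hp0.trans_lt hy.1, hy.2.trans_le hqN⟩
    · rw [Real.sqrt_div hβ.le]
      simp only [pow_one, pow_zero, one_mul, sub_zero]
      field_simp

omit hΛ hξ hξ0 hξ1 in
lemma width_weakLayer_pow_le : (mu k β ε / n) ^ k * (ε ^ (k - 1))⁻¹ ≤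
    (4 * (1 + 1 / β)) ^ k * ((4 * n : ℕ) : ℝ)⁻¹ ^ k := by
  have hε := h.ε_pos
  have hN := h.N_pos
  rw [div_eq_mul_one_div, h.inv_n, mul_pow, mul_inv_le_iff₀ (by positivity)]
  calc mu k β ε ^ k * (4 * ((4 * n : ℕ) : ℝ)⁻¹) ^ k
      ≤ ((1 + 1 / β) ^ k * ε ^ (k - 1)) * (4 * ((4 * n : ℕ) : ℝ)⁻¹) ^ k := by
        gcongr; exact h.mu_pow_le
    _ = _ := by rw [mul_pow, mul_pow]; ring

/-- The orders `m` in `(1, 1 + μ)` and `m'` in `(1 + μ, 2)` stay free. Each further order trades a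
mesh width against a factor `ε⁻¹`, and several trades are needed later. -/
lemma L2norm_weakLayer_le (hW : IsWeakLayer (k + 1) β ε K W) {m m' : ℕ} (hm : m ≤ k)
    (hm' : m' ≤ k) :
    L2norm (fun y => W y - interp ξ (4 * n) (node k β σ ε (4 * n) φ) W y) (Ico 0 2) ≤
      ENNReal.ofReal ((1 + Λ) * (K * (√ε / √β) *
        ((mu k β ε / n) ^ (m + 1) * (ε ^ m)⁻¹ +
          (4 * ((4 * n : ℕ) : ℝ)⁻¹) ^ (m' + 1) * (ε ^ m')⁻¹ * ((4 * n : ℕ) : ℝ)⁻¹ ^ (k - 1)))) ∧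
    L2norm (fun y => iteratedDeriv 1 W y - interpDeriv ξ (4 * n) (node k β σ ε (4 * n) φ) W y)
        (Ico 0 2) ≤
      ENNReal.ofReal ((1 + Λ) * (K * (√ε / √β) *
        ((mu k β ε / n) ^ m * (ε ^ m)⁻¹ +
          (4 * ((4 * n : ℕ) : ℝ)⁻¹) ^ m' * (ε ^ m')⁻¹ * ((4 * n : ℕ) : ℝ)⁻¹ ^ (k - 1)))) := by
  have hβ := h.β_pos
  have hε := h.ε_pos
  have hK := hW.K_nonneg hε
  have hN := h.N_pos
  have hmu := h.mu_nonneg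
  have hmu' := h.mu_le
  have hΛ0 := hΛ.1
  have hx := h.node_le_succ
  have hn := h.n_pos
  have hn' : (0 : ℝ) < n := by exact_mod_cast hn
  have x0 := node_zero (k := k) (β := β) (σ := σ) (ε := ε) h.meshFunction
  have x2 := node_two_mul (k := k) (β := β) (σ := σ) (ε := ε) hn h.meshFunction
  have x3 := node_three_mul (k := k) (β := β) (σ := σ) (ε := ε) hn h.meshFunction
  have x4 := node_last (k := k) (β := β) (σ := σ) (ε := ε) hn h.meshFunction
  have hcl := hW.hasChain_left
  have hcr := hW.hasChain_right hβ hε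
  have hsplit : ∀ v, L2norm v (Ico 0 2) ≤ L2norm v (Ico 0 1) +
      (L2norm v (Ico 1 (1 + mu k β ε)) + L2norm v (Ico (1 + mu k β ε) 2)) := by
    intro v
    rw [← Ico_union_Ico_eq_Ico (zero_le_one' ℝ) one_le_two,
      ← Ico_union_Ico_eq_Ico (by linarith : (1 : ℝ) ≤ 1 + mu k β ε) (by linarith)]
    exact (L2norm_union_le _ _ _).trans (add_le_add le_rfl (L2norm_union_le _ _ _))
  -- Left of `1` the function is zero, so amplitude `A = 0` serves with arbitrary `H` and `α`.
  have hA := hΛ.L2norm_layer_le (D := fun ℓ => iteratedDeriv ℓ W) (p := 0) (q := 2 * n) (m := 0)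
    (H := 1) (A := 0) (α := 1) (s := 0) hξ hξ0 hξ1 hx (Nat.zero_le _) (by omega) x0.ge x2.le
    (Nat.zero_le _) (hcl.mono le_rfl le_rfl (by omega)) zero_le_one le_rfl one_pos
    (fun i _ hi => by
      have h1 := mesh_mono hx (Nat.zero_le i) (by omega : i ≤ 4 * n)
      have h2 := mesh_mono hx (i := i + 1) (j := 2 * n) hi (by omega)
      rw [x0] at h1; rw [x2] at h2; linarith)
    (fun y hy => by
      rw [x0, x2] at hy
      rw [iteratedDeriv_eq_zero_of_eq_zero isOpen_Ioo hW.eq_zero _ hy]; simp)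
  have hb : ∀ m ≤ k, ∀ y ∈ Ioo (1 : ℝ) 2, |iteratedDeriv (m + 1) W y| ≤
      K * (ε ^ m)⁻¹ * Real.exp (-(β / ε) * (y - 1)) := by
    intro m hm y hy
    refine (hW.bound (m + 1) (by omega) y hy).trans (le_of_eq ?_)
    rw [pow_succ]; field_simp
  have hB := hΛ.L2norm_layer_le (D := fun ℓ => iteratedDeriv ℓ W) (p := 2 * n) (q := 3 * n) (m := m)
    (H := mu k β ε / n) (A := K * (ε ^ m)⁻¹) (α := β / ε) (s := 1) hξ hξ0 hξ1 hx (by omega)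
    (by omega) x2.ge (by rw [x3]; linarith) hm (hcr.mono le_rfl le_rfl (by omega))
    (by positivity) (by positivity) (by positivity)
    (fun i h1 h2 => (width_weakLayer hn h.meshFunction h1 h2).le)
    (fun y hy => by
      rw [x2, x3] at hy
      exact hb m hm y ⟨hy.1, by linarith [hy.2]⟩)
  have hC := hΛ.L2norm_layer_le (D := fun ℓ => iteratedDeriv ℓ W) (p := 3 * n) (q := 4 * n)
    (m := m') (H := 1 / n) (A := K * (ε ^ m')⁻¹) (α := β / ε) (s := 1) hξ hξ0 hξ1 hx (by omega)
    (by omega) (by rw [x3]; linarith) x4.le hm' (hcr.mono le_rfl le_rfl (by omega))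
    (by positivity) (by positivity) (by positivity)
    (fun i h1 h2 => by
      rw [width_right hn h.meshFunction h1]; gcongr; linarith)
    (fun y hy => by
      rw [x3, x4] at hy
      exact hb m' hm' y ⟨by linarith [hy.1], hy.2⟩)
  rw [x0, x2] at hA
  rw [x2, x3] at hB
  rw [x3, x4, h.inv_n] at hC
  have hexp := h.exp_mu_le
  have e1 : (1 : ℝ) + mu k β ε - 1 = mu k β ε := by ring
  rw [e1] at hC
  rw [sub_self, mul_zero, Real.exp_zero] at hB
  have comb : ∀ {a b c : ℝ≥0∞} {P Q : ℝ}, a ≤ 0 → 0 ≤ P → 0 ≤ Q →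
      b ≤ ENNReal.ofReal ((1 + Λ) * (P * (K * (ε ^ m)⁻¹) * 1 / √(β / ε))) →
      c ≤ ENNReal.ofReal ((1 + Λ) * (Q * (K * (ε ^ m')⁻¹) *
        Real.exp (-(β / ε) * mu k β ε) / √(β / ε))) →
      a + (b + c) ≤ ENNReal.ofReal ((1 + Λ) * (K * (√ε / √β) *
        (P * (ε ^ m)⁻¹ + Q * (ε ^ m')⁻¹ * ((4 * n : ℕ) : ℝ)⁻¹ ^ (k - 1)))) := by
    intro a b c P Q ha hP hQ hb hc
    refine (add_le_add ha (add_le_add hb hc)).trans ?_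
    rw [zero_add, ← ENNReal.ofReal_add (by positivity) (by positivity)]
    refine ENNReal.ofReal_le_ofReal ?_
    have e2 : ∀ z : ℝ, z / √(β / ε) = √ε / √β * z := by
      intro z; rw [Real.sqrt_div hβ.le]; field_simp
    rw [e2, e2]
    calc (1 + Λ) * (√ε / √β * (P * (K * (ε ^ m)⁻¹) * 1)) + (1 + Λ) * (√ε / √β *
            (Q * (K * (ε ^ m')⁻¹) * Real.exp (-(β / ε) * mu k β ε)))
        ≤ (1 + Λ) * (√ε / √β * (P * (K * (ε ^ m)⁻¹) * 1)) + (1 + Λ) * (√ε / √β *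
            (Q * (K * (ε ^ m')⁻¹) * ((4 * n : ℕ) : ℝ)⁻¹ ^ (k - 1))) := by gcongr
      _ = _ := by ring
  constructor
  · exact (hsplit _).trans (comb (hA.1.trans (by simp)) (by positivity) (by positivity) hB.1 hC.1)
  · exact (hsplit _).trans (comb (hA.2.trans (by simp)) (by positivity) (by positivity) hB.2 hC.2)

lemma L2norm_smooth_le {D : ℕ → ℝ → ℝ} (h1 : HasChain 0 1 (k + 1) S D)
    (h2 : HasChain 1 2 (k + 1) S D)
    (hK : L2norm (D (k + 1)) (Ioo 0 1) + L2norm (D (k + 1)) (Ioo 1 2) ≤ ENNReal.ofReal K) :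
    L2norm (fun y => S y - interp ξ (4 * n) (node k β σ ε (4 * n) φ) S y) (Ico 0 2) ≤
      ENNReal.ofReal ((1 + Λ) *
        (h₁ k β σ ε (4 * n) φ + 4 * ((4 * n : ℕ) : ℝ)⁻¹) ^ (k + 1) * K) ∧
    L2norm (fun y => D 1 y - interpDeriv ξ (4 * n) (node k β σ ε (4 * n) φ) S y) (Ico 0 2) ≤
      ENNReal.ofReal ((1 + Λ) *
        (h₁ k β σ ε (4 * n) φ + 4 * ((4 * n : ℕ) : ℝ)⁻¹) ^ k * K) := by
  have hn := h.n_pos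
  have hx := h.node_le_succ
  have hΛ0 := hΛ.1
  have x0 := node_zero (k := k) (β := β) (σ := σ) (ε := ε) h.meshFunction
  have x2 := node_two_mul (k := k) (β := β) (σ := σ) (ε := ε) hn h.meshFunction
  have x4 := node_last (k := k) (β := β) (σ := σ) (ε := ε) hn h.meshFunction
  have hH := width_le (k := k) hn h.β_pos h.σ_pos h.ε_pos h.meshFunction h.lam_nonneg h.mu_nonneg
    h.mu_le
  have hh := h₁_nonneg (k := k) hn h.β_pos h.σ_pos h.ε_pos h.meshFunction
  rw [h.inv_n] at hH
  have hN := h.N_pos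
  set H := h₁ k β σ ε (4 * n) φ + 4 * ((4 * n : ℕ) : ℝ)⁻¹ with hHdef
  have hH0 : 0 ≤ H := by positivity
  have hG : ∀ r i, i < 4 * n → ∀ y,
      (node k β σ ε (4 * n) φ (i + 1) - node k β σ ε (4 * n) φ i) ^ r * |D (k + 1) y| ≤
        |H ^ r * D (k + 1) y| := by
    intro r i hi y
    rw [abs_mul, abs_of_nonneg (pow_nonneg hH0 r)]
    have := sub_nonneg.2 (hx i hi)
    gcongr
    exact hH i
  have hIoo : ∀ a b : ℝ, L2norm (D (k + 1)) (Ico a b) = L2norm (D (k + 1)) (Ioo a b) := by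
    intro a b; unfold L2norm; rw [Measure.restrict_congr_set Ioo_ae_eq_Ico]
  have comb : ∀ (v : ℝ → ℝ) (r : ℕ),
      L2norm v (Ico 0 1) ≤ ENNReal.ofReal (1 + Λ) *
        L2norm (fun y => H ^ r * D (k + 1) y) (Ico 0 1) →
      L2norm v (Ico 1 2) ≤ ENNReal.ofReal (1 + Λ) *
        L2norm (fun y => H ^ r * D (k + 1) y) (Ico 1 2) →
      L2norm v (Ico 0 2) ≤ ENNReal.ofReal ((1 + Λ) * H ^ r * K) := by
    intro v r hv1 hv2
    rw [← Ico_union_Ico_eq_Ico (zero_le_one' ℝ) one_le_two]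
    refine ((L2norm_union_le _ _ _).trans (add_le_add hv1 hv2)).trans ?_
    rw [L2norm_const_mul, L2norm_const_mul, hIoo, hIoo, ← mul_add, ← mul_add,
      abs_of_nonneg (pow_nonneg hH0 r), mul_assoc (1 + Λ), ENNReal.ofReal_mul (by positivity),
      ENNReal.ofReal_mul (by positivity)]
    gcongr
  constructor
  · refine comb _ (k + 1) ?_ ?_
    · have := hΛ.L2norm_region_le hξ hξ0 hξ1 hx (p := 0) (q := 2 * n) (by omega) (by omega)
        x0.ge x2.le le_rfl h1 (fun i _ hi y _ => hG (k + 1) i (by omega) y)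
      rwa [x0, x2] at this
    · have := hΛ.L2norm_region_le hξ hξ0 hξ1 hx (p := 2 * n) (q := 4 * n) (by omega) (by omega)
        x2.ge x4.le le_rfl h2 (fun i _ hi y _ => hG (k + 1) i (by omega) y)
      rwa [x2, x4] at this
  · refine comb _ k ?_ ?_
    · have := hΛ.L2norm_region_deriv_le hξ hξ0 hξ1 hx (p := 0) (q := 2 * n) (by omega) (by omega)
        x0.ge x2.le le_rfl h1 (fun i _ hi y _ => hG k i (by omega) y)
      rwa [x0, x2] at this
    · have := hΛ.L2norm_region_deriv_le hξ hξ0 hξ1 hx (p := 2 * n) (q := 4 * n) (by omega)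
        (by omega) x2.ge x4.le le_rfl h2 (fun i _ hi y _ => hG k i (by omega) y)
      rwa [x2, x4] at this

end IsAdmissible

/-! ### Assembly of the estimates -/

/-- The domain without the point where the parts of the solution may jump. -/
def brokenDomain : Set ℝ := Ioo 0 1 ∪ Ioo 1 2

lemma measurableSet_brokenDomain : MeasurableSet brokenDomain :=
  measurableSet_Ioo.union measurableSet_Ioo

lemma brokenDomain_subset_Ico : brokenDomain ⊆ Ico 0 2 := by
  rintro y (⟨h1, h2⟩ | ⟨h1, h2⟩) <;> constructor <;> linarith

lemma L2norm_Ioo_eq_brokenDomain (v : ℝ → ℝ) : L2norm v (Ioo 0 2) = L2norm v brokenDomain := by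
  have : Ioo (0 : ℝ) 2 =ᵐ[volume] brokenDomain := by
    have hne : ∀ᵐ y : ℝ, y ≠ 1 := by simp [ae_iff, measure_singleton]
    filter_upwards [hne] with y hy
    refine propext ⟨fun h => ?_, fun h => ?_⟩
    · rcases lt_or_gt_of_ne hy with h1 | h1
      · exact Or.inl ⟨h.1, h1⟩
      · exact Or.inr ⟨h1, h.2⟩
    · rcases h with ⟨h1, h2⟩ | ⟨h1, h2⟩ <;> constructor <;> linarith
  unfold L2norm; rw [Measure.restrict_congr_set this]

lemma L2norm_add_three_le {v a b c : ℝ → ℝ} {A B C : ℝ}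
    (ha : AEStronglyMeasurable a (volume.restrict brokenDomain))
    (hb : AEStronglyMeasurable b (volume.restrict brokenDomain))
    (hc : AEStronglyMeasurable c (volume.restrict brokenDomain))
    (hv : ∀ y ∈ brokenDomain, v y = a y + b y + c y)
    (hA : L2norm a (Ico 0 2) ≤ ENNReal.ofReal A) (hB : L2norm b (Ico 0 2) ≤ ENNReal.ofReal B)
    (hC : L2norm c (Ico 0 2) ≤ ENNReal.ofReal C) (hA0 : 0 ≤ A) (hB0 : 0 ≤ B) (hC0 : 0 ≤ C) :
    L2norm v (Ioo 0 2) ≤ ENNReal.ofReal (A + B + C) := by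
  rw [L2norm_Ioo_eq_brokenDomain, L2norm_congr_ae measurableSet_brokenDomain
    (Eventually.of_forall hv), ENNReal.ofReal_add (by positivity) hC0, ENNReal.ofReal_add hA0 hB0]
  refine (L2norm_add_le (ha.add hb) hc).trans (add_le_add ((L2norm_add_le ha hb).trans
    (add_le_add ?_ ?_)) ?_)
  · exact (L2norm_mono_set brokenDomain_subset_Ico).trans hA
  · exact (L2norm_mono_set brokenDomain_subset_Ico).trans hB
  · exact (L2norm_mono_set brokenDomain_subset_Ico).trans hC

section Broken
variable {m : ℕ} {v : ℝ → ℝ} {D : ℕ → ℝ → ℝ}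

lemma aestronglyMeasurable_brokenDomain (h1 : HasChain 0 1 (m + 1) v D)
    (h2 : HasChain 1 2 (m + 1) v D) :
    AEStronglyMeasurable v (volume.restrict brokenDomain) ∧
      AEStronglyMeasurable (D 1) (volume.restrict brokenDomain) :=
  ⟨aestronglyMeasurable_union_iff.2 ⟨h1.aestronglyMeasurable, h2.aestronglyMeasurable⟩,
    aestronglyMeasurable_union_iff.2
      ⟨h1.aestronglyMeasurable_deriv, h2.aestronglyMeasurable_deriv⟩⟩

end Broken

lemma interp_add_of_mem {k N : ℕ} {ξ : Fin (k + 1) → ℝ} (hξ : StrictMono ξ)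
    (hξ0 : ξ 0 = 0) (hξ1 : ξ (Fin.last k) = 1) {x : ℕ → ℝ} (hx : ∀ i < N, x i ≤ x (i + 1))
    {p q : ℕ} (hpq : p ≤ q) (hq : q ≤ N) {m : ℕ} {u v w : ℝ → ℝ} {D G : ℕ → ℝ → ℝ}
    (hv : HasChain (x p) (x q) (m + 1) v D) (hw : HasChain (x p) (x q) (m + 1) w G)
    (hu : ∀ y ∈ Ioo (x p) (x q), u y = v y + w y) {y : ℝ} (hy : y ∈ Ico (x p) (x q)) :
    interp ξ N x u y = interp ξ N x v y + interp ξ N x w y ∧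
      interpDeriv ξ N x u y = interpDeriv ξ N x v y + interpDeriv ξ N x w y := by
  obtain ⟨i, hpi, hiq, hyi⟩ := exists_mem_cell hpq hy
  have h1 := mesh_mono hx hpi (by omega : i ≤ N)
  have h2 := mesh_mono hx (i := i + 1) (j := q) hiq hq
  have hadd := cellInterp_add hξ hξ0 hξ1 (hyi.1.trans_lt hyi.2) (hv.mono h1 h2 le_rfl)
    (hw.mono h1 h2 le_rfl) fun z hz => hu z (Ioo_subset_Ioo h1 h2 hz)
  have hi : i < N := by omega
  simp only [interp_of_mem hx hi hyi, interpDeriv_of_mem hx hi hyi, hadd, Polynomial.derivative_add,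
    Polynomial.eval_add, and_self]

/-- The two bounds balance at `ε = ν`, where both equal `ν^(k+1/2)`. This gives an order for the
weak layer that is uniform in `ε`. -/
lemma sqrt_mul_pow_min_le {ε ν : ℝ} (hν : 0 < ν) (k : ℕ) :
    √ε * ν ^ k ≤ √ν * ν ^ k ∨ √ε * ε⁻¹ * ν ^ (k + 1) ≤ √ν * ν ^ k := by
  rcases le_total ε ν with h | h
  · left; gcongr
  · right
    have h1 : √ε * ε⁻¹ = (√ε)⁻¹ := by
      rw [← div_eq_mul_inv, Real.sqrt_div_self]
    have h2 : √ν * √ν = ν := Real.mul_self_sqrt hν.le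
    have h3 : (√ε)⁻¹ ≤ (√ν)⁻¹ := inv_anti₀ (Real.sqrt_pos.2 hν) (Real.sqrt_le_sqrt h)
    have h4 : 0 < √ν := Real.sqrt_pos.2 hν
    calc √ε * ε⁻¹ * ν ^ (k + 1) ≤ (√ν)⁻¹ * ν ^ (k + 1) := by rw [h1]; gcongr
      _ = (√ν)⁻¹ * (ν ^ k * (√ν * √ν)) := by rw [h2, pow_succ]
      _ = _ := by field_simp

namespace IsAdmissible
variable {k n : ℕ} {ξ : Fin (k + 1) → ℝ} {β σ ε K K₁ Λ γ : ℝ} {φ : ℝ → ℝ} {u S E W : ℝ → ℝ}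

/-- The constant in the bounds for the strong layer. -/
def strongConst (k : ℕ) (β σ K K₁ Λ : ℝ) : ℝ :=
  (1 + Λ) * (K * ((1 + K₁) * (1 + layerConst β σ K₁)) ^ (k + 1) * √(2 * σ / β)) +
    2 * ((1 + Λ) * K * (1 + (√β)⁻¹ + 2 / β))

/-- The constant in the bounds for the weak layer. -/
def weakConst (k : ℕ) (β K Λ : ℝ) : ℝ :=
  (1 + Λ) * (K * (√β)⁻¹ * (4 * (4 * (1 + 1 / β)) ^ k + 16))

section Facts
variable (h : IsAdmissible k n β σ ε K₁ φ)
include h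

lemma Y_nonneg : 0 ≤ ((4 * n : ℕ) : ℝ)⁻¹ * maxAbsDerivPsi φ :=
  mul_nonneg (inv_nonneg.2 h.N_pos.le) (zero_le_one.trans h.one_le_M)

lemma inv_N_le_one : ((4 * n : ℕ) : ℝ)⁻¹ ≤ 1 := inv_le_one_of_one_le₀ h.one_le_N

lemma one_le_sqrt_mul_inv : 1 ≤ √ε * ε⁻¹ := by
  have hε := h.ε_pos
  rw [← div_eq_mul_inv, one_le_div hε, Real.le_sqrt' hε]
  nlinarith [h.ε_le_one]

lemma sqrt_le_one : √ε ≤ 1 := Real.sqrt_le_one.2 h.ε_le_one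

lemma layerConst_nonneg : 0 ≤ layerConst β σ K₁ := by
  have := h.σ_pos; have := h.β_pos
  unfold layerConst; positivity

lemma strongConst_nonneg (hK : 0 ≤ K) (hΛ : 0 ≤ Λ) : 0 ≤ strongConst k β σ K K₁ Λ := by
  have := h.σ_pos; have := h.β_pos; have := h.layerConst_nonneg; have := h.K₁_nonneg
  unfold strongConst; positivity

lemma weakConst_nonneg (hK : 0 ≤ K) (hΛ : 0 ≤ Λ) : 0 ≤ weakConst k β K Λ := by
  have := h.β_pos
  unfold weakConst; positivity

lemma inv_N_pow_le_rpow {Q p : ℝ} (hQ : ((4 * n : ℕ) : ℝ)⁻¹ ≤ Q) (hp : 0 ≤ p) {m : ℕ}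
    (hpm : p ≤ m) : ((4 * n : ℕ) : ℝ)⁻¹ ^ m ≤ Q ^ p := by
  have hν := inv_pos.2 h.N_pos
  rw [← Real.rpow_natCast]
  exact (Real.rpow_le_rpow_of_exponent_ge hν h.inv_N_le_one hpm).trans
    (Real.rpow_le_rpow hν.le hQ hp)

end Facts

variable (h : IsAdmissible k n β σ ε K₁ φ) (hΛ : IsLebesgueBound ξ Λ) (hξ : StrictMono ξ)
  (hξ0 : ξ 0 = 0) (hξ1 : ξ (Fin.last k) = 1)
include h hΛ hξ hξ0 hξ1

/-- The orders `m = k - 1`, `m' = 0` give the bound with `√ε`; `m = k`, `m' = 1` give one more power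
of `N⁻¹` for a factor `ε⁻¹`, and also the derivative bound. -/
lemma L2norm_weakLayer_bounds (hW : IsWeakLayer (k + 1) β ε K W) :
    (L2norm (fun y => W y - interp ξ (4 * n) (node k β σ ε (4 * n) φ) W y) (Ico 0 2) ≤
      ENNReal.ofReal (weakConst k β K Λ * (√ε * ((4 * n : ℕ) : ℝ)⁻¹ ^ k))) ∧
    (L2norm (fun y => W y - interp ξ (4 * n) (node k β σ ε (4 * n) φ) W y) (Ico 0 2) ≤
      ENNReal.ofReal (weakConst k β K Λ * (√ε * ε⁻¹ * ((4 * n : ℕ) : ℝ)⁻¹ ^ (k + 1)))) ∧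
    (L2norm (fun y => iteratedDeriv 1 W y - interpDeriv ξ (4 * n) (node k β σ ε (4 * n) φ) W y)
        (Ico 0 2) ≤
      ENNReal.ofReal (weakConst k β K Λ * (√ε * ε⁻¹ * ((4 * n : ℕ) : ℝ)⁻¹ ^ k))) := by
  have hβ := h.β_pos
  have hε := h.ε_pos
  have hk := h.one_le_k
  have hK := hW.K_nonneg hε
  have hΛ0 := hΛ.1
  have hmu := h.mu_nonneg
  have hw := h.width_weakLayer_pow_le
  have hwν : mu k β ε / n ≤ 4 * ((4 * n : ℕ) : ℝ)⁻¹ := by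
    rw [← h.inv_n]
    have := h.mu_le
    gcongr; linarith
  have hν := inv_pos.2 h.N_pos
  have ha := (h.L2norm_weakLayer_le hΛ hξ hξ0 hξ1 hW (m := k - 1) (m' := 0) (by omega) (by omega)).1
  obtain ⟨hb, hc⟩ := h.L2norm_weakLayer_le hΛ hξ hξ0 hξ1 hW (m := k) (m' := 1) le_rfl hk
  set ν := ((4 * n : ℕ) : ℝ)⁻¹
  set c4 := (4 * (1 + 1 / β)) ^ k with hc4
  have hc40 : 0 ≤ c4 := by positivity
  have hp1 : ν * ν ^ (k - 1) = ν ^ k := by rw [← pow_succ', Nat.sub_add_cancel hk]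
  have hp2 : ε⁻¹ * (ε ^ (k - 1))⁻¹ = (ε ^ k)⁻¹ := by
    rw [← mul_inv, ← pow_succ', Nat.sub_add_cancel hk]
  have hμ0 : 0 ≤ mu k β ε / n := by positivity
  have fin : ∀ {z t : ℝ}, z ≤ (4 * c4 + 16) * t →
      (1 + Λ) * (K * (√ε / √β) * z) ≤ weakConst k β K Λ * (√ε * t) := by
    intro z t hz
    calc (1 + Λ) * (K * (√ε / √β) * z) ≤ (1 + Λ) * (K * (√ε / √β) * ((4 * c4 + 16) * t)) := by
          gcongr
      _ = _ := by rw [weakConst, ← hc4]; ring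
  refine ⟨ha.trans (ENNReal.ofReal_le_ofReal (fin ?_)),
    hb.trans (ENNReal.ofReal_le_ofReal ?_), hc.trans (ENNReal.ofReal_le_ofReal ?_)⟩
  · rw [Nat.sub_add_cancel hk]
    have e : (4 * ν) ^ (0 + 1) * (ε ^ 0)⁻¹ * ν ^ (k - 1) = 4 * ν ^ k := by rw [← hp1]; simp; ring
    rw [e]
    nlinarith [pow_pos hν k]
  · rw [mul_assoc √ε]
    refine fin ?_
    have e : (4 * ν) ^ (1 + 1) * (ε ^ 1)⁻¹ * ν ^ (k - 1) = 16 * (ε⁻¹ * ν ^ (k + 1)) := by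
      rw [pow_succ ν k, ← hp1, pow_one]; ring
    have e2 : (mu k β ε / n) ^ (k + 1) * (ε ^ k)⁻¹ ≤ 4 * c4 * (ε⁻¹ * ν ^ (k + 1)) := by
      calc (mu k β ε / n) ^ (k + 1) * (ε ^ k)⁻¹ =
            (mu k β ε / n) * ((mu k β ε / n) ^ k * (ε ^ (k - 1))⁻¹) * ε⁻¹ := by
            rw [← hp2]; ring
        _ ≤ (4 * ν) * (c4 * ν ^ k) * ε⁻¹ := by gcongr
        _ = _ := by ring
    rw [e]
    linarith
  · rw [mul_assoc √ε]
    refine fin ?_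
    have e : (4 * ν) ^ 1 * (ε ^ 1)⁻¹ * ν ^ (k - 1) = 4 * (ε⁻¹ * ν ^ k) := by
      rw [← hp1, pow_one, pow_one]; ring
    have e2 : (mu k β ε / n) ^ k * (ε ^ k)⁻¹ ≤ c4 * (ε⁻¹ * ν ^ k) := by
      calc (mu k β ε / n) ^ k * (ε ^ k)⁻¹ =
            ((mu k β ε / n) ^ k * (ε ^ (k - 1))⁻¹) * ε⁻¹ := by rw [← hp2]; ring
        _ ≤ (c4 * ν ^ k) * ε⁻¹ := by gcongr
        _ = _ := by ring
    rw [e]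
    have : 0 < ε⁻¹ * ν ^ k := by positivity
    nlinarith

/-- On `(1, 2)` there are two bounds for `E`: one uniform in `ε`, and one with the factor `√ε` that
is needed on `(1, 1 + μ)`. -/
lemma L2norm_strongLayer_tail_bounds (hE : IsStrongLayer (k + 1) β ε K E) :
    (L2norm (fun y => E y - interp ξ (4 * n) (node k β σ ε (4 * n) φ) E y)
        (Ico (lam β σ ε (4 * n)) 1) ≤
      ENNReal.ofReal ((1 + Λ) * K * ((4 * n : ℕ) : ℝ)⁻¹ ^ (k + 1))) ∧
    (L2norm (fun y => iteratedDeriv 1 E y - interpDeriv ξ (4 * n) (node k β σ ε (4 * n) φ) E y)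
        (Ico (lam β σ ε (4 * n)) 1) ≤
      ENNReal.ofReal ((1 + Λ) * K * (√β)⁻¹ * (√ε * ε⁻¹ * ((4 * n : ℕ) : ℝ)⁻¹ ^ (k + 1)))) ∧
    (L2norm (fun y => E y - interp ξ (4 * n) (node k β σ ε (4 * n) φ) E y) (Ico 1 2) ≤
      ENNReal.ofReal ((1 + Λ) * K * ((4 * n : ℕ) : ℝ)⁻¹ ^ (k + 1))) ∧
    (L2norm (fun y => E y - interp ξ (4 * n) (node k β σ ε (4 * n) φ) E y) (Ico 1 2) ≤
      ENNReal.ofReal ((1 + Λ) * K * (2 / β) * (√ε * ((4 * n : ℕ) : ℝ)⁻¹ ^ (k + 1)))) ∧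
    (L2norm (fun y => iteratedDeriv 1 E y - interpDeriv ξ (4 * n) (node k β σ ε (4 * n) φ) E y)
        (Ico 1 2) ≤
      ENNReal.ofReal ((1 + Λ) * K * (√β)⁻¹ * (√ε * ε⁻¹ * ((4 * n : ℕ) : ℝ)⁻¹ ^ (k + 1)))) := by
  have hβ := h.β_pos
  have hε := h.ε_pos
  have hK := hE.K_nonneg
  have hΛ0 := hΛ.1
  have x1 := node_last_strongLayer (k := k) (β := β) (σ := σ) (ε := ε) h.n_pos h.meshFunction
  have x2 := node_two_mul (k := k) (β := β) (σ := σ) (ε := ε) h.n_pos h.meshFunction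
  have x4 := node_last (k := k) (β := β) (σ := σ) (ε := ε) h.n_pos h.meshFunction
  have hl := h.lam_nonneg
  have hl' := h.lam_le
  obtain ⟨a1, a2⟩ := h.L2norm_strongLayer_tail_le hΛ hξ hξ0 hξ1 hE (p := n) (q := 2 * n) (by omega)
    (by omega) (by rw [x1, x2]; linarith)
  obtain ⟨b1, b2⟩ := h.L2norm_strongLayer_tail_le hΛ hξ hξ0 hξ1 hE (p := 2 * n) (q := 4 * n)
    (by omega) (by omega) (by rw [x2, x4]; norm_num)
  rw [x1, x2] at a1 a2
  rw [x2, x4, mul_one] at b1 b2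
  have e1 := h.exp_lam_le
  have e2 : Real.exp (-(β / ε)) ≤ ((4 * n : ℕ) : ℝ)⁻¹ ^ (k + 1) := by
    refine le_trans (Real.exp_le_exp.2 ?_) e1
    have : 0 < β / ε := by positivity
    nlinarith
  have e3 := h.exp_le_sqrt
  refine ⟨a1.trans (ENNReal.ofReal_le_ofReal ?_), a2.trans (ENNReal.ofReal_le_ofReal ?_),
    b1.trans (ENNReal.ofReal_le_ofReal ?_), b1.trans (ENNReal.ofReal_le_ofReal ?_),
    b2.trans (ENNReal.ofReal_le_ofReal ?_)⟩
  · rw [mul_assoc]; gcongr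
  · rw [mul_assoc (1 + Λ) K, mul_assoc (1 + Λ), div_eq_mul_inv K]; gcongr
  · rw [mul_assoc]; gcongr
  · calc _ ≤ (1 + Λ) * (K * (2 / β * √ε * ((4 * n : ℕ) : ℝ)⁻¹ ^ (k + 1))) := by gcongr
      _ = _ := by ring
  · rw [mul_assoc (1 + Λ) K, mul_assoc (1 + Λ), div_eq_mul_inv K]; gcongr

lemma L2norm_strongLayer_total_le (hE : IsStrongLayer (k + 1) β ε K E) {p : ℝ} (hp : 0 ≤ p)
    (hpk : p ≤ k + 1 / 2) :
    L2norm (fun y => E y - interp ξ (4 * n) (node k β σ ε (4 * n) φ) E y) (Ico 0 2) ≤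
      ENNReal.ofReal (strongConst k β σ K K₁ Λ *
        (((4 * n : ℕ) : ℝ)⁻¹ * maxAbsDerivPsi φ) ^ p) := by
  have hβ := h.β_pos
  have hK := hE.K_nonneg
  have hΛ0 := hΛ.1
  have hK1 := h.K₁_nonneg
  have hlc := h.layerConst_nonneg
  have hY := h.Y_nonneg
  have hl := h.lam_nonneg
  have hl' := h.lam_le
  have hν := inv_pos.2 h.N_pos
  have hE1 := h.L2norm_strongLayer_le hΛ hξ hξ0 hξ1 hE hp hpk
  obtain ⟨a, -, b, -⟩ := h.L2norm_strongLayer_tail_bounds hΛ hξ hξ0 hξ1 hE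
  rw [← Ico_union_Ico_eq_Ico hl (by linarith : lam β σ ε (4 * n) ≤ 2),
    ← Ico_union_Ico_eq_Ico (by linarith : lam β σ ε (4 * n) ≤ 1) one_le_two]
  refine ((L2norm_union_le _ _ _).trans (add_le_add hE1 ((L2norm_union_le _ _ _).trans
    (add_le_add a b)))).trans ?_
  rw [← ENNReal.ofReal_add (by positivity) (by positivity),
    ← ENNReal.ofReal_add (by positivity) (by positivity)]
  refine ENNReal.ofReal_le_ofReal ?_
  have e1 := h.inv_N_pow_le_rpow h.inv_N_pow_le hp (m := k + 1) (by push_cast; linarith)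
  have e2 : √ε * (((4 * n : ℕ) : ℝ)⁻¹ * maxAbsDerivPsi φ) ^ p ≤
      (((4 * n : ℕ) : ℝ)⁻¹ * maxAbsDerivPsi φ) ^ p :=
    mul_le_of_le_one_left (Real.rpow_nonneg hY p) h.sqrt_le_one
  set Yp := (((4 * n : ℕ) : ℝ)⁻¹ * maxAbsDerivPsi φ) ^ p
  have hYp : 0 ≤ Yp := Real.rpow_nonneg hY p
  rw [strongConst, add_mul ((1 + Λ) * _)]
  refine add_le_add (mul_le_mul_of_nonneg_left e2 (by positivity)) ?_
  calc _ ≤ (1 + Λ) * K * Yp + (1 + Λ) * K * Yp := by gcongr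
    _ = 2 * ((1 + Λ) * K * 1) * Yp := by ring
    _ ≤ _ := by
      have : 0 ≤ (√β)⁻¹ + 2 / β := by positivity
      gcongr
      linarith

lemma L2norm_strongLayer_total_deriv_le (hE : IsStrongLayer (k + 1) β ε K E) :
    L2norm (fun y => iteratedDeriv 1 E y - interpDeriv ξ (4 * n) (node k β σ ε (4 * n) φ) E y)
        (Ico 0 2) ≤
      ENNReal.ofReal (strongConst k β σ K K₁ Λ *
        (√ε * ε⁻¹ * (((4 * n : ℕ) : ℝ)⁻¹ * maxAbsDerivPsi φ) ^ k)) := by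
  have hβ := h.β_pos
  have hε := h.ε_pos
  have hK := hE.K_nonneg
  have hΛ0 := hΛ.1
  have hK1 := h.K₁_nonneg
  have hlc := h.layerConst_nonneg
  have hY := h.Y_nonneg
  have hl := h.lam_nonneg
  have hl' := h.lam_le
  have hν := inv_pos.2 h.N_pos
  have hE1 := h.L2norm_strongLayer_deriv_le hΛ hξ hξ0 hξ1 hE
  obtain ⟨-, a, -, -, b⟩ := h.L2norm_strongLayer_tail_bounds hΛ hξ hξ0 hξ1 hE
  rw [← Ico_union_Ico_eq_Ico hl (by linarith : lam β σ ε (4 * n) ≤ 2),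
    ← Ico_union_Ico_eq_Ico (by linarith : lam β σ ε (4 * n) ≤ 1) one_le_two]
  refine ((L2norm_union_le _ _ _).trans (add_le_add hE1 ((L2norm_union_le _ _ _).trans
    (add_le_add a b)))).trans ?_
  rw [← ENNReal.ofReal_add (by positivity) (by positivity),
    ← ENNReal.ofReal_add (by positivity) (by positivity)]
  refine ENNReal.ofReal_le_ofReal ?_
  have e1 : ((4 * n : ℕ) : ℝ)⁻¹ ^ (k + 1) ≤ (((4 * n : ℕ) : ℝ)⁻¹ * maxAbsDerivPsi φ) ^ k :=
    (pow_le_pow_of_le_one hν.le h.inv_N_le_one (Nat.le_succ k)).trans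
      (pow_le_pow_left₀ hν.le h.inv_N_pow_le k)
  set Yk := (((4 * n : ℕ) : ℝ)⁻¹ * maxAbsDerivPsi φ) ^ k
  have hYk : 0 ≤ Yk := pow_nonneg hY k
  rw [strongConst, add_mul ((1 + Λ) * _)]
  refine add_le_add ?_ ?_
  · gcongr
    · nlinarith
    · omega
  calc _ ≤ (1 + Λ) * K * (√β)⁻¹ * (√ε * ε⁻¹ * Yk) + (1 + Λ) * K * (√β)⁻¹ * (√ε * ε⁻¹ * Yk) := by
        gcongr
    _ = 2 * ((1 + Λ) * K * (√β)⁻¹) * (√ε * ε⁻¹ * Yk) := by ring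
    _ ≤ _ := by
      have : 0 ≤ 2 / β := by positivity
      gcongr
      linarith

/-- The constant in the bounds for the whole error. -/
def totalConst (k : ℕ) (β σ K K₁ Λ : ℝ) : ℝ :=
  (1 + Λ) * 15 ^ (k + 1) * K + strongConst k β σ K K₁ Λ + weakConst k β K Λ

omit h hΛ hξ hξ0 hξ1 in
lemma totalConst_nonneg (h : IsAdmissible k n β σ ε K₁ φ) (hK : 0 ≤ K) (hΛ : 0 ≤ Λ) :
    0 ≤ totalConst k β σ K K₁ Λ := by
  have := h.strongConst_nonneg hK hΛ
  have := h.weakConst_nonneg hK hΛ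
  unfold totalConst; positivity

/-- The exponent `p` is left free because the base is not known to be at most `1`: the bound with `p
= k`, used in the energy norm, does not follow from `p = k + 1/2`. -/
lemma exists_weakDeriv_error (hd : IsDecomposition (k + 1) β ε K u S E W) :
    (∀ p : ℝ, k ≤ p → p ≤ k + 1 / 2 →
      L2norm (fun y => u y - interp ξ (4 * n) (node k β σ ε (4 * n) φ) u y) (Ioo 0 2) ≤
        ENNReal.ofReal (totalConst k β σ K K₁ Λ *
          (h₁ k β σ ε (4 * n) φ + ((4 * n : ℕ) : ℝ)⁻¹ * maxAbsDerivPsi φ) ^ p)) ∧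
    ∃ g, HasWeakDeriv 0 2 (fun y => u y - interp ξ (4 * n) (node k β σ ε (4 * n) φ) u y) g ∧
      L2norm g (Ioo 0 2) ≤ ENNReal.ofReal (totalConst k β σ K K₁ Λ * (√ε * ε⁻¹ *
          (h₁ k β σ ε (4 * n) φ + ((4 * n : ℕ) : ℝ)⁻¹ * maxAbsDerivPsi φ) ^ k)) := by
  have hβ := h.β_pos
  have hε := h.ε_pos
  have hn := h.n_pos
  have hx := h.node_le_succ
  have hE := hd.isStrongLayer hε
  have hW := hd.isWeakLayer hε
  have hK := hE.K_nonneg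
  have hΛ0 := hΛ.1
  have hs0 := h.strongConst_nonneg hK hΛ0
  have hw0 := h.weakConst_nonneg hK hΛ0
  obtain ⟨D, s1, s2, hDK⟩ := hd.bound_S.exists_hasChain
  have hEc := hE.hasChain hβ hε
  have e1 := hEc.mono (a' := 0) (b' := 1) le_rfl one_le_two le_rfl
  have e2 := hEc.mono (a' := 1) (b' := 2) zero_le_one le_rfl le_rfl
  have w1 := hW.hasChain_left
  have w2 := hW.hasChain_right hβ hε
  have se1 := s1.add (u := fun y => S y + E y) e1 fun _ _ => rfl
  have se2 := s2.add (u := fun y => S y + E y) e2 fun _ _ => rfl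
  have u1 := se1.add (u := u) w1 fun y hy => hd.eq_add y (Or.inl hy)
  have u2 := se2.add (u := u) w2 fun y hy => hd.eq_add y (Or.inr hy)
  have x0 := node_zero (k := k) (β := β) (σ := σ) (ε := ε) h.meshFunction
  have x2 := node_two_mul (k := k) (β := β) (σ := σ) (ε := ε) hn h.meshFunction
  have x4 := node_last (k := k) (β := β) (σ := σ) (ε := ε) hn h.meshFunction
  have hI : ∀ y ∈ brokenDomain,
      interp ξ (4 * n) (node k β σ ε (4 * n) φ) u y =
        interp ξ (4 * n) (node k β σ ε (4 * n) φ) S y +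
        interp ξ (4 * n) (node k β σ ε (4 * n) φ) E y +
        interp ξ (4 * n) (node k β σ ε (4 * n) φ) W y ∧
      interpDeriv ξ (4 * n) (node k β σ ε (4 * n) φ) u y =
        interpDeriv ξ (4 * n) (node k β σ ε (4 * n) φ) S y +
        interpDeriv ξ (4 * n) (node k β σ ε (4 * n) φ) E y +
        interpDeriv ξ (4 * n) (node k β σ ε (4 * n) φ) W y := by
    rintro y (hy | hy)
    · have hy' := Ioo_subset_Ico_self hy
      have hy'' : ∀ y ∈ Ioo (0 : ℝ) 1, u y = (S y + E y) + W y := fun y hy =>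
        hd.eq_add y (Or.inl hy)
      rw [← x0, ← x2] at hy' hy'' se1 w1 s1 e1
      obtain ⟨i1, i2⟩ := interp_add_of_mem hξ hξ0 hξ1 hx (by omega) (by omega) se1 w1 hy'' hy'
      obtain ⟨j1, j2⟩ := interp_add_of_mem (u := fun y => S y + E y) hξ hξ0 hξ1 hx (by omega)
        (by omega) s1 e1 (fun _ _ => rfl) hy'
      exact ⟨by rw [i1, j1], by rw [i2, j2]⟩
    · have hy' := Ioo_subset_Ico_self hy
      have hy'' : ∀ y ∈ Ioo (1 : ℝ) 2, u y = (S y + E y) + W y := fun y hy =>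
        hd.eq_add y (Or.inr hy)
      rw [← x2, ← x4] at hy' hy'' se2 w2 s2 e2
      obtain ⟨i1, i2⟩ := interp_add_of_mem hξ hξ0 hξ1 hx (by omega) (by omega) se2 w2 hy'' hy'
      obtain ⟨j1, j2⟩ := interp_add_of_mem (u := fun y => S y + E y) hξ hξ0 hξ1 hx (by omega)
        (by omega) s2 e2 (fun _ _ => rfl) hy'
      exact ⟨by rw [i1, j1], by rw [i2, j2]⟩
  obtain ⟨mS, mS'⟩ := aestronglyMeasurable_brokenDomain s1 s2
  obtain ⟨mE, mE'⟩ := aestronglyMeasurable_brokenDomain e1 e2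
  obtain ⟨mW, mW'⟩ := aestronglyMeasurable_brokenDomain w1 w2
  have mI : ∀ v, AEStronglyMeasurable (interp ξ (4 * n) (node k β σ ε (4 * n) φ) v)
      (volume.restrict brokenDomain) := fun v =>
    (measurable_interp ξ _ _ v).aestronglyMeasurable
  have mI' : ∀ v, AEStronglyMeasurable (interpDeriv ξ (4 * n) (node k β σ ε (4 * n) φ) v)
      (volume.restrict brokenDomain) := fun v =>
    (measurable_interpDeriv ξ _ _ v).aestronglyMeasurable
  obtain ⟨bS, bS'⟩ := h.L2norm_smooth_le hΛ hξ hξ0 hξ1 s1 s2 (hDK (k + 1) le_rfl)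
  obtain ⟨bW, bW2, bW'⟩ := h.L2norm_weakLayer_bounds hΛ hξ hξ0 hξ1 hW
  have bE' := h.L2norm_strongLayer_total_deriv_le hΛ hξ hξ0 hξ1 hE
  have hh := h₁_nonneg (k := k) hn hβ h.σ_pos hε h.meshFunction
  have hhl := (h₁_le_lam (k := k) hn hβ h.σ_pos hε h.meshFunction).trans h.lam_le
  have hY := h.Y_nonneg
  have hνY := h.inv_N_pow_le
  have hν := inv_pos.2 h.N_pos
  have hν1 := h.inv_N_le_one
  have hν4 : 4 * ((4 * n : ℕ) : ℝ)⁻¹ ≤ 1 := by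
    rw [← h.inv_n]
    exact div_le_one_of_le₀ (by exact_mod_cast hn) (by positivity)
  have hsε := h.one_le_sqrt_mul_inv
  have bE := fun {p : ℝ} => h.L2norm_strongLayer_total_le hΛ hξ hξ0 hξ1 hE (p := p)
  have hrpow := fun {Q p : ℝ} => h.inv_N_pow_le_rpow (Q := Q) (p := p)
  set ν := ((4 * n : ℕ) : ℝ)⁻¹
  set Y := ν * maxAbsDerivPsi φ
  set hm := h₁ k β σ ε (4 * n) φ
  have hQ : 0 ≤ hm + Y := by positivity
  have hνQ : ν ≤ hm + Y := by linarith
  refine ⟨fun p hp hpk => ?_, _, hasWeakDeriv_interp_error hξ hξ0 hξ1 hx x0 x4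
    (r := 2 * n) (by omega) x2 hd.continuousOn_u u1 u2, ?_⟩
  · have hp0 : 0 ≤ p := le_trans (by positivity) hp
    have hQp : 0 ≤ (hm + Y) ^ p := Real.rpow_nonneg hQ p
    have cS : (1 + Λ) * (hm + 4 * ν) ^ (k + 1) * K ≤ (1 + Λ) * 15 ^ (k + 1) * K * (hm + Y) ^ p := by
      -- Here `hm ≤ 1/2` and `4 * ν ≤ 1`, so the base is below `2`, and it is at most `4 * (hm +
      -- Y)`. The constant is `15 = (1 + 2) * (1 + 4)`.
      have := pow_le_of_layer (w := hm + 4 * ν) (K₁ := 2) (c := 4) (Y := hm + Y) (θ := 0) (p := p)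
        (m := k + 1) (by positivity) (by linarith) (by norm_num) hQ
        (by rw [Real.exp_zero]; linarith) hp0 (by push_cast; linarith)
      rw [← mul_pow, mul_zero, Real.exp_zero, mul_one] at this
      norm_num at this
      calc (1 + Λ) * (hm + 4 * ν) ^ (k + 1) * K ≤ (1 + Λ) * (15 ^ (k + 1) * (hm + Y) ^ p) * K := by
            gcongr
        _ = _ := by ring
    have cE : L2norm (fun y => E y - interp ξ (4 * n) (node k β σ ε (4 * n) φ) E y) (Ico 0 2) ≤
        ENNReal.ofReal (strongConst k β σ K K₁ Λ * (hm + Y) ^ p) := by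
      refine (bE hp0 hpk).trans (ENNReal.ofReal_le_ofReal ?_)
      gcongr
      linarith
    have cν : √ν * ν ^ k ≤ (hm + Y) ^ p := by
      rw [Real.sqrt_eq_rpow, ← Real.rpow_natCast, ← Real.rpow_add hν]
      exact (Real.rpow_le_rpow_of_exponent_ge hν hν1 (by linarith)).trans
        (Real.rpow_le_rpow hν.le hνQ hp0)
    have cW : L2norm (fun y => W y - interp ξ (4 * n) (node k β σ ε (4 * n) φ) W y) (Ico 0 2) ≤
        ENNReal.ofReal (weakConst k β K Λ * (hm + Y) ^ p) := by
      -- Which of the two weak layer bounds is good enough depends on whether `ε` or `N⁻¹` is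
      -- smaller.
      rcases sqrt_mul_pow_min_le (ε := ε) hν k with hc | hc
      · exact bW.trans (ENNReal.ofReal_le_ofReal (mul_le_mul_of_nonneg_left (hc.trans cν) hw0))
      · exact bW2.trans (ENNReal.ofReal_le_ofReal (mul_le_mul_of_nonneg_left (hc.trans cν) hw0))
    rw [totalConst, add_mul, add_mul]
    refine L2norm_add_three_le (mS.sub (mI S)) (mE.sub (mI E)) (mW.sub (mI W)) (fun y hy => ?_)
      (bS.trans (ENNReal.ofReal_le_ofReal cS)) cE cW (by positivity) (by positivity)
      (by positivity)
    simp only [Pi.sub_apply]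
    rw [hd.eq_add y hy, (hI y hy).1]; ring
  · have hQk : 0 ≤ (hm + Y) ^ k := pow_nonneg hQ k
    have cS : (1 + Λ) * (hm + 4 * ν) ^ k * K ≤
        (1 + Λ) * 15 ^ (k + 1) * K * (√ε * ε⁻¹ * (hm + Y) ^ k) := by
      -- The factor `1` makes room for `1 ≤ √ε * ε⁻¹`, by which the smooth part fits the scaling of
      -- the layers.
      have c1 : (hm + 4 * ν) ^ k ≤ 15 ^ (k + 1) * (1 * (hm + Y) ^ k) := by
        calc (hm + 4 * ν) ^ k ≤ (15 * (hm + Y)) ^ k := by gcongr; linarith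
          _ = 15 ^ k * (1 * (hm + Y) ^ k) := by rw [mul_pow, one_mul]
          _ ≤ _ := by gcongr <;> norm_num
      calc (1 + Λ) * (hm + 4 * ν) ^ k * K
          ≤ (1 + Λ) * (15 ^ (k + 1) * (√ε * ε⁻¹ * (hm + Y) ^ k)) * K := by
            gcongr
            exact c1.trans (by gcongr)
        _ = _ := by ring
    have hYQ : Y ≤ hm + Y := by linarith
    have cE : strongConst k β σ K K₁ Λ * (√ε * ε⁻¹ * Y ^ k) ≤
        strongConst k β σ K K₁ Λ * (√ε * ε⁻¹ * (hm + Y) ^ k) := by gcongr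
    have cW : weakConst k β K Λ * (√ε * ε⁻¹ * ν ^ k) ≤
        weakConst k β K Λ * (√ε * ε⁻¹ * (hm + Y) ^ k) := by gcongr
    rw [totalConst, add_mul, add_mul]
    refine L2norm_add_three_le (mS'.sub (mI' S)) (mE'.sub (mI' E)) (mW'.sub (mI' W))
      (fun y hy => ?_)
      (bS'.trans (ENNReal.ofReal_le_ofReal cS)) (bE'.trans (ENNReal.ofReal_le_ofReal cE))
      (bW'.trans (ENNReal.ofReal_le_ofReal cW)) (by positivity) (by positivity)
      (by positivity)
    simp only [Pi.sub_apply]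
    rw [(hI y hy).2]; ring

/-- Squaring `√ε * ε⁻¹` gives `ε⁻¹`, which the weight `ε` cancels. One weak derivative `g` suffices
to bound the infimum in `energyNorm`. -/
lemma energyNorm_error_le (hγ : 0 < γ) (hd : IsDecomposition (k + 1) β ε K u S E W) :
    energyNorm ε γ (fun y => u y - interp ξ (4 * n) (node k β σ ε (4 * n) φ) u y) ≤
      ENNReal.ofReal (√(1 + γ) * totalConst k β σ K K₁ Λ *
        (h₁ k β σ ε (4 * n) φ + ((4 * n : ℕ) : ℝ)⁻¹ * maxAbsDerivPsi φ) ^ k) := by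
  have hε := h.ε_pos
  have hK := (hd.isStrongLayer hε).K_nonneg
  have hT := h.totalConst_nonneg hK hΛ.1
  have hh := h₁_nonneg (k := k) h.n_pos h.β_pos h.σ_pos hε h.meshFunction
  have hY := h.Y_nonneg
  obtain ⟨hL, g, hg, hgL⟩ := h.exists_weakDeriv_error hΛ hξ hξ0 hξ1 hd
  have hL := hL k le_rfl (by linarith)
  rw [Real.rpow_natCast] at hL
  set T := totalConst k β σ K K₁ Λ
  set Q := h₁ k β σ ε (4 * n) φ + ((4 * n : ℕ) : ℝ)⁻¹ * maxAbsDerivPsi φ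
  have hQ : 0 ≤ Q := by positivity
  refine (iInf₂_le g hg).trans ?_
  calc _ ≤ (ENNReal.ofReal ε * ENNReal.ofReal (T * (√ε * ε⁻¹ * Q ^ k)) ^ 2 +
        ENNReal.ofReal γ * ENNReal.ofReal (T * Q ^ k) ^ 2) ^ (1 / 2 : ℝ) := by gcongr
    _ = ENNReal.ofReal ((1 + γ) * (T * Q ^ k) ^ 2) ^ (1 / 2 : ℝ) := by
        rw [← ENNReal.ofReal_pow (by positivity), ← ENNReal.ofReal_pow (by positivity),
          ← ENNReal.ofReal_mul hε.le, ← ENNReal.ofReal_mul hγ.le,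
          ← ENNReal.ofReal_add (by positivity) (by positivity)]
        congr 2
        have : √ε ^ 2 = ε := Real.sq_sqrt hε.le
        have e : ε * (T * (√ε * ε⁻¹ * Q ^ k)) ^ 2 = ε * ε⁻¹ ^ 2 * √ε ^ 2 * (T * Q ^ k) ^ 2 := by
          ring
        rw [e, this]
        field_simp
    _ = _ := by
        rw [ENNReal.ofReal_rpow_of_nonneg (by positivity) (by norm_num), ← Real.sqrt_eq_rpow,
          Real.sqrt_mul (by positivity), Real.sqrt_sq (by positivity), mul_assoc]

end IsAdmissible

end CoarseMesh

end

/-! ### The theorem -/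

/-- The finite bound on `energyNorm` includes the existence of a weak derivative in `L²`: the
infimum over an empty family is infinite, and `ε > 0`. -/
theorem mainTheorem5 (k : ℕ) (hk : 1 ≤ k)
    (ξ : Fin (k + 1) → ℝ) (hξ : StrictMono ξ) (hξ0 : ξ 0 = 0) (hξ1 : ξ (Fin.last k) = 1)
    (β γ σ : ℝ) (hβ : 0 < β) (hγ : 0 < γ) (hσ : (k : ℝ) + 1 ≤ σ) (K K₁ : ℝ) :
    ∃ C : ℝ, 0 < C ∧
      ∀ (ε : ℝ) (N : ℕ) (φ : ℝ → ℝ) (u S E W : ℝ → ℝ),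
        0 < ε → ε ≤ 1 → 0 < N → 4 ∣ N →
        CoarseMesh.IsMeshFunction N φ →
        CoarseMesh.lam β σ ε N ≤ 1 / 2 →
        CoarseMesh.mu k β ε ≤ 1 / 2 →
        CoarseMesh.h₁ k β σ ε N φ ≤ K₁ * ε →
        Real.exp (-ε ^ (-1 / (k : ℝ))) ≤ (N : ℝ) ^ (1 - (k : ℝ)) →
        CoarseMesh.IsDecomposition (k + 1) β ε K u S E W →
        let lam : ℝ := CoarseMesh.lam β σ ε N
        let mu : ℝ := CoarseMesh.mu k β ε
        let h₁ : ℝ := CoarseMesh.h₁ k β σ ε N φ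
        let M : ℝ := CoarseMesh.maxAbsDerivPsi φ
        let I : (ℝ → ℝ) → ℝ → ℝ := CoarseMesh.interp ξ N (CoarseMesh.node k β σ ε N φ)
        CoarseMesh.L2norm (u - I u) (Ioo 0 2)
            ≤ ENNReal.ofReal (C * (h₁ + (N : ℝ)⁻¹ * M) ^ ((k : ℝ) + 1 / 2)) ∧
        CoarseMesh.energyNorm ε γ (u - I u)
            ≤ ENNReal.ofReal (C * (h₁ + (N : ℝ)⁻¹ * M) ^ k) ∧
        CoarseMesh.L2norm (W - I W) (Ioo 0 2)
            ≤ ENNReal.ofReal (C * (ε ^ (1 / 2 : ℝ) * (N : ℝ)⁻¹ ^ k)) ∧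
        CoarseMesh.L2norm (E - I E) (Ioo lam 1 ∪ Ioo (1 + mu) 2)
            ≤ ENNReal.ofReal (C * (N : ℝ)⁻¹ ^ (k + 1)) ∧
        CoarseMesh.L2norm (E - I E) (Ioo 0 lam ∪ Ioo 1 (1 + mu))
            ≤ ENNReal.ofReal (C * (ε ^ (1 / 2 : ℝ) * ((N : ℝ)⁻¹ * M) ^ k)) := by
  obtain ⟨Λ, hΛ⟩ := CoarseMesh.exists_isLebesgueBound ξ
  set T := CoarseMesh.IsAdmissible.totalConst k β σ K K₁ Λ
  set s := CoarseMesh.IsAdmissible.strongConst k β σ K K₁ Λ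
  set w := CoarseMesh.IsAdmissible.weakConst k β K Λ
  -- Absolute values are needed because `C` is chosen before any mesh or decomposition shows that
  -- `K` and `K₁` are nonnegative.
  refine ⟨1 + |T| + |√(1 + γ) * T| + |w| + |2 * ((1 + Λ) * K)| + |s|, by positivity, ?_⟩
  intro ε N φ u S E W hε hε1 hN hdvd hφ hlam hmu hh₁ hexp hd
  obtain ⟨n, rfl⟩ := hdvd
  have h : CoarseMesh.IsAdmissible k n β σ ε K₁ φ :=
    ⟨hk, by omega, hβ, hσ, hε, hε1, hφ, hlam, hmu, hh₁, hexp⟩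
  have hE := hd.isStrongLayer hε
  have hW := hd.isWeakLayer hε
  have hK := hE.K_nonneg
  have hΛ0 := hΛ.1
  have hY := h.Y_nonneg
  have hν := inv_pos.2 h.N_pos
  have hH := CoarseMesh.h₁_nonneg (k := k) h.n_pos hβ h.σ_pos hε hφ
  have a1 := abs_nonneg T
  have a2 := abs_nonneg (√(1 + γ) * T)
  have a3 := abs_nonneg w
  have a4 := abs_nonneg (2 * ((1 + Λ) * K))
  have a5 := abs_nonneg s
  have hle : ∀ {L : ENNReal} {c X : ℝ}, L ≤ ENNReal.ofReal (c * X) → 0 ≤ X →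
      c ≤ 1 + |T| + |√(1 + γ) * T| + |w| + |2 * ((1 + Λ) * K)| + |s| →
      L ≤ ENNReal.ofReal ((1 + |T| + |√(1 + γ) * T| + |w| + |2 * ((1 + Λ) * K)| + |s|) * X) :=
    fun hL hX hc => hL.trans (ENNReal.ofReal_le_ofReal (mul_le_mul_of_nonneg_right hc hX))
  obtain ⟨t1, -, t2, t3, -⟩ := h.L2norm_strongLayer_tail_bounds hΛ hξ hξ0 hξ1 hE
  refine ⟨?_, ?_, ?_, ?_, ?_⟩
  · refine hle ((h.exists_weakDeriv_error hΛ hξ hξ0 hξ1 hd).1 _ (by linarith) le_rfl)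
      (by positivity) ?_
    linarith [le_abs_self T]
  · refine hle (h.energyNorm_error_le hΛ hξ hξ0 hξ1 hγ hd) (by positivity) ?_
    linarith [le_abs_self (√(1 + γ) * T)]
  · rw [← Real.sqrt_eq_rpow]
    refine hle ((CoarseMesh.L2norm_mono_set Ioo_subset_Ico_self).trans
      (h.L2norm_weakLayer_bounds hΛ hξ hξ0 hξ1 hW).1) (by positivity) ?_
    linarith [le_abs_self w]
  -- The factor `2` counts the intervals `(λ, 1)` and `(1 + μ, 2)`.
  · refine hle (c := 2 * ((1 + Λ) * K)) ?_ (by positivity)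
      (by linarith [le_abs_self (2 * ((1 + Λ) * K))])
    refine (CoarseMesh.L2norm_union_le _ _ _).trans ((add_le_add
      ((CoarseMesh.L2norm_mono_set Ioo_subset_Ico_self).trans t1)
      ((CoarseMesh.L2norm_mono_set (Ioo_subset_Ico_self.trans
        (Ico_subset_Ico_left ?_))).trans t2)).trans ?_)
    · linarith [h.mu_nonneg]
    · rw [← ENNReal.ofReal_add (by positivity) (by positivity)]
      exact ENNReal.ofReal_le_ofReal (le_of_eq (by ring))
  · rw [← Real.sqrt_eq_rpow]
    refine hle (c := s) ?_ (by positivity) (by linarith [le_abs_self s])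
    -- On `(0, λ)` the admissible exponent `p = k` is enough. On `(1, 1 + μ)` the tail bound `t3`
    -- over `(1, 2)` already carries `√ε`.
    have t0 := h.L2norm_strongLayer_le hΛ hξ hξ0 hξ1 hE (p := k) (by positivity) (by linarith)
    rw [Real.rpow_natCast] at t0
    refine (CoarseMesh.L2norm_union_le _ _ _).trans ((add_le_add
      ((CoarseMesh.L2norm_mono_set Ioo_subset_Ico_self).trans t0)
      ((CoarseMesh.L2norm_mono_set (Ioo_subset_Ico_self.trans
        (Ico_subset_Ico_right ?_))).trans t3)).trans ?_)
    · linarith [h.mu_le]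
    · have hK1 := h.K₁_nonneg
      have hlc := h.layerConst_nonneg
      have hσ0 := h.σ_pos
      rw [← ENNReal.ofReal_add (by positivity) (by positivity)]
      refine ENNReal.ofReal_le_ofReal ?_
      have e1 : ((4 * n : ℕ) : ℝ)⁻¹ ^ (k + 1) ≤
          (((4 * n : ℕ) : ℝ)⁻¹ * CoarseMesh.maxAbsDerivPsi φ) ^ k :=
        (pow_le_pow_of_le_one hν.le h.inv_N_le_one (Nat.le_succ k)).trans
          (pow_le_pow_left₀ hν.le h.inv_N_pow_le k)
      set Yk := (((4 * n : ℕ) : ℝ)⁻¹ * CoarseMesh.maxAbsDerivPsi φ) ^ k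
      have hYk : 0 ≤ Yk := pow_nonneg hY k
      have e2 : (1 + Λ) * K * (2 / β) ≤ 2 * ((1 + Λ) * K * (1 + (√β)⁻¹ + 2 / β)) := by
        have h1 : 0 ≤ (√β)⁻¹ := by positivity
        have h2 : 0 ≤ 2 / β := by positivity
        have h3 : 0 ≤ (1 + Λ) * K := by positivity
        nlinarith [mul_nonneg h3 h1, mul_nonneg h3 h2]
      have e3 : s = _ := CoarseMesh.IsAdmissible.strongConst.eq_1 k β σ K K₁ Λ
      rw [e3, add_mul ((1 + Λ) * _)]
      gcongr
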